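/- **Setting.** Let $V,H,U$ be real separable Hilbert spaces with a dense, continuous injective embedding $V\hookrightarrow H$, and identify $H=H^*\hookrightarrow V^*$. Let $a:V\times V\to\mathbb R$ be a bounded bilinear form with $a(x,x)\le-\kappa\|x\|_V^2$ for some $\kappa>0$ and all $x\in V$, and let $A:V\to V^*$, $\langle x,Ay\rangle_{V,V^*}=a(x,y)$; as an operator in $V^*$ with domain $V$ it generates a $C_0$-semigroup $e^{tA}$ on $V^*$. Let $r>0$, $L^2_r=L^2([-r,0];V)$, $\mathcal H=H\times L^2_r$, and write $x_t(\theta)=x(t+\theta)$ for $\theta\in[-r,0]$. Let $D_1\in\mathscr L(V)$, $D_2\in\mathscr L(L^2_r,V)$, $F_1\in\mathscr L(V,V^*)$, $F_2\in\mathscr L(L^2_r,V^*)$, $Dx_t=D_1x(t-r)+D_2x_t$, $Fx_t=F_1x(t-r)+F_2x_t$. Let $\Phi\in\mathscr L(U,H)$ and $\mathcal Bu=(\Phi u,0)\in\mathcal H$. **Noise.** Let $0<\alpha<\frac12$ and let $K:\mathbb R^2\to\mathbb R$ be an $\alpha$-regular Volterra kernel: $K$ is measurable, $K(t,\rho)=0$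 for $t<\rho$, $K(t,\rho)\to0$ as $t\to\rho+$, $K(\cdot,\rho)$ is $C^1$ on $(\rho,\infty)$, and $|\partial_uK(u,\rho)|\le C(u-\rho)^{\alpha-1}$ for $\rho<u$, with $C$ independent of $u,\rho$. Let $B=(B_t)_{t\in\mathbb R}$ be an $\alpha$-regular $U$-cylindrical Volterra process on a probability space $(\Omega,\mathscr F,\mathbb P)$ with kernel $K$, i.e. bounded operators $B_t:U\to L^2(\Omega)$ with $\mathbb E B_t(u)=0$, $B_0(u)=0$ and $$\mathbb E\,(B_{t_1}(u_1)-B_{s_1}(u_1))(B_{t_2}(u_2)-B_{s_2}(u_2))=\langle u_1,u_2\rangle_U\int_{\mathbb R}(K(t_1,\rho)-K(s_1,\rho))(K(t_2,\rho)-K(s_2,\rho))\,d\rho .$$ For a real process $b=B(u)$ with $\|u\|_U=1$, the Wiener integral $\int f\,db$ of $f:\mathbb R\to E$, $E$ a Hilbert space, is the extension of $\sum_jf_j\mathbf 1_{[t_{j-1},t_j)}\mapsto\sum_jf_j(b_{t_j}-b_{t_{j-1}})\in L^2(\Omega;E)$ by continuity along the norm $\|\mathscr K^*f\|_{L^2(\mathbb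 R;E)}$, $(\mathscr K^*f)(\rho)=\int_\rho^\infty f(u)\,\partial_uK(u,\rho)\,du$. For $G:\mathbb R\to\mathscr L(U,E)$ one sets $\int G\,dB=\sum_k\int G(s)e_k\,dB(s)(e_k)$, for each orthonormal basis $(e_k)$ of $U$, with convergence in $L^2(\Omega;E)$. **Neutral equation.** Let $T\ge0$ and $\phi=(\phi_0,\phi_1)\in L^2(\Omega;\mathcal H)$ (in particular, any deterministic $\phi\in\mathcal H$). A (mild) solution on $[-r,T]$ of $$d(x(t)-Dx_t)=A(x(t)-Dx_t)\,dt+Fx_t\,dt+\Phi\,dB(t),\qquad x(0)=\phi_0+D\phi_1,\quad x_0=\phi_1 \tag{3.1}$$ is a process $x\in L^2([-r,T]\times\Omega;V)$ with $x_0=\phi_1$ a.s., together with an $H$-valued process $y$ that represents $x(t)-Dx_t$ (that is, $y(t)=x(t)-Dx_t$ a.s. for a.e. $t\in[0,T]$), such that for every $t\in[0,T]$ one has $y(t)\in L^2(\Omega;H)$, the stochastic integral below exists and, a.s. in $V^*$, $$y(t)=e^{tA}\phi_0+\int_0^te^{(t-s)A}Fx_s\,ds+\int_0^te^{(t-s)A}\Phi\,dB(s).$$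 **Abstract equation.** Let $\mathcal A$ be the operator in $\mathcal H$ with domain $$\mathscr D(\mathcal A)=\{(\phi_0,\phi_1)\in\mathcal H:\ \phi_1\in W^{1,2}([-r,0];V),\ \phi_0=\phi_1(0)-D\phi_1\in V,\ A\phi_0+F\phi_1\in H\},\qquad \mathcal A\phi=(A\phi_0+F\phi_1,\phi_1').$$ A (mild) solution on $[0,T]$ of $dX=\mathcal AX\,dt+\mathcal B\,dB$, $X(0)=\phi$ (equation (3.2)), is an $\mathcal H$-valued process $X$ such that $\mathcal A$ generates a $C_0$-semigroup $\mathcal S$ on $\mathcal H$ and, for every $t\in[0,T]$, the stochastic integral below exists and $X(t)=\mathcal S(t)\phi+\int_0^t\mathcal S(t-s)\mathcal B\,dB(s)$ a.s. **Proposition 3.1.** For every $T\ge0$, if $x$ is a solution of (3.1) on $[-r,T]$, then the process $X(t)=(x(t)-Dx_t,\,x_t)$, $t\in[0,T]$ (with $x(t)-Dx_t$ represented by $y(t)$), is a solution on $[0,T]$ of the abstract Cauchy problem (3.2) with $X(0)=\phi$. -/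

import Mathlib

open MeasureTheory Set Filter Topology
open scoped ENNReal

noncomputable section

/-! ### Strongly continuous semigroups -/

section Semigroup

variable {E : Type*} [NormedAddCommGroup E] [NormedSpace ℝ E]

/-- `S` (only its values at `t ≥ 0` matter) is a strongly continuous semigroup on `E` whose
infinitesimal generator is exactly the operator with graph `𝒢`: a point `x` is in the domain with
image `z`, i.e. `(x, z) ∈ 𝒢`, if and only if `(S h x - x) / h → z` as `h → 0+`. -/
structure IsC0SemigroupGeneratedBy (𝒢 : Set (E × E)) (S : ℝ → E →L[ℝ] E) : Prop where
  zero : S 0 = ContinuousLinearMap.id ℝ E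
  add : ∀ s t : ℝ, 0 ≤ s → 0 ≤ t → S (s + t) = (S s).comp (S t)
  tendsto_zero : ∀ x : E, Tendsto (fun t => S t x) (𝓝[>] 0) (𝓝 x)
  generator : ∀ x z : E,
    (x, z) ∈ 𝒢 ↔ Tendsto (fun h : ℝ => h⁻¹ • (S h x - x)) (𝓝[>] 0) (𝓝 z)

end Semigroup

/-! ### Regular Volterra kernels, cylindrical Volterra processes, Wiener integrals -/

/-- The partial derivative `∂K/∂u (u, ρ)`. -/
def kernelDeriv (K : ℝ → ℝ → ℝ) (u ρ : ℝ) : ℝ := deriv (fun v => K v ρ) u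

/-- `K` is an `α`-regular Volterra kernel. -/
structure IsRegularVolterraKernel (α : ℝ) (K : ℝ → ℝ → ℝ) : Prop where
  alpha_pos : 0 < α
  alpha_lt : α < 1 / 2
  measurable : Measurable (Function.uncurry K)
  eq_zero : ∀ t ρ : ℝ, t < ρ → K t ρ = 0
  tendsto_diag : ∀ ρ : ℝ, Tendsto (fun t => K t ρ) (𝓝[>] ρ) (𝓝 0)
  contDiffOn : ∀ ρ : ℝ, ContDiffOn ℝ 1 (fun t => K t ρ) (Ioi ρ)
  deriv_bound : ∃ C : ℝ, 0 < C ∧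
    ∀ u ρ : ℝ, ρ < u → |kernelDeriv K u ρ| ≤ C * (u - ρ) ^ (α - 1)

/-- `R(s₁, t₁, s₂, t₂) = ∫ (K(t₁, ρ) - K(s₁, ρ)) (K(t₂, ρ) - K(s₂, ρ)) dρ`. -/
def volterraCov (K : ℝ → ℝ → ℝ) (s₁ t₁ s₂ t₂ : ℝ) : ℝ :=
  ∫ ρ, (K t₁ ρ - K s₁ ρ) * (K t₂ ρ - K s₂ ρ)

section Noise

variable {Ω : Type*} [MeasurableSpace Ω] {P : Measure Ω}
variable {U : Type*} [NormedAddCommGroup U] [InnerProductSpace ℝ U]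
variable {E : Type*} [NormedAddCommGroup E] [NormedSpace ℝ E]

/-- `W` is a (two-sided) `U`-cylindrical Volterra process with kernel `K`: a family of bounded
operators `W t : U → L²(Ω)`, centered, vanishing at time zero, with the prescribed covariance. -/
structure IsCylindricalVolterra (K : ℝ → ℝ → ℝ) (W : ℝ → U →L[ℝ] Lp ℝ 2 P) : Prop where
  centered : ∀ (t : ℝ) (u : U), ∫ ω, W t u ω ∂P = 0
  zero : ∀ u : U, W 0 u = 0
  covariance : ∀ (s₁ t₁ s₂ t₂ : ℝ) (u₁ u₂ : U),
    ∫ ω, (W t₁ u₁ ω - W s₁ u₁ ω) * (W t₂ u₂ ω - W s₂ u₂ ω) ∂P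
      = volterraCov K s₁ t₁ s₂ t₂ * inner ℝ u₁ u₂

/-- Data of a step function `∑ⱼ fⱼ 1_{[tⱼ₋₁, tⱼ)}` with `t₀ < t₁ < ⋯ < tₙ`. -/
structure StepData (E : Type*) where
  n : ℕ
  node : Fin (n + 1) → ℝ
  strictMono : StrictMono node
  val : Fin n → E

/-- The step function `∑ⱼ fⱼ 1_{[tⱼ₋₁, tⱼ)}`. -/
def StepData.toFun (f : StepData E) (s : ℝ) : E :=
  ∑ k : Fin f.n, (Ico (f.node k.castSucc) (f.node k.succ)).indicator (fun _ => f.val k) s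

/-- The elementary integral `i(f) = ∑ⱼ fⱼ (b_{tⱼ} - b_{tⱼ₋₁})`. -/
def StepData.integral (f : StepData E) (b : ℝ → Lp ℝ 2 P) (ω : Ω) : E :=
  ∑ k : Fin f.n, (b (f.node k.succ) ω - b (f.node k.castSucc) ω) • f.val k

/-- `(𝒦* f)(ρ) = ∫_ρ^∞ f(u) ∂K/∂u(u, ρ) du`. -/
def kernelAdjoint (K : ℝ → ℝ → ℝ) (f : ℝ → E) (ρ : ℝ) : E :=
  ∫ u in Ioi ρ, kernelDeriv K u ρ • f u

/-- `I` is the Wiener integral `∫ f db` of `f : ℝ → E` with respect to the scalar process `b` with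
kernel `K`: the value at `f` of the extension of the elementary integral by continuity along the
norm `‖𝒦* f‖_{L²(ℝ; E)}`. The function `f` has to be admissible: `𝒦* f` is given by a convergent
integral at almost every point, and it is an `L²`-limit of images of step functions. -/
def IsWienerIntegral (K : ℝ → ℝ → ℝ) (b : ℝ → Lp ℝ 2 P) (f : ℝ → E) (I : Lp E 2 P) : Prop :=
  (∀ᵐ ρ : ℝ, IntegrableOn (fun u => kernelDeriv K u ρ • f u) (Ioi ρ)) ∧
  ∃ g : ℕ → StepData E,
    Tendsto (fun n => eLpNorm
      (fun ρ => kernelAdjoint K (g n).toFun ρ - kernelAdjoint K f ρ) 2 volume) atTop (𝓝 0) ∧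
    Tendsto (fun n => eLpNorm (fun ω => (g n).integral b ω - I ω) 2 P) atTop (𝓝 0)

/-- `I` is the Wiener integral `∫ G dW` of an operator-valued integrand `G s : U → E` with respect
to the cylindrical process `W`: for each orthonormal basis `(eₖ)` of `U`, all the integrals
`∫ G(s) eₖ dW(s)(eₖ)` exist and their sum over `k` converges to `I` in `L²(Ω; E)`. -/
def IsCylWienerIntegral (K : ℝ → ℝ → ℝ) (W : ℝ → U →L[ℝ] Lp ℝ 2 P) (G : ℝ → U → E)
    (I : Lp E 2 P) : Prop :=
  ∀ (w : Set U) (e : HilbertBasis w ℝ U), ∃ J : w → Lp E 2 P,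
    (∀ k, IsWienerIntegral K (fun t => W t (e k)) (fun s => G s (e k)) (J k)) ∧ HasSum J I

/-- `I` is the stochastic convolution `∫₀ᵗ S(t - s) Φ dW(s)`. -/
def IsStochConvolution (K : ℝ → ℝ → ℝ) (W : ℝ → U →L[ℝ] Lp ℝ 2 P) (S : ℝ → E →L[ℝ] E)
    (Φ : U → E) (t : ℝ) (I : Lp E 2 P) : Prop :=
  IsCylWienerIntegral K W
    (fun s u => (Ico 0 t).indicator (fun s' => S (t - s') (Φ u)) s) I

/-- `X` is a mild solution on `[0, T]` of `dX = 𝒜 X dt + Φ dW`, `X(0) = φ`, where `𝒜` is the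
operator with graph `𝒢`: the operator `𝒜` generates a strongly continuous semigroup `S`, and for
each `t ∈ [0, T]` the stochastic convolution exists and, almost surely,
`X(t) = S(t) φ + ∫₀ᵗ S(t - s) Φ dW(s)`. -/
def IsMildCauchySolution (K : ℝ → ℝ → ℝ) (W : ℝ → U →L[ℝ] Lp ℝ 2 P) (𝒢 : Set (E × E))
    (Φ : U → E) (T : ℝ) (φ : Ω → E) (X : ℝ → Ω → E) : Prop :=
  ∃ S : ℝ → E →L[ℝ] E, IsC0SemigroupGeneratedBy 𝒢 S ∧
    ∀ t ∈ Icc (0 : ℝ) T, ∃ I : Lp E 2 P, IsStochConvolution K W S Φ t I ∧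
      ∀ᵐ ω ∂P, X t ω = S t (φ ω) + I ω

end Noise

/-! ### The neutral equation -/

/-- `L²_r = L²([-r, 0]; V)`. -/
abbrev SegmentSpace (V : Type*) [NormedAddCommGroup V] (r : ℝ) :=
  Lp V 2 ((volume : Measure ℝ).restrict (Icc (-r) 0))

/-- `ℋ = H × L²_r` with the Hilbert norm `(‖φ₀‖² + ‖φ₁‖²)^{1/2}`. -/
abbrev StateSpace (H V : Type*) [NormedAddCommGroup H] [NormedAddCommGroup V] (r : ℝ) :=
  WithLp 2 (H × SegmentSpace V r)

open Classical in
/-- The segment `x_t(θ) = x(t + θ)`, `θ ∈ [-r, 0]`, as an element of `L²_r` (and zero, by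
convention, if it is not square integrable). -/
def historySegment (V : Type*) [NormedAddCommGroup V] (r : ℝ) (x : ℝ → V) (t : ℝ) : SegmentSpace V r :=
  if h : MemLp (fun θ => x (t + θ)) 2 ((volume : Measure ℝ).restrict (Icc (-r) 0))
  then h.toLp _ else 0

section Neutral

variable (U V H : Type*)
  [NormedAddCommGroup U] [InnerProductSpace ℝ U]
  [NormedAddCommGroup V] [InnerProductSpace ℝ V]
  [NormedAddCommGroup H] [InnerProductSpace ℝ H]

/-- The coefficients of a neutral equation: the delay `r`, the dense continuous embedding
`j : V → H`, the coercive form `a`, the operators `D₁, D₂, F₁, F₂` and the noise coefficient `Φ`. -/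
structure NeutralSystem where
  r : ℝ
  r_pos : 0 < r
  j : V →L[ℝ] H
  j_injective : Function.Injective j
  j_dense : DenseRange j
  a : V →L[ℝ] V →L[ℝ] ℝ
  coercive : ∃ κ : ℝ, 0 < κ ∧ ∀ x : V, a x x ≤ -κ * ‖x‖ ^ 2
  D₁ : V →L[ℝ] V
  D₂ : SegmentSpace V r →L[ℝ] V
  F₁ : V →L[ℝ] StrongDual ℝ V
  F₂ : SegmentSpace V r →L[ℝ] StrongDual ℝ V
  Φ : U →L[ℝ] H

variable {U V H}

namespace NeutralSystem

variable (N : NeutralSystem U V H)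

/-- The embedding `H = H* → V*`, `h ↦ ⟨h, j ·⟩`. -/
def toDual (h : H) : StrongDual ℝ V := (innerSL ℝ h).comp N.j

/-- The operator `A : V → V*` with `⟨x, A y⟩ = a(x, y)`. -/
def A : V →L[ℝ] StrongDual ℝ V := N.a.flip

/-- The graph of `A` as an unbounded operator in `V*` with domain `V ⊂ V*`. -/
def graphA : Set (StrongDual ℝ V × StrongDual ℝ V) :=
  {p | ∃ v : V, p = (N.toDual (N.j v), N.A v)}

/-- `D x_t = D₁ x(t - r) + D₂ x_t`. -/
def delayD (x : ℝ → V) (t : ℝ) : V := N.D₁ (x (t - N.r)) + N.D₂ (historySegment V N.r x t)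

/-- `F x_t = F₁ x(t - r) + F₂ x_t`. -/
def delayF (x : ℝ → V) (t : ℝ) : StrongDual ℝ V :=
  N.F₁ (x (t - N.r)) + N.F₂ (historySegment V N.r x t)

/-- The graph of the operator `𝒜` in `ℋ`: `φ` is in the domain if and only if
`φ₁ ∈ W^{1,2}([-r, 0]; V)`, `φ₀ = φ₁(0) - D φ₁ ∈ V` and `A φ₀ + F φ₁ ∈ H`, and then
`𝒜 φ = (A φ₀ + F φ₁, φ₁')`. Here `f` is the absolutely continuous representative of `φ₁`
and `v` is `φ₀` as an element of `V`. -/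
def graphGenerator : Set (StateSpace H V N.r × StateSpace H V N.r) :=
  {p | ∃ (f : ℝ → V) (v : V),
    p.1.snd =ᵐ[(volume : Measure ℝ).restrict (Icc (-N.r) 0)] f ∧
    (∀ θ ∈ Icc (-N.r) 0, f θ = f 0 - ∫ s in θ..0, p.2.snd s) ∧
    v = f 0 - (N.D₁ (f (-N.r)) + N.D₂ p.1.snd) ∧
    p.1.fst = N.j v ∧
    N.toDual p.2.fst = N.A v + (N.F₁ (f (-N.r)) + N.F₂ p.1.snd)}

/-- The lifted noise coefficient `ℬ u = (Φ u, 0)`. -/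
def liftedNoise (u : U) : StateSpace H V N.r := WithLp.toLp 2 (N.Φ u, 0)

/-- The state process `t ↦ (y(t), x_t)`, where `y(t)` stands for `x(t) - D x_t`. -/
def state {Ω : Type*} (x : ℝ → Ω → V) (y : ℝ → Ω → H) (t : ℝ) (ω : Ω) : StateSpace H V N.r :=
  WithLp.toLp 2 (y t ω, historySegment V N.r (fun s => x s ω) t)

/-- `x` is a mild solution on `[-r, T]` of
`d(x(t) - D x_t) = A (x(t) - D x_t) dt + F x_t dt + Φ dW(t)`, `x(0) = φ₀ + D φ₁`, `x_0 = φ₁`,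
and `y` is the `H`-valued process `y(t) = x(t) - D x_t`.
As `x` is only square integrable in time with values in `V`, the expression `x(t) - D x_t` is
defined for almost every `t` only, and `y` is the version of it for which the variation of
constants formula holds at every `t` (at `t = 0` this formula is the initial condition
`x(0) - D φ₁ = φ₀`). The formula is an identity in `V*`. -/
structure IsMildSolution {Ω : Type*} [MeasurableSpace Ω] (P : Measure Ω)
    (K : ℝ → ℝ → ℝ) (W : ℝ → U →L[ℝ] Lp ℝ 2 P) (T : ℝ)
    (φ : Ω → StateSpace H V N.r) (x : ℝ → Ω → V) (y : ℝ → Ω → H) : Prop where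
  memLp_x : MemLp (fun p : ℝ × Ω => x p.1 p.2) 2
    (((volume : Measure ℝ).restrict (Icc (-N.r) T)).prod P)
  memLp_y : ∀ t ∈ Icc (0 : ℝ) T, MemLp (y t) 2 P
  initial : ∀ᵐ ω ∂P, historySegment V N.r (fun s => x s ω) 0 = (φ ω).snd
  neutral : ∀ᵐ t ∂((volume : Measure ℝ).restrict (Icc 0 T)), ∀ᵐ ω ∂P,
    y t ω = N.j (x t ω - N.delayD (fun s => x s ω) t)
  mild : ∃ S : ℝ → StrongDual ℝ V →L[ℝ] StrongDual ℝ V, IsC0SemigroupGeneratedBy N.graphA S ∧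
    ∀ t ∈ Icc (0 : ℝ) T, ∃ I : Lp (StrongDual ℝ V) 2 P,
      IsStochConvolution K W S (fun u => N.toDual (N.Φ u)) t I ∧
      ∀ᵐ ω ∂P, N.toDual (y t ω) = S t (N.toDual (φ ω).fst)
        + (∫ s in (0 : ℝ)..t, S (t - s) (N.delayF (fun σ => x σ ω) s)) + I ω

end NeutralSystem

end Neutral

end

/-!
The proof tests the claimed identity against random variables `ξ ∈ L²(Ω)`, which reduces it to a
deterministic statement.

*The deterministic equation.* If the noise is replaced by a forcing `h : [0, T] → H`, then
`Y(t) = (y(t), x_t)` is the mild solution of the abstract Cauchy problem with forcing `(h, 0)`. No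
regularity of `x` is available, so the equation is integrated in time: the integral of a mild
solution lies in the domain of the generator
(`IsC0SemigroupGeneratedBy.integral_mild_mem`). Applied in `V*`, this shows that `∫₀ᵗ Y` lies in the
domain of `𝒜`, which maps it to `Y(t) - φ - ∫₀ᵗ (h, 0)`; the segment component is the primitive of
`x_t - x_0`. The mild solution of the abstract problem satisfies the same relation, and the
difference vanishes because `𝒜` is quasi-dissipative up to an equivalent inner product
(`IsMaximalQuasiDissipative.eq_zero_of_integral_mem`). The result is
`NeutralSystem.state_eq_of_mild`; Fubini transfers it to the means `E[ξ X(t)]`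
(`NeutralSystem.IsMildSolution.mean_state_eq`).

*Generation.* On `H × L²_r` the inner product of the second component gets an affine weight that is
small at `0` and large at `-r`. The boundary term of the shift at `-r` then absorbs the point delays
in `D` and `F`, and the one at `0` is absorbed by the coercivity of `a`
(`NeutralSystem.exists_quasiDissipative_weight`). For large `l` the equation `l φ - 𝒜 φ = e` is
solved by Lax-Milgram, since the delays act as small perturbations on `e^{l ·}`
(`NeutralSystem.exists_range_bound`). The theorem of Lumer and Phillips
(`IsMaximalQuasiDissipative.exists_semigroup`), proved by Yosida approximation, gives the semigroup.

*The noise.* Integrals over `[0, t)` of continuous functions against the noise exist, because `𝒦*`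
maps bounded functions of bounded support boundedly into `L²(ℝ)` and elementary integrals are
isometric to their images under `𝒦*`. The covariance of the noise at time `τ` with such an integral
of `f` is `∫₀ᵗ g(s) f(s) ds`, where `g = kernelCorrelation K τ`
(`IsRegularVolterraKernel.lpMean_wienerIntegral_indicator`). So testing against `ξ = W τ (e k)`
replaces the noise by the forcing `h = g • Φ (e k)`, and testing against `ξ` orthogonal to the noise
replaces it by `0`. By the deterministic result, `Z = X(t) - S(t) φ` has with every `ξ` the
covariance that the integral of `S(t - ·) ℬ` would have. These covariances make the Wiener
integrals along an orthonormal basis the orthogonal projections of `Z`, so that their sum converges,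
and identify it with `Z` (`IsRegularVolterraKernel.exists_hasSum_of_lpMean`).
-/

noncomputable section

/-! ### Semigroups and their mild solutions -/

namespace IsC0SemigroupGeneratedBy

variable {E : Type*} [NormedAddCommGroup E] [NormedSpace ℝ E]
  {𝒢 : Set (E × E)} {S : ℝ → E →L[ℝ] E}

theorem tendsto_zero_right (hS : IsC0SemigroupGeneratedBy 𝒢 S) (x : E) :
    Tendsto (fun t => S t x) (𝓝[≥] 0) (𝓝 x) := by
  have h0 : ContinuousWithinAt (fun t => S t x) (Ioi 0) 0 := by
    simpa [ContinuousWithinAt, hS.zero] using hS.tendsto_zero x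
  have := continuousWithinAt_Ioi_iff_Ici.1 h0
  simpa [ContinuousWithinAt, hS.zero] using this

/-- Otherwise `‖S(tₙ)‖ → ∞` along some `tₙ → 0`, against the uniform boundedness principle. -/
theorem exists_norm_le_near_zero [CompleteSpace E] (hS : IsC0SemigroupGeneratedBy 𝒢 S) :
    ∃ δ > 0, ∃ M : ℝ, 1 ≤ M ∧ ∀ t ∈ Icc (0 : ℝ) δ, ‖S t‖ ≤ M := by
  by_contra! hcon
  have hn : ∀ n : ℕ, ∃ t ∈ Icc (0 : ℝ) (1 / (n + 1)), (n : ℝ) + 1 < ‖S t‖ := fun n =>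
    hcon (1 / (n + 1)) (by positivity) (n + 1) (by simp)
  choose u hu hun using hn
  have hu0 : Tendsto u atTop (𝓝[≥] 0) := by
    refine tendsto_nhdsWithin_iff.2 ⟨?_, Eventually.of_forall fun n => (hu n).1⟩
    exact squeeze_zero (fun n => (hu n).1) (fun n => (hu n).2)
      tendsto_one_div_add_atTop_nhds_zero_nat
  obtain ⟨C, hC⟩ := banach_steinhaus (g := fun n => S (u n)) fun x => by
    have h1 := ((hS.tendsto_zero_right x).comp hu0).norm
    obtain ⟨C, hC⟩ := h1.bddAbove_range
    exact ⟨C, fun n => hC ⟨n, rfl⟩⟩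
  obtain ⟨n, hnC⟩ := exists_nat_gt C
  linarith [hC n, hun n]

theorem exists_norm_le [CompleteSpace E] (hS : IsC0SemigroupGeneratedBy 𝒢 S) (T : ℝ) :
    ∃ M : ℝ, 1 ≤ M ∧ ∀ t ∈ Icc (0 : ℝ) T, ‖S t‖ ≤ M := by
  obtain ⟨δ, hδ, M, hM, hb⟩ := hS.exists_norm_le_near_zero
  have key : ∀ n : ℕ, ∀ t ∈ Icc (0 : ℝ) (n * δ), ‖S t‖ ≤ M ^ (n + 1) := by
    intro n
    induction n with
    | zero =>
      intro t ht
      have : t ∈ Icc (0 : ℝ) δ := ⟨ht.1, by simpa using ht.2.trans (by simpa using hδ.le)⟩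
      simpa using hb t this
    | succ n ih =>
      intro t ht
      rcases le_or_gt t δ with h | h
      · refine (hb t ⟨ht.1, h⟩).trans ?_
        exact le_self_pow₀ hM (by omega)
      · have h1 := ih (t - δ) ⟨by linarith, by
          have := ht.2; push_cast at this; linarith⟩
        have h2 : S t = (S (t - δ)).comp (S δ) := by
          rw [← hS.add _ _ (by linarith) hδ.le]; simp
        rw [h2, pow_succ]
        refine (ContinuousLinearMap.opNorm_comp_le _ _).trans ?_
        exact mul_le_mul h1 (hb δ ⟨hδ.le, le_rfl⟩) (norm_nonneg _) (by positivity)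
  obtain ⟨n, hn⟩ := exists_nat_gt (T / δ)
  refine ⟨M ^ (n + 1), one_le_pow₀ hM, fun t ht => key n t ⟨ht.1, ?_⟩⟩
  rw [div_lt_iff₀ hδ] at hn
  exact ht.2.trans hn.le

theorem norm_apply_sub_le (hS : IsC0SemigroupGeneratedBy 𝒢 S) {M T : ℝ}
    (hM : ∀ t ∈ Icc (0 : ℝ) T, ‖S t‖ ≤ M) {s t : ℝ} (hs : s ∈ Icc (0 : ℝ) T)
    (ht : t ∈ Icc (0 : ℝ) T) (x : E) : ‖S t x - S s x‖ ≤ M * ‖S |t - s| x - x‖ := by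
  have aux : ∀ s t : ℝ, s ∈ Icc (0 : ℝ) T → s ≤ t →
      ‖S t x - S s x‖ ≤ M * ‖S (t - s) x - x‖ := by
    intro s t hs hst
    have h : S t x = S s (S (t - s) x) := by
      rw [← ContinuousLinearMap.comp_apply, ← hS.add _ _ hs.1 (by linarith)]; simp
    rw [h, ← map_sub]
    exact (S s).le_of_opNorm_le (hM s hs) _
  rcases le_total s t with h | h
  · rw [abs_of_nonneg (by linarith)]; exact aux s t hs h
  · rw [norm_sub_rev, abs_of_nonpos (by linarith), neg_sub]; exact aux t s ht h

/-- Strong continuity at zero propagates to joint continuity in time and in the vector; the time is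
truncated at zero because `S` carries no information at negative times. -/
theorem continuous_uncurry [CompleteSpace E] (hS : IsC0SemigroupGeneratedBy 𝒢 S) :
    Continuous fun p : ℝ × E => S (max p.1 0) p.2 := by
  rw [continuous_iff_continuousAt]
  rintro ⟨t₀, e₀⟩
  obtain ⟨M, hM1, hM⟩ := hS.exists_norm_le (max t₀ 0 + 1)
  have hlim : Tendsto (fun p : ℝ × E => M * ‖p.2 - e₀‖
      + M * ‖S |max p.1 0 - max t₀ 0| e₀ - e₀‖) (𝓝 (t₀, e₀)) (𝓝 0) := by
    have h1 : Tendsto (fun p : ℝ × E => ‖p.2 - e₀‖) (𝓝 (t₀, e₀)) (𝓝 0) := by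
      have : Continuous fun p : ℝ × E => ‖p.2 - e₀‖ := by fun_prop
      simpa using this.tendsto (t₀, e₀)
    have h2 : Tendsto (fun p : ℝ × E => |max p.1 0 - max t₀ 0|) (𝓝 (t₀, e₀)) (𝓝[≥] 0) := by
      refine tendsto_nhdsWithin_iff.2 ⟨?_, Eventually.of_forall fun n => mem_Ici.2 (abs_nonneg _)⟩
      have : Continuous fun p : ℝ × E => |max p.1 0 - max t₀ 0| := by fun_prop
      simpa using this.tendsto (t₀, e₀)
    have h3 := ((hS.tendsto_zero_right e₀).comp h2).sub_const e₀ |>.norm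
    simpa using (h1.const_mul M).add (h3.const_mul M)
  refine tendsto_iff_norm_sub_tendsto_zero.2 (squeeze_zero' (Eventually.of_forall fun _ =>
    norm_nonneg _) ?_ hlim)
  have hev : ∀ᶠ p : ℝ × E in 𝓝 (t₀, e₀), max p.1 0 < max t₀ 0 + 1 := by
    have hc : Continuous fun p : ℝ × E => max p.1 0 := by fun_prop
    exact (hc.tendsto (t₀, e₀)).eventually_lt_const (by simp)
  filter_upwards [hev] with p hp
  have hp' : max p.1 0 ∈ Icc (0 : ℝ) (max t₀ 0 + 1) := ⟨le_max_right _ _, hp.le⟩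
  have ht' : max t₀ 0 ∈ Icc (0 : ℝ) (max t₀ 0 + 1) := ⟨le_max_right _ _, by linarith⟩
  calc ‖S (max p.1 0) p.2 - S (max t₀ 0) e₀‖
      = ‖S (max p.1 0) (p.2 - e₀) + (S (max p.1 0) e₀ - S (max t₀ 0) e₀)‖ := by
        rw [map_sub]; congr 1; abel
    _ ≤ _ := (norm_add_le _ _).trans (add_le_add
        ((S _).le_of_opNorm_le (hM _ hp') _) (hS.norm_apply_sub_le hM ht' hp' _))

theorem continuous_apply [CompleteSpace E] (hS : IsC0SemigroupGeneratedBy 𝒢 S) (e : E) :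
    Continuous fun t : ℝ => S (max t 0) e :=
  hS.continuous_uncurry.comp (continuous_id.prodMk continuous_const)

theorem continuousOn_apply [CompleteSpace E] (hS : IsC0SemigroupGeneratedBy 𝒢 S) (e : E) :
    ContinuousOn (fun t : ℝ => S t e) (Ici 0) :=
  (hS.continuous_apply e).continuousOn.congr fun t ht => by simp [max_eq_left (mem_Ici.1 ht)]

/-- `(S h - 1) ∫₀^τ S(s) e ds = ∫_τ^{τ+h} S(s) e ds - ∫₀^h S(s) e ds`. -/
theorem apply_integral_sub [CompleteSpace E] (hS : IsC0SemigroupGeneratedBy 𝒢 S) (e : E)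
    {h τ : ℝ} (hh : 0 ≤ h) (hτ : 0 ≤ τ) :
    S h (∫ s in (0 : ℝ)..τ, S (max s 0) e) - ∫ s in (0 : ℝ)..τ, S (max s 0) e
      = (∫ s in τ..τ + h, S (max s 0) e) - ∫ s in (0 : ℝ)..h, S (max s 0) e := by
  have hc := hS.continuous_apply e
  have hi : ∀ a b : ℝ, IntervalIntegrable (fun s => S (max s 0) e) volume a b :=
    fun a b => hc.intervalIntegrable a b
  have h1 : S h (∫ s in (0 : ℝ)..τ, S (max s 0) e) = ∫ s in h..τ + h, S (max s 0) e := by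
    rw [← ContinuousLinearMap.intervalIntegral_comp_comm _ (hi _ _)]
    have h2 := intervalIntegral.integral_comp_add_right (a := 0) (b := τ)
      (fun s => S (max s 0) e) h
    rw [zero_add] at h2
    rw [← h2]
    refine intervalIntegral.integral_congr fun s hs => ?_
    rw [uIcc_of_le hτ] at hs
    have : S (s + h) = (S h).comp (S s) := by rw [add_comm, hS.add _ _ hh hs.1]
    simp [max_eq_left hs.1, max_eq_left (add_nonneg hs.1 hh), this]
  rw [h1, ← intervalIntegral.integral_add_adjacent_intervals (hi h 0) (hi 0 (τ + h)),
    ← intervalIntegral.integral_add_adjacent_intervals (hi 0 τ) (hi τ (τ + h)),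
    intervalIntegral.integral_symm 0 h]
  abel

/-- The integral `∫₀^τ S(s) e ds` lies in the domain of the generator, which maps it to `S(τ) e - e`. -/
theorem tendsto_average [CompleteSpace E] (hS : IsC0SemigroupGeneratedBy 𝒢 S) (e : E) {τ : ℝ}
    (hτ : 0 ≤ τ) :
    Tendsto (fun h : ℝ => h⁻¹ • (S h (∫ s in (0 : ℝ)..τ, S (max s 0) e)
      - ∫ s in (0 : ℝ)..τ, S (max s 0) e)) (𝓝[>] 0) (𝓝 (S τ e - e)) := by
  have hc := hS.continuous_apply e
  have hd : ∀ a : ℝ, Tendsto (fun h : ℝ => h⁻¹ • ∫ s in a..a + h, S (max s 0) e) (𝓝[>] 0)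
      (𝓝 (S (max a 0) e)) := by
    intro a
    have h1 : HasDerivAt (fun u => ∫ s in a..u, S (max s 0) e) (S (max a 0) e) a :=
      (hc.integral_hasStrictDerivAt a a).hasDerivAt
    have h2 := h1.tendsto_slope_zero_right
    simpa using h2
  have h3 := (hd τ).sub (hd 0)
  simp only [max_eq_left hτ, max_self, hS.zero, zero_add, ContinuousLinearMap.id_apply] at h3
  refine h3.congr' ?_
  filter_upwards [self_mem_nhdsWithin] with h hh
  rw [hS.apply_integral_sub e (le_of_lt hh) hτ, smul_sub]

/-- Joint integrability of `(s, σ) ↦ 1_{σ ≤ s} S(s - σ) f(σ)`, for Fubini. The time is truncated at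
zero so that the whole square `(0, t]²` can serve as the domain. -/
theorem mild_integrable [CompleteSpace E] (hS : IsC0SemigroupGeneratedBy 𝒢 S) {f : ℝ → E} {t : ℝ}
    (hf : IntegrableOn f (Ioc 0 t)) :
    Integrable (fun p : ℝ × ℝ =>
      (if p.2 ≤ p.1 then (1 : ℝ) else 0) • S (max (p.1 - p.2) 0) (f p.2))
      ((volume.restrict (Ioc 0 t)).prod (volume.restrict (Ioc 0 t))) := by
  obtain ⟨M, hM1, hM⟩ := hS.exists_norm_le t
  have hm : AEStronglyMeasurable (fun p : ℝ × ℝ =>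
      (if p.2 ≤ p.1 then (1 : ℝ) else 0) • S (max (p.1 - p.2) 0) (f p.2))
      ((volume.restrict (Ioc 0 t)).prod (volume.restrict (Ioc 0 t))) := by
    refine AEStronglyMeasurable.smul ?_ ?_
    · exact (Measurable.ite (measurableSet_le measurable_snd measurable_fst) measurable_const
        measurable_const).aestronglyMeasurable
    · have h2 : AEStronglyMeasurable (fun p : ℝ × ℝ => (p.1 - p.2, f p.2))
          ((volume.restrict (Ioc 0 t)).prod (volume.restrict (Ioc 0 t))) :=
        (by fun_prop : Continuous fun p : ℝ × ℝ => p.1 - p.2).aestronglyMeasurable.prodMk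
          hf.1.comp_snd
      exact hS.continuous_uncurry.comp_aestronglyMeasurable h2
  have hg : Integrable (fun p : ℝ × ℝ => (M : ℝ) * ‖f p.2‖)
      ((volume.restrict (Ioc 0 t)).prod (volume.restrict (Ioc 0 t))) :=
    (hf.norm.const_mul M).comp_snd _
  refine hg.mono' hm ?_
  rw [Measure.prod_restrict]
  refine (ae_restrict_iff' (measurableSet_Ioc.prod measurableSet_Ioc)).2
    (Eventually.of_forall fun p hp => ?_)
  have hb : ‖S (max (p.1 - p.2) 0) (f p.2)‖ ≤ M * ‖f p.2‖ := by
    refine (S _).le_of_opNorm_le (hM _ ⟨le_max_right _ _, max_le ?_ ?_⟩) _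
    · linarith [hp.1.2, hp.2.1]
    · linarith [hp.1.1, hp.1.2]
  split_ifs
  · simpa using hb
  · simpa using (norm_nonneg _).trans hb

/-- The convolution as an integral over the fixed interval `(0, t]`. -/
theorem convolution_eq (f : ℝ → E) {s t : ℝ} (hs : s ∈ Ioc 0 t) :
    ∫ σ in (0 : ℝ)..s, S (s - σ) (f σ) =
      ∫ σ in Ioc 0 t, (if σ ≤ s then (1 : ℝ) else 0) • S (max (s - σ) 0) (f σ) := by
  rw [intervalIntegral.integral_of_le hs.1.le, ← integral_indicator measurableSet_Ioc,
    ← integral_indicator measurableSet_Ioc]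
  congr 1
  ext σ
  by_cases h1 : σ ∈ Ioc 0 s
  · have h2 : σ ∈ Ioc 0 t := ⟨h1.1, h1.2.trans hs.2⟩
    simp [h1, h2, h1.2]
  · by_cases h2 : σ ∈ Ioc 0 t
    · have : ¬ σ ≤ s := fun h => h1 ⟨h2.1, h⟩
      simp [h1, h2, this]
    · simp [h1, h2]

theorem integrableOn_convolution [CompleteSpace E] (hS : IsC0SemigroupGeneratedBy 𝒢 S) {f : ℝ → E}
    {t : ℝ} (hf : IntegrableOn f (Ioc 0 t)) :
    IntegrableOn (fun s => ∫ σ in (0 : ℝ)..s, S (s - σ) (f σ)) (Ioc 0 t) := by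
  refine IntegrableOn.congr_fun (hS.mild_integrable hf).integral_prod_left (fun s hs => ?_)
    measurableSet_Ioc
  exact (convolution_eq f hs).symm

theorem integral_truncated_shift (S : ℝ → E →L[ℝ] E) (e : E) {σ t : ℝ} (hσ : σ ∈ Ioc 0 t) :
    ∫ s in Ioc 0 t, (if σ ≤ s then (1 : ℝ) else 0) • S (max (s - σ) 0) e
      = ∫ s in (0 : ℝ)..t - σ, S (max s 0) e := by
  have h2 := intervalIntegral.integral_comp_sub_right (a := σ) (b := t)
      (fun s => S (max s 0) e) σ
  rw [sub_self] at h2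
  rw [← h2, intervalIntegral.integral_of_le hσ.2, ← integral_indicator measurableSet_Ioc,
    ← integral_indicator measurableSet_Ioc]
  refine integral_congr_ae ?_
  filter_upwards [Measure.ae_ne volume σ] with s hsσ
  by_cases h1 : s ∈ Ioc σ t
  · have h2 : s ∈ Ioc 0 t := ⟨hσ.1.trans h1.1, h1.2⟩
    simp [h1, h2, h1.1.le]
  · by_cases h2 : s ∈ Ioc 0 t
    · have : ¬ σ ≤ s := fun h => h1 ⟨lt_of_le_of_ne h (Ne.symm hsσ), h2.2⟩
      simp [h1, h2, this]
    · simp [h1, h2]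

/-- The double integral of the convolution over `0 < σ ≤ s ≤ t`, in the other order. -/
theorem integral_convolution [CompleteSpace E] (hS : IsC0SemigroupGeneratedBy 𝒢 S) {f : ℝ → E}
    {t : ℝ} (hf : IntegrableOn f (Ioc 0 t)) :
    ∫ s in Ioc 0 t, ∫ σ in (0 : ℝ)..s, S (s - σ) (f σ) =
      ∫ σ in Ioc 0 t, ∫ s in (0 : ℝ)..t - σ, S (max s 0) (f σ) := by
  rw [setIntegral_congr_fun measurableSet_Ioc fun s hs => convolution_eq f hs,
    integral_integral_swap (f := fun s σ =>
      (if σ ≤ s then (1 : ℝ) else 0) • S (max (s - σ) 0) (f σ)) (hS.mild_integrable hf)]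
  exact setIntegral_congr_fun measurableSet_Ioc fun σ hσ => integral_truncated_shift S (f σ) hσ

/-- A mild solution solves the equation integrated in time: if
`z(s) = S(s) x + ∫₀ˢ S(s - σ) f(σ) dσ`, then `∫₀ᵗ z` lies in the domain of the generator, which maps
it to `z(t) - x - ∫₀ᵗ f`. -/
theorem integral_mild_mem [CompleteSpace E] (hS : IsC0SemigroupGeneratedBy 𝒢 S) {f z : ℝ → E}
    {t : ℝ} (ht : 0 ≤ t) (hf : IntegrableOn f (Ioc 0 t)) (x : E)
    (hz : ∀ s ∈ Icc 0 t, z s = S s x + ∫ σ in (0 : ℝ)..s, S (s - σ) (f σ)) :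
    (∫ s in (0 : ℝ)..t, z s, z t - x - ∫ s in (0 : ℝ)..t, f s) ∈ 𝒢 := by
  -- The difference quotient of `∫₀ᵗ z` is split into the part from `S(s) x` and the part from the
  -- convolution.
  rw [hS.generator]
  -- the integral of `z`, by Fubini
  have hQ : ∫ s in (0 : ℝ)..t, z s = (∫ s in (0 : ℝ)..t, S (max s 0) x)
      + ∫ σ in Ioc 0 t, ∫ s in (0 : ℝ)..t - σ, S (max s 0) (f σ) := by
    rw [← hS.integral_convolution hf, intervalIntegral.integral_of_le ht,
      intervalIntegral.integral_of_le ht, ← integral_add]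
    · refine setIntegral_congr_fun measurableSet_Ioc fun s hs => ?_
      simp only [hz s ⟨hs.1.le, hs.2⟩, max_eq_left hs.1.le]
    · exact (hS.continuous_apply x).integrableOn_Ioc
    · exact hS.integrableOn_convolution hf
  have hQint : IntegrableOn (fun σ => ∫ s in (0 : ℝ)..t - σ, S (max s 0) (f σ)) (Ioc 0 t) := by
    have h1 := (hS.mild_integrable hf).swap.integral_prod_left
    exact IntegrableOn.congr_fun h1 (fun σ hσ => integral_truncated_shift S (f σ) hσ)
      measurableSet_Ioc
  obtain ⟨M, hM1, hM⟩ := hS.exists_norm_le (t + 1)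
  -- dominated convergence for the difference quotients of the inner integrals
  have hdom : Tendsto (fun h : ℝ => ∫ σ in Ioc 0 t,
      h⁻¹ • (S h (∫ s in (0 : ℝ)..t - σ, S (max s 0) (f σ))
        - ∫ s in (0 : ℝ)..t - σ, S (max s 0) (f σ))) (𝓝[>] 0)
      (𝓝 (∫ σ in Ioc 0 t, (S (t - σ) (f σ) - f σ))) := by
    refine tendsto_integral_filter_of_dominated_convergence (fun σ => 2 * M * ‖f σ‖) ?_ ?_ ?_ ?_
    · refine Eventually.of_forall fun h => ?_
      exact (((S h).integrable_comp hQint).sub hQint).1.const_smul _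
    · have hlt : ∀ᶠ h : ℝ in 𝓝[>] 0, h < 1 :=
        (eventually_lt_nhds (by norm_num)).filter_mono nhdsWithin_le_nhds
      filter_upwards [self_mem_nhdsWithin, hlt] with h hh hh1
      refine (ae_restrict_iff' measurableSet_Ioc).2 (Eventually.of_forall fun σ hσ => ?_)
      have hh0 : 0 < h := hh
      rw [hS.apply_integral_sub _ hh0.le (sub_nonneg.2 hσ.2)]
      have hb : ∀ a : ℝ, 0 ≤ a → a ≤ t →
          ‖∫ s in a..a + h, S (max s 0) (f σ)‖ ≤ M * ‖f σ‖ * h := by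
        intro a ha hat
        have := intervalIntegral.norm_integral_le_of_norm_le_const (a := a) (b := a + h)
          (f := fun s => S (max s 0) (f σ)) (C := M * ‖f σ‖) fun s hs => by
            rw [uIoc_of_le (by linarith)] at hs
            refine (S _).le_of_opNorm_le (hM _ ⟨le_max_right _ _, max_le ?_ ?_⟩) _
            · linarith [hs.2]
            · linarith
        simpa [abs_of_pos hh0] using this
      have h1 := hb (t - σ) (sub_nonneg.2 hσ.2) (by linarith [hσ.1])
      have h2 := hb 0 le_rfl ht
      rw [zero_add] at h2
      rw [norm_smul, norm_inv, Real.norm_of_nonneg hh0.le, inv_mul_le_iff₀ hh0]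
      refine (_root_.norm_sub_le _ _).trans ?_
      linarith
    · exact hf.norm.const_mul _
    · refine (ae_restrict_iff' measurableSet_Ioc).2 (Eventually.of_forall fun σ hσ => ?_)
      exact hS.tendsto_average (f σ) (sub_nonneg.2 hσ.2)
  have hSf : IntegrableOn (fun σ => S (t - σ) (f σ)) (Ioc 0 t) := by
    refine Integrable.mono' (hf.norm.const_mul M) ?_ ?_
    · have h1 : AEStronglyMeasurable (fun σ => S (max (t - σ) 0) (f σ))
          (volume.restrict (Ioc 0 t)) :=
        hS.continuous_uncurry.comp_aestronglyMeasurable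
          ((by fun_prop : Continuous fun σ : ℝ => t - σ).aestronglyMeasurable.prodMk hf.1)
      refine h1.congr ((ae_restrict_iff' measurableSet_Ioc).2 (Eventually.of_forall fun σ hσ => ?_))
      simp only [max_eq_left (sub_nonneg.2 hσ.2)]
    · refine (ae_restrict_iff' measurableSet_Ioc).2 (Eventually.of_forall fun σ hσ => ?_)
      exact (S _).le_of_opNorm_le (hM _ ⟨by linarith [hσ.2], by linarith [hσ.1]⟩) _
  have hfin := (hS.tendsto_average x ht).add hdom
  have hlim : S t x - x + ∫ σ in Ioc 0 t, (S (t - σ) (f σ) - f σ)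
      = z t - x - ∫ s in (0 : ℝ)..t, f s := by
    rw [hz t ⟨ht, le_rfl⟩, integral_sub hSf hf, intervalIntegral.integral_of_le ht,
      intervalIntegral.integral_of_le ht]
    abel
  rw [hlim] at hfin
  refine hfin.congr fun h => ?_
  rw [hQ, integral_smul, integral_sub ((S h).integrable_comp hQint) hQint,
    ContinuousLinearMap.integral_comp_comm _ hQint, map_add, ← smul_add]
  congr 1
  abel

end IsC0SemigroupGeneratedBy

/-! ### Generation by Yosida approximation -/

section Generation

variable {E : Type*} [NormedAddCommGroup E] [NormedSpace ℝ E]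

theorem IsC0SemigroupGeneratedBy.hasDerivWithinAt {𝒢 : Set (E × E)} {S : ℝ → E →L[ℝ] E}
    (hS : IsC0SemigroupGeneratedBy 𝒢 S) {x z : E} (hxz : (x, z) ∈ 𝒢) {t : ℝ} (ht : 0 ≤ t) :
    HasDerivWithinAt (fun s => S s x) (S t z) (Ici t) t := by
  refine HasDerivWithinAt.Ici_of_Ioi ?_
  rw [hasDerivWithinAt_iff_tendsto_slope' (by simp)]
  have h1 := (hS.generator x z).1 hxz
  have h2 := ((S t).continuous.tendsto z).comp h1
  have h3 : Tendsto (fun s : ℝ => s - t) (𝓝[>] t) (𝓝[>] 0) := by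
    refine tendsto_nhdsWithin_iff.2 ⟨?_, ?_⟩
    · have : Tendsto (fun s : ℝ => s - t) (𝓝 t) (𝓝 (t - t)) :=
        (continuous_id.sub continuous_const).tendsto t
      rw [sub_self] at this
      exact this.mono_left nhdsWithin_le_nhds
    · filter_upwards [self_mem_nhdsWithin] with s hs using sub_pos.2 (mem_Ioi.1 hs)
  refine (h2.comp h3).congr' ?_
  filter_upwards [self_mem_nhdsWithin] with s hs
  have hs' : t < s := hs
  have : S s x = S t (S (s - t) x) := by
    rw [← ContinuousLinearMap.comp_apply, ← hS.add _ _ ht (by linarith)]; simp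
  simp [slope, this]

variable [CompleteSpace E]

/-- If the generator of a semigroup of growth `M e^{βt}` extends `𝒢`, and `λ - 𝒢` is onto for one
`λ > β`, then the generator is `𝒢`: an eigenvector of the generator for `λ` would make the
semigroup grow too fast. -/
theorem IsC0SemigroupGeneratedBy.of_extension {𝒢 𝒢' : Submodule ℝ (E × E)} {S : ℝ → E →L[ℝ] E}
    (hS : IsC0SemigroupGeneratedBy (𝒢' : Set (E × E)) S) (hle : 𝒢 ≤ 𝒢') {M β l : ℝ}
    (hM : ∀ t, 0 ≤ t → ‖S t‖ ≤ M * Real.exp (β * t)) (hl : β < l)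
    (hrange : ∀ e : E, ∃ x, (x, l • x - e) ∈ 𝒢) :
    IsC0SemigroupGeneratedBy (𝒢 : Set (E × E)) S := by
  have hEq : 𝒢 = 𝒢' := by
    refine le_antisymm hle ?_
    rintro ⟨x, z⟩ hxz
    obtain ⟨x', hx'⟩ := hrange (l • x - z)
    have hd : (x - x', l • (x - x')) ∈ 𝒢' := by
      have := 𝒢'.sub_mem hxz (hle hx')
      convert this using 1
      ext
      · simp
      · simp only [smul_sub, Prod.snd_sub]; abel
    have hconst : ∀ t, 0 ≤ t → Real.exp (-(l * t)) • S t (x - x') = x - x' := by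
      intro t ht
      have h1 := constant_of_has_deriv_right_zero (a := 0) (b := t)
        (f := fun s => Real.exp (-(l * s)) • S s (x - x')) ?_ ?_ t ⟨ht, le_rfl⟩
      · simpa [hS.zero] using h1
      · refine ContinuousOn.smul (by fun_prop) ?_
        exact (hS.continuousOn_apply _).mono fun s hs => hs.1
      · intro s hs
        have h2 := hS.hasDerivWithinAt hd hs.1
        have h3 : HasDerivWithinAt (fun s : ℝ => Real.exp (-(l * s)))
            (Real.exp (-(l * s)) * (-l)) (Ici s) s := by
          have := (((hasDerivAt_id s).const_mul l).neg).exp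
          simpa using this.hasDerivWithinAt
        refine (h3.smul h2).congr_deriv ?_
        rw [map_smul, smul_smul, ← add_smul, mul_neg, add_neg_cancel, zero_smul]
    have h0 : x - x' = 0 := by
      by_contra hne
      have hpos : 0 < ‖x - x'‖ := norm_pos_iff.2 hne
      have hb : ∀ t, 0 ≤ t → ‖x - x'‖ ≤ M * Real.exp (-((l - β) * t)) * ‖x - x'‖ := by
        intro t ht
        calc ‖x - x'‖ = ‖Real.exp (-(l * t)) • S t (x - x')‖ := by rw [hconst t ht]
          _ = Real.exp (-(l * t)) * ‖S t (x - x')‖ := by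
            rw [norm_smul, Real.norm_of_nonneg (Real.exp_pos _).le]
          _ ≤ Real.exp (-(l * t)) * (M * Real.exp (β * t) * ‖x - x'‖) := by
            gcongr
            exact (S t).le_of_opNorm_le (hM t ht) _
          _ = M * Real.exp (-((l - β) * t)) * ‖x - x'‖ := by
            rw [show -((l - β) * t) = -(l * t) + β * t by ring, Real.exp_add]; ring
      have hlim : Tendsto (fun t : ℝ => M * Real.exp (-((l - β) * t)) * ‖x - x'‖) atTop
          (𝓝 (M * 0 * ‖x - x'‖)) := by
        refine Tendsto.mul_const _ (Tendsto.const_mul _ ?_)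
        refine Real.tendsto_exp_neg_atTop_nhds_zero.comp ?_
        exact tendsto_id.const_mul_atTop (sub_pos.2 hl)
      have := ge_of_tendsto hlim ((eventually_ge_atTop 0).mono hb)
      simp at this
      exact hne this
    have hx : x = x' := sub_eq_zero.1 h0
    subst hx
    simpa using hx'
  rwa [hEq]

theorem hasDerivAt_exp_smul_apply (A : E →L[ℝ] E) (x : E) (t : ℝ) :
    HasDerivAt (fun u : ℝ => NormedSpace.exp (u • A) x) (NormedSpace.exp (t • A) (A x)) t := by
  have h := hasDerivAt_exp_smul_const (𝕂 := ℝ) A t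
  simpa using h.clm_apply (hasDerivAt_const t x)

theorem hasDerivAt_exp_smul_apply' (A : E →L[ℝ] E) (x : E) (t : ℝ) :
    HasDerivAt (fun u : ℝ => NormedSpace.exp (u • A) x) (A (NormedSpace.exp (t • A) x)) t := by
  have h := hasDerivAt_exp_smul_const' (𝕂 := ℝ) A t
  simpa using h.clm_apply (hasDerivAt_const t x)

theorem continuous_exp_smul_apply (A : E →L[ℝ] E) (x : E) :
    Continuous fun u : ℝ => NormedSpace.exp (u • A) x :=
  continuous_iff_continuousAt.2 fun t => (hasDerivAt_exp_smul_apply A x t).continuousAt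

/-- Two semigroups with commuting generators are compared by interpolating
`u ↦ e^{uA} e^{(t - u)A'} x` from `u = 0` to `u = t`. -/
theorem norm_exp_smul_sub_le {A A' : E →L[ℝ] E} (hcomm : Commute A A') {C t : ℝ} (ht : 0 ≤ t)
    (hA : ∀ s ∈ Icc 0 t, ‖NormedSpace.exp (s • A)‖ ≤ C)
    (hA' : ∀ s ∈ Icc 0 t, ‖NormedSpace.exp (s • A')‖ ≤ C) (x : E) :
    ‖NormedSpace.exp (t • A) x - NormedSpace.exp (t • A') x‖ ≤ C * C * ‖A x - A' x‖ * t := by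
  have hd : ∀ s : ℝ, HasDerivAt
      (fun u : ℝ => NormedSpace.exp (u • A) (NormedSpace.exp ((t - u) • A') x))
      (NormedSpace.exp (s • A) (NormedSpace.exp ((t - s) • A') (A x - A' x))) s := by
    intro s
    have h1 := hasDerivAt_exp_smul_const (𝕂 := ℝ) A s
    have h2 : HasDerivAt (fun u : ℝ => NormedSpace.exp ((t - u) • A') x)
        (-(NormedSpace.exp ((t - s) • A') (A' x))) s := by
      have := (hasDerivAt_exp_smul_apply A' x (t - s)).scomp s
        ((hasDerivAt_id s).const_sub t)
      simpa [Function.comp_def] using this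
    have h3 := h1.clm_apply h2
    convert h3 using 1
    have hc : A (NormedSpace.exp ((t - s) • A') x) = NormedSpace.exp ((t - s) • A') (A x) := by
      have := (hcomm.smul_right (t - s)).exp_right
      exact congrArg (fun L : E →L[ℝ] E => L x) this
    rw [map_neg, map_sub, map_sub, mul_apply_eq_comp, hc, sub_eq_add_neg]
  have hC : 0 ≤ C := (norm_nonneg _).trans (hA 0 ⟨le_rfl, ht⟩)
  have key := norm_image_sub_le_of_norm_deriv_le_segment' (a := 0) (b := t)
    (fun s _ => (hd s).hasDerivWithinAt) (C := C * C * ‖A x - A' x‖) (fun s hs => ?_) t ⟨ht, le_rfl⟩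
  · simpa using key
  · calc _ ≤ C * (C * ‖A x - A' x‖) := by
          refine ((NormedSpace.exp (s • A)).le_of_opNorm_le (hA s ⟨hs.1, hs.2.le⟩) _).trans ?_
          gcongr
          exact (NormedSpace.exp ((t - s) • A')).le_of_opNorm_le
            (hA' (t - s) ⟨by linarith [hs.2], by linarith [hs.1]⟩) _
      _ = _ := by ring

/-- Bounded operators that converge on a dense set converge everywhere. -/
theorem exists_tendsto_of_dense {A : ℕ → E →L[ℝ] E} {C : ℝ} (hA : ∀ n, ‖A n‖ ≤ C) {D : Set E}
    (hD : Dense D) (hconv : ∀ x ∈ D, CauchySeq fun n => A n x) (x : E) :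
    ∃ y, Tendsto (fun n => A n x) atTop (𝓝 y) := by
  refine cauchySeq_tendsto_of_complete (Metric.cauchySeq_iff.2 fun ε hε => ?_)
  have hC : 0 ≤ C := (norm_nonneg _).trans (hA 0)
  obtain ⟨y, hy, hxy⟩ := hD.exists_dist_lt x (show 0 < ε / (3 * (C + 1)) by positivity)
  obtain ⟨N, hN⟩ := Metric.cauchySeq_iff.1 (hconv y hy) (ε / 3) (by positivity)
  refine ⟨N, fun m hm n hn => ?_⟩
  have hb : ∀ k, dist (A k x) (A k y) < ε / 3 := by
    intro k
    rw [dist_eq_norm, ← map_sub]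
    calc ‖A k (x - y)‖ ≤ C * ‖x - y‖ := (A k).le_of_opNorm_le (hA k) _
      _ ≤ (C + 1) * ‖x - y‖ := by gcongr; linarith
      _ < (C + 1) * (ε / (3 * (C + 1))) := by
        rw [← dist_eq_norm]; gcongr
      _ = ε / 3 := by field_simp
  calc dist (A m x) (A n x) ≤ dist (A m x) (A m y) + dist (A m y) (A n y) + dist (A n y) (A n x) :=
        dist_triangle4 _ _ _ _
    _ < ε / 3 + ε / 3 + ε / 3 := by
        gcongr
        · exact hb m
        · exact hN m hm n hn
        · rw [dist_comm]; exact hb n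
    _ = ε := by ring

/-- Yosida's construction: the semigroup generated by `𝒢` is the strong limit of the exponentials of
bounded operators `A n` that converge to `𝒢` on its domain. -/
theorem exists_semigroup_of_approx (𝒢 : Submodule ℝ (E × E)) (A : ℕ → E →L[ℝ] E)
    (hcomm : ∀ m n, Commute (A m) (A n)) {M β l : ℝ} (hM0 : 0 ≤ M) (hβ : 0 ≤ β)
    (hM : ∀ n t, 0 ≤ t → ‖NormedSpace.exp (t • A n)‖ ≤ M * Real.exp (β * t))
    (hdense : Dense {x | ∃ z, (x, z) ∈ 𝒢})
    (hconv : ∀ x z, (x, z) ∈ 𝒢 → Tendsto (fun n => A n x) atTop (𝓝 z))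
    (hl : β < l) (hrange : ∀ e : E, ∃ x, (x, l • x - e) ∈ 𝒢) :
    ∃ S, IsC0SemigroupGeneratedBy (𝒢 : Set (E × E)) S := by
  have hMs : ∀ n t s, s ∈ Icc (0 : ℝ) t → ‖NormedSpace.exp (s • A n)‖ ≤ M * Real.exp (β * t) := by
    intro n t s hs
    refine (hM n s hs.1).trans ?_
    gcongr
    exact hs.2
  have hlim : ∀ t : ℝ, 0 ≤ t → ∀ x, ∃ y,
      Tendsto (fun n => NormedSpace.exp (t • A n) x) atTop (𝓝 y) := by
    intro t ht
    refine exists_tendsto_of_dense (hM · t ht) hdense ?_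
    rintro x ⟨z, hxz⟩
    have hc := (hconv x z hxz).cauchySeq
    rw [Metric.cauchySeq_iff] at hc ⊢
    intro ε hε
    set C := M * Real.exp (β * t) with hC
    have hC0 : 0 ≤ C := by positivity
    obtain ⟨N, hN⟩ := hc (ε / (C * C * t + 1)) (by positivity)
    refine ⟨N, fun m hm n hn => ?_⟩
    have h1 := norm_exp_smul_sub_le (hcomm m n) ht (hMs m t) (hMs n t) x
    have h2 := hN m hm n hn
    rw [dist_eq_norm] at h2 ⊢
    rw [lt_div_iff₀ (by positivity)] at h2
    refine h1.trans_lt ?_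
    nlinarith [norm_nonneg (A m x - A n x)]
  choose! S₀ hS₀ using hlim
  have hS₀' : ∀ t, 0 ≤ t → Tendsto (fun n x => NormedSpace.exp (t • A n) x) atTop (𝓝 (S₀ t)) :=
    fun t ht => tendsto_pi_nhds.2 (hS₀ t ht)
  let S : ℝ → E →L[ℝ] E := fun t =>
    if ht : 0 ≤ t then continuousLinearMapOfTendsto _ (hS₀' t ht) else 0
  have hS : ∀ t, 0 ≤ t → ∀ x, Tendsto (fun n => NormedSpace.exp (t • A n) x) atTop (𝓝 (S t x)) := by
    intro t ht x
    have : S t x = S₀ t x := by simp only [S, dif_pos ht]; rfl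
    rw [this]
    exact hS₀ t ht x
  have hSM : ∀ t, 0 ≤ t → ‖S t‖ ≤ M * Real.exp (β * t) := by
    intro t ht
    refine (S t).opNorm_le_bound (by positivity) fun x => ?_
    exact le_of_tendsto (hS t ht x).norm
      (Eventually.of_forall fun n => (NormedSpace.exp (t • A n)).le_of_opNorm_le (hM n t ht) x)
  have hzero : S 0 = ContinuousLinearMap.id ℝ E := by
    ext x
    refine tendsto_nhds_unique (hS 0 le_rfl x) ?_
    simp
  have hadd : ∀ s t : ℝ, 0 ≤ s → 0 ≤ t → S (s + t) = (S s).comp (S t) := by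
    intro s t hs ht
    ext x
    refine tendsto_nhds_unique (hS _ (add_nonneg hs ht) x) ?_
    have h1 : Tendsto (fun n => NormedSpace.exp (s • A n) (NormedSpace.exp (t • A n) x - S t x))
        atTop (𝓝 0) := by
      refine squeeze_zero_norm
        (fun n => (NormedSpace.exp (s • A n)).le_of_opNorm_le (hM n s hs) _) ?_
      have := ((hS t ht x).sub_const (S t x)).norm.const_mul (M * Real.exp (β * s))
      simpa using this
    have h2 := h1.add (hS s hs (S t x))
    simp only [zero_add] at h2
    refine h2.congr fun n => ?_
    have : NormedSpace.exp ((s + t) • A n)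
        = NormedSpace.exp (s • A n) * NormedSpace.exp (t • A n) := by
      let _ : NormedAlgebra ℚ (E →L[ℝ] E) := NormedAlgebra.restrictScalars ℚ ℝ _
      rw [add_smul, NormedSpace.exp_add_of_commute]
      exact ((Commute.refl (A n)).smul_right t).smul_left s
    rw [this, map_sub]
    simp
  have htz : ∀ x : E, Tendsto (fun t => S t x) (𝓝[>] 0) (𝓝 x) := by
    -- on the domain `‖S t x - x‖ ≤ C t`; the general case follows by density
    have hdom : ∀ x z, (x, z) ∈ 𝒢 → ∀ t ∈ Icc (0 : ℝ) 1,
        ‖S t x - x‖ ≤ M * Real.exp β * ‖z‖ * t := by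
      intro x z hxz t ht
      refine le_of_tendsto_of_tendsto ((hS t ht.1 x).sub_const x).norm
        (((hconv x z hxz).norm.const_mul (M * Real.exp β)).mul_const t)
        (Eventually.of_forall fun n => ?_)
      have key := norm_image_sub_le_of_norm_deriv_le_segment' (a := 0) (b := t)
        (fun s _ => (hasDerivAt_exp_smul_apply (A n) x s).hasDerivWithinAt)
        (C := M * Real.exp β * ‖A n x‖) (fun s hs => ?_) t ⟨ht.1, le_rfl⟩
      · simpa using key
      · refine (NormedSpace.exp (s • A n)).le_of_opNorm_le ?_ _
        simpa using hMs n 1 s ⟨hs.1, hs.2.le.trans ht.2⟩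
    intro x
    rw [Metric.tendsto_nhds]
    intro ε hε
    set C := M * Real.exp β with hC
    have hC0 : 0 ≤ C := by positivity
    obtain ⟨y, ⟨z, hyz⟩, hxy⟩ := hdense.exists_dist_lt x (show 0 < ε / (2 * (C + 1)) by positivity)
    have hsmall : ∀ᶠ t : ℝ in 𝓝[>] 0, C * ‖z‖ * t < ε / 2 := by
      have : Tendsto (fun t : ℝ => C * ‖z‖ * t) (𝓝 0) (𝓝 0) := by
        simpa using (tendsto_id (x := 𝓝 (0 : ℝ))).const_mul (C * ‖z‖)
      exact (this.mono_left nhdsWithin_le_nhds).eventually_lt_const (by positivity)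
    have hone : ∀ᶠ t : ℝ in 𝓝[>] 0, t < 1 :=
      (eventually_lt_nhds (by norm_num)).filter_mono nhdsWithin_le_nhds
    filter_upwards [hsmall, hone, self_mem_nhdsWithin] with t h1 h2 h3
    have ht : t ∈ Icc (0 : ℝ) 1 := ⟨le_of_lt h3, h2.le⟩
    have h4 : ‖S t (x - y)‖ ≤ C * ‖x - y‖ := by
      refine (S t).le_of_opNorm_le ((hSM t ht.1).trans ?_) _
      rw [hC]
      gcongr
      nlinarith [ht.2]
    rw [dist_eq_norm] at hxy
    rw [lt_div_iff₀ (by positivity)] at hxy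
    calc dist (S t x) x = ‖S t (x - y) + (S t y - y) + (y - x)‖ := by
          rw [dist_eq_norm, map_sub]; congr 1; abel
      _ ≤ C * ‖x - y‖ + C * ‖z‖ * t + ‖x - y‖ := by
          refine (norm_add₃_le).trans ?_
          rw [norm_sub_rev y x]
          gcongr
          exact hdom y z hyz t ht
      _ < ε := by nlinarith
  let 𝒢' : Submodule ℝ (E × E) :=
    { carrier := {p | Tendsto (fun h : ℝ => h⁻¹ • (S h p.1 - p.1)) (𝓝[>] 0) (𝓝 p.2)}
      add_mem' := by
        intro p q hp hq
        refine (hp.add hq).congr fun h => ?_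
        rw [← smul_add]; simp only [Prod.fst_add, map_add]; congr 1; abel
      zero_mem' := by simp
      smul_mem' := by
        intro c p hp
        refine (hp.const_smul c).congr fun h => ?_
        rw [smul_comm]; simp [smul_sub] }
  have hS' : IsC0SemigroupGeneratedBy (𝒢' : Set (E × E)) S :=
    ⟨hzero, hadd, htz, fun x z => Iff.rfl⟩
  refine ⟨S, hS'.of_extension ?_ hSM hl hrange⟩
  rintro ⟨x, z⟩ hxz
  -- pass to the limit in `exp (t A n) x - x = ∫₀ᵗ exp (s A n) (A n x) ds`
  have hint : ∀ t, 0 ≤ t → S t x - x = ∫ s in (0 : ℝ)..t, S (max s 0) z := by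
    intro t ht
    refine tendsto_nhds_unique ((hS t ht x).sub_const x) ?_
    have h1 : Tendsto (fun n => ∫ s in (0 : ℝ)..t, NormedSpace.exp (s • A n) (A n x)) atTop
        (𝓝 (∫ s in (0 : ℝ)..t, S (max s 0) z)) := by
      obtain ⟨R, hR⟩ := (hconv x z hxz).norm.bddAbove_range
      refine intervalIntegral.tendsto_integral_filter_of_dominated_convergence
        (fun _ => M * Real.exp (β * t) * R) ?_ ?_ ?_ ?_
      · exact Eventually.of_forall fun n =>
          (continuous_exp_smul_apply (A n) (A n x)).aestronglyMeasurable
      · refine Eventually.of_forall fun n => Eventually.of_forall fun s hs => ?_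
        rw [uIoc_of_le ht] at hs
        refine ((NormedSpace.exp (s • A n)).le_of_opNorm_le (hMs n t s ⟨hs.1.le, hs.2⟩) _).trans ?_
        gcongr
        exact hR ⟨n, rfl⟩
      · exact intervalIntegrable_const
      · refine Eventually.of_forall fun s hs => ?_
        rw [uIoc_of_le ht] at hs
        rw [max_eq_left hs.1.le]
        have h2 : Tendsto (fun n => NormedSpace.exp (s • A n) (A n x - z)) atTop (𝓝 0) := by
          refine squeeze_zero_norm
            (fun n => (NormedSpace.exp (s • A n)).le_of_opNorm_le (hM n s hs.1.le) _) ?_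
          have := ((hconv x z hxz).sub_const z).norm.const_mul (M * Real.exp (β * s))
          simpa using this
        have h3 := h2.add (hS s hs.1.le z)
        simp only [zero_add] at h3
        refine h3.congr fun n => ?_
        rw [map_sub]; simp
    refine h1.congr fun n => ?_
    rw [intervalIntegral.integral_eq_sub_of_hasDerivAt
      (fun s _ => hasDerivAt_exp_smul_apply (A n) x s)
      ((continuous_exp_smul_apply (A n) (A n x)).intervalIntegrable _ _)]
    simp
  change Tendsto (fun h : ℝ => h⁻¹ • (S h x - x)) (𝓝[>] 0) (𝓝 z)
  have hder : HasDerivAt (fun u => ∫ s in (0 : ℝ)..u, S (max s 0) z) (S (max 0 0) z) 0 :=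
    ((hS'.continuous_apply z).integral_hasStrictDerivAt 0 0).hasDerivAt
  have h2 := hder.tendsto_slope_zero_right
  simp only [max_self, hzero, ContinuousLinearMap.id_apply, zero_add,
    intervalIntegral.integral_same, sub_zero] at h2
  refine h2.congr' ?_
  filter_upwards [self_mem_nhdsWithin] with h hh
  rw [hint h (le_of_lt hh)]

end Generation

/-! ### Maximal quasi-dissipative operators -/

section Dissipative

variable {E : Type*} [NormedAddCommGroup E] [InnerProductSpace ℝ E]

/-- The linear relation `𝒢` is the graph of an operator that is quasi-dissipative, with constant
`ω`, for the equivalent inner product `B`, and `λ - 𝒢` is onto for every `λ > Λ`. -/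
structure IsMaximalQuasiDissipative (𝒢 : Submodule ℝ (E × E)) (B : E →L[ℝ] E →L[ℝ] ℝ)
    (c ω Λ : ℝ) : Prop where
  symm : ∀ x y, B x y = B y x
  c_pos : 0 < c
  coercive : ∀ x, c * ‖x‖ ^ 2 ≤ B x x
  omega_nonneg : 0 ≤ ω
  dissipative : ∀ x z, (x, z) ∈ 𝒢 → B z x ≤ ω * B x x
  single_valued : ∀ z, (0, z) ∈ 𝒢 → z = 0
  range : ∀ l, Λ < l → ∀ e : E, ∃ x, (x, l • x - e) ∈ 𝒢

namespace IsMaximalQuasiDissipative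

variable {𝒢 : Submodule ℝ (E × E)} {B : E →L[ℝ] E →L[ℝ] ℝ} {c ω Λ : ℝ}

theorem eq_zero_of_form (h : IsMaximalQuasiDissipative 𝒢 B c ω Λ) {x : E} (hx : B x x ≤ 0) :
    x = 0 := by
  have h1 := h.coercive x
  have h2 := h.c_pos
  have h3 : ‖x‖ ^ 2 ≤ 0 := by
    by_contra hc
    nlinarith
  exact norm_eq_zero.1 (pow_eq_zero_iff (two_ne_zero) |>.1 (le_antisymm h3 (by positivity)))

theorem form_nonneg (h : IsMaximalQuasiDissipative 𝒢 B c ω Λ) (x : E) : 0 ≤ B x x :=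
  (mul_nonneg h.c_pos.le (by positivity)).trans (h.coercive x)

/-- The resolvent has norm at most `1 / (l - ω)` for `B`; here `x` is the resolvent at `l` applied
to `e`. -/
theorem form_resolvent_le (h : IsMaximalQuasiDissipative 𝒢 B c ω Λ) {l : ℝ} (hl : ω < l) {x e : E}
    (hx : (x, l • x - e) ∈ 𝒢) : (l - ω) ^ 2 * B x x ≤ B e e := by
  have h1 := h.dissipative _ _ hx
  have h2 := h.form_nonneg (e - (l - ω) • x)
  have h3 := h.symm x e
  simp only [map_sub, map_smul, sub_apply, smul_apply,
    smul_eq_mul] at h1 h2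
  rw [h3] at h2
  nlinarith

theorem resolvent_unique (h : IsMaximalQuasiDissipative 𝒢 B c ω Λ) {l : ℝ} (hl : ω < l) {x x' e : E}
    (hx : (x, l • x - e) ∈ 𝒢) (hx' : (x', l • x' - e) ∈ 𝒢) : x = x' := by
  have h1 : (x - x', l • (x - x') - 0) ∈ 𝒢 := by
    convert 𝒢.sub_mem hx hx' using 1
    ext
    · simp
    · simp only [smul_sub, Prod.snd_sub]; abel
  have h2 := h.form_resolvent_le hl h1
  simp only [map_zero] at h2
  refine sub_eq_zero.1 (h.eq_zero_of_form ?_)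
  have h3 : 0 < (l - ω) ^ 2 := pow_pos (sub_pos.2 hl) 2
  by_contra hc
  push Not at hc
  nlinarith

theorem norm_sq_le_of_form_le (h : IsMaximalQuasiDissipative 𝒢 B c ω Λ) {x e : E} {C : ℝ}
    (hC : 0 ≤ C) (hx : B x x ≤ C ^ 2 * B e e) : ‖x‖ ≤ √(‖B‖ / c) * C * ‖e‖ := by
  refine abs_le_of_sq_le_sq' ?_ (by positivity) |>.2
  have h1 := h.coercive x
  have h2 : B e e ≤ ‖B‖ * ‖e‖ * ‖e‖ := (le_abs_self _).trans (B.le_opNorm₂ e e)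
  rw [mul_pow, mul_pow, Real.sq_sqrt (show 0 ≤ ‖B‖ / c from div_nonneg B.opNorm_nonneg h.c_pos.le)]
  have h3 : C ^ 2 * B e e ≤ C ^ 2 * (‖B‖ * ‖e‖ * ‖e‖) := by gcongr
  have h4 : c * ‖x‖ ^ 2 ≤ C ^ 2 * (‖B‖ * ‖e‖ * ‖e‖) := h1.trans (hx.trans h3)
  calc ‖x‖ ^ 2 ≤ C ^ 2 * (‖B‖ * ‖e‖ * ‖e‖) / c := by
        rw [le_div_iff₀ h.c_pos]; linarith
    _ = _ := by ring

theorem exists_resolvent (h : IsMaximalQuasiDissipative 𝒢 B c ω Λ) {l : ℝ} (hl : ω < l)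
    (hΛ : Λ < l) : ∃ R : E →L[ℝ] E, ∀ e, (R e, l • R e - e) ∈ 𝒢 := by
  choose R hR using h.range l hΛ
  let L : E →ₗ[ℝ] E :=
    { toFun := R
      map_add' := by
        intro a b
        refine h.resolvent_unique hl (hR (a + b)) ?_
        convert 𝒢.add_mem (hR a) (hR b) using 1
        ext
        · simp
        · simp only [smul_add, Prod.snd_add]; abel
      map_smul' := by
        intro k a
        refine h.resolvent_unique hl (hR (k • a)) ?_
        convert 𝒢.smul_mem k (hR a) using 1
        ext
        · simp
        · simp only [smul_sub, Prod.smul_snd, RingHom.id_apply]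
          rw [smul_comm] }
  refine ⟨L.mkContinuous (√(‖B‖ / c) * (l - ω)⁻¹) fun e => ?_, hR⟩
  have hpos := sub_pos.2 hl
  refine h.norm_sq_le_of_form_le (inv_nonneg.2 hpos.le) ?_
  have := h.form_resolvent_le hl (hR e)
  rw [inv_pow, le_inv_mul_iff₀ (by positivity)]
  exact this

theorem resolvent_commute (h : IsMaximalQuasiDissipative 𝒢 B c ω Λ) {l m : ℝ} (hl : ω < l)
    (hm : ω < m) {R R' : E →L[ℝ] E} (hR : ∀ e, (R e, l • R e - e) ∈ 𝒢)
    (hR' : ∀ e, (R' e, m • R' e - e) ∈ 𝒢) : Commute R R' := by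
  -- the resolvent identity, in both orders
  have key : ∀ {l m : ℝ} {R R' : E →L[ℝ] E}, ω < l → (∀ e, (R e, l • R e - e) ∈ 𝒢) →
      (∀ e, (R' e, m • R' e - e) ∈ 𝒢) → ∀ e, R e + (l - m) • R (R' e) = R' e := by
    intro l m R R' hl hR hR' e
    refine h.resolvent_unique hl (e := e + (l - m) • R' e) ?_ ?_
    · have := hR (e + (l - m) • R' e)
      simpa only [map_add, map_smul] using this
    · convert hR' e using 2
      rw [sub_smul]; abel
  ext e
  change R (R' e) = R' (R e)
  rcases eq_or_ne l m with rfl | hne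
  · have : ∀ e, R e = R' e := fun e => h.resolvent_unique hl (hR e) (hR' e)
    rw [this, this e]
  · have h1 := key hl hR hR' e
    have h2 := key hm hR' hR e
    have h3 : (l - m) • (R (R' e) - R' (R e)) = 0 := by
      have e1 : (l - m) • R (R' e) = R' e - R e := eq_sub_of_add_eq' h1
      have e2 : (m - l) • R' (R e) = R e - R' e := eq_sub_of_add_eq' h2
      rw [smul_sub, e1, ← neg_sub m l, neg_smul, e2]; abel
    exact sub_eq_zero.1 ((smul_eq_zero.1 h3).resolve_left (sub_ne_zero.2 hne))

/-- On a Hilbert space the domain of a maximal quasi-dissipative operator is dense: a vector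
`B`-orthogonal to the domain is `λ x - 𝒢 x` with `x` in the domain, and dissipativity forces
`x = 0`. -/
theorem dense_domain [CompleteSpace E] (h : IsMaximalQuasiDissipative 𝒢 B c ω Λ) :
    Dense {x | ∃ z, (x, z) ∈ 𝒢} := by
  have hset : {x | ∃ z, (x, z) ∈ 𝒢} = (𝒢.map (LinearMap.fst ℝ E E) : Set E) := by
    ext x
    simp
  rw [hset, Submodule.dense_iff_topologicalClosure_eq_top,
    Submodule.topologicalClosure_eq_top_iff, Submodule.eq_bot_iff]
  intro e' he'
  have hB : IsCoercive B := ⟨c, h.c_pos, fun u => by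
    simpa [sq, mul_assoc] using h.coercive u⟩
  obtain ⟨e, rfl⟩ := hB.continuousLinearEquivOfBilin.surjective e'
  obtain ⟨x, hx⟩ := h.range (max ω Λ + 1) (by linarith [le_max_right ω Λ]) e
  have h1 : B e x = 0 := by
    rw [← hB.continuousLinearEquivOfBilin_apply, real_inner_comm]
    exact (Submodule.mem_orthogonal _ _).1 he' x ⟨_, hx, rfl⟩
  have h2 := h.dissipative _ _ hx
  have hx0 : x = 0 := by
    refine h.eq_zero_of_form ?_
    simp only [map_sub, map_smul, sub_apply, smul_apply,
      smul_eq_mul, h1] at h2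
    by_contra hc
    push Not at hc
    nlinarith [le_max_left ω Λ]
  subst hx0
  have h3 := h.single_valued _ hx
  simp only [smul_zero, zero_sub, neg_eq_zero] at h3
  simp [h3]

/-- The exponential of a bounded operator satisfying a quasi-dissipativity estimate for `B`; the
constant accounts for the change from `B` to the norm. -/
theorem norm_exp_le [CompleteSpace E] (h : IsMaximalQuasiDissipative 𝒢 B c ω Λ) {A : E →L[ℝ] E}
    {β : ℝ} (hA : ∀ e, B (A e) e ≤ β * B e e) {t : ℝ} (ht : 0 ≤ t) :
    ‖NormedSpace.exp (t • A)‖ ≤ √(‖B‖ / c) * Real.exp (β * t) := by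
  refine ContinuousLinearMap.opNorm_le_bound _ (by positivity) fun e => ?_
  refine h.norm_sq_le_of_form_le (Real.exp_pos _).le ?_
  -- `exp (-2 β s) B(u, u)` is nonincreasing along `u(s) = exp (s A) e`
  let g : ℝ → ℝ := fun s => Real.exp (-(2 * β * s)) *
    B (NormedSpace.exp (s • A) e) (NormedSpace.exp (s • A) e)
  have hg : ∀ s, HasDerivAt g (Real.exp (-(2 * β * s)) * (-(2 * β)) *
      B (NormedSpace.exp (s • A) e) (NormedSpace.exp (s • A) e)
      + Real.exp (-(2 * β * s)) * (B (A (NormedSpace.exp (s • A) e)) (NormedSpace.exp (s • A) e)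
        + B (NormedSpace.exp (s • A) e) (A (NormedSpace.exp (s • A) e)))) s := by
    intro s
    have h1 : HasDerivAt (fun s : ℝ => Real.exp (-(2 * β * s)))
        (Real.exp (-(2 * β * s)) * (-(2 * β))) s := by
      have := (((hasDerivAt_id s).const_mul (2 * β)).neg).exp
      simpa using this
    have hu := hasDerivAt_exp_smul_apply' A e s
    have h2 := (B.hasFDerivAt.comp_hasDerivAt s hu).clm_apply hu
    exact h1.mul h2
  have hanti : AntitoneOn g (Ici 0) := by
    refine antitoneOn_of_deriv_nonpos (convex_Ici 0)
      (fun s _ => (hg s).continuousAt.continuousWithinAt)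
      (fun s _ => (hg s).differentiableAt.differentiableWithinAt) fun s _ => ?_
    rw [(hg s).deriv, h.symm (NormedSpace.exp (s • A) e) (A (NormedSpace.exp (s • A) e))]
    have := hA (NormedSpace.exp (s • A) e)
    have hp := Real.exp_pos (-(2 * β * s))
    nlinarith
  have h0 := hanti (mem_Ici.2 le_rfl) (mem_Ici.2 ht) ht
  simp only [g, mul_zero, neg_zero, Real.exp_zero, zero_smul, NormedSpace.exp_zero, one_mul,
    one_apply_eq_self] at h0
  calc B (NormedSpace.exp (t • A) e) (NormedSpace.exp (t • A) e)
      = Real.exp (β * t) ^ 2 * (Real.exp (-(2 * β * t)) *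
        B (NormedSpace.exp (t • A) e) (NormedSpace.exp (t • A) e)) := by
        rw [← mul_assoc, sq, ← Real.exp_add, ← Real.exp_add,
          show β * t + β * t + -(2 * β * t) = 0 by ring, Real.exp_zero, one_mul]
    _ ≤ _ := by gcongr

/-- The Lumer-Phillips theorem in a Hilbert space. -/
theorem exists_semigroup [CompleteSpace E] (h : IsMaximalQuasiDissipative 𝒢 B c ω Λ) :
    ∃ S, IsC0SemigroupGeneratedBy (𝒢 : Set (E × E)) S := by
  have hω := h.omega_nonneg
  obtain ⟨N, hN⟩ := exists_nat_gt (max (2 * ω) Λ)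
  have hNl : ∀ n : ℕ, 2 * ω < (N + n : ℕ) ∧ Λ < (N + n : ℕ) := fun n => by
    push_cast
    have : (0 : ℝ) ≤ n := n.cast_nonneg
    exact ⟨by linarith [le_max_left (2 * ω) Λ], by linarith [le_max_right (2 * ω) Λ]⟩
  have hNω : ∀ n : ℕ, ω < (N + n : ℕ) := fun n => by linarith [(hNl n).1]
  choose R hR using fun n => h.exists_resolvent (hNω n) (hNl n).2
  let l : ℕ → ℝ := fun n => ((N + n : ℕ) : ℝ)
  have hlω : ∀ n, ω < l n := hNω
  have hl2 : ∀ n, 2 * ω < l n := fun n => (hNl n).1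
  have hltop : Tendsto l atTop atTop :=
    tendsto_natCast_atTop_atTop.comp (tendsto_add_atTop_nat N |>.congr fun n => add_comm n N)
  -- the Yosida approximations
  -- For `l ≥ 2 ω` they are quasi-dissipative with the constant `4 ω`, which no longer depends on `n`.
  let A : ℕ → E →L[ℝ] E := fun n => l n • (l n • R n - ContinuousLinearMap.id ℝ E)
  have hAa : ∀ n e, A n e = l n • (l n • R n e - e) := fun n e => by simp [A]
  have hRn : ∀ n e, ‖R n e‖ ≤ √(‖B‖ / c) * (l n - ω)⁻¹ * ‖e‖ := by
    intro n e
    have hpos := sub_pos.2 (hlω n)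
    refine h.norm_sq_le_of_form_le (inv_nonneg.2 hpos.le) ?_
    rw [inv_pow, le_inv_mul_iff₀ (by positivity)]
    exact h.form_resolvent_le (hlω n) (hR n e)
  have hdiss : ∀ n e, B (A n e) e ≤ 4 * ω * B e e := by
    intro n e
    have h1 := h.dissipative _ _ (hR n e)
    have h2 := h.form_resolvent_le (hlω n) (hR n e)
    have h3 := h.form_nonneg (l n • R n e - e)
    have h4 := h.form_nonneg (R n e)
    change B (l n • R n e - e) (R n e) ≤ _ at h1
    rw [hAa]
    have he : B (l n • (l n • R n e - e)) e
        = (l n) ^ 2 * B (l n • R n e - e) (R n e)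
          - l n * B (l n • R n e - e) (l n • R n e - e) := by
      simp only [map_sub, map_smul, sub_apply, smul_apply,
        smul_eq_mul]
      ring
    rw [he]
    have h5 : 0 < l n := by linarith [hl2 n]
    have h6 : (l n) ^ 2 ≤ 4 * (l n - ω) ^ 2 := by nlinarith [hl2 n]
    have h7 : (l n) ^ 2 * B (l n • R n e - e) (R n e) ≤ (l n) ^ 2 * (ω * B (R n e) (R n e)) := by
      gcongr
    have h8 : (l n) ^ 2 * (ω * B (R n e) (R n e))
        ≤ 4 * (l n - ω) ^ 2 * (ω * B (R n e) (R n e)) := by gcongr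
    nlinarith [mul_nonneg h5.le h3, mul_le_mul_of_nonneg_left h2 hω]
  refine exists_semigroup_of_approx 𝒢 A ?_ (Real.sqrt_nonneg (‖B‖ / c)) (β := 4 * ω)
    (by positivity) (fun n t ht => h.norm_exp_le (hdiss n) ht) h.dense_domain ?_
    (l := max (4 * ω) Λ + 1) (by linarith [le_max_left (4 * ω) Λ])
    (h.range _ (by linarith [le_max_right (4 * ω) Λ]))
  · intro m n
    have h1 := h.resolvent_commute (hlω m) (hlω n) (hR m) (hR n)
    have h2 : Commute (l m • R m - ContinuousLinearMap.id ℝ E)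
        (l n • R n - ContinuousLinearMap.id ℝ E) := by
      have h1' : Commute (l m • R m) (l n • R n) := (h1.smul_left (l m)).smul_right (l n)
      exact ((h1'.sub_right (Commute.one_right _)).sub_left
        ((Commute.one_left _).sub_right (Commute.one_left _)))
    exact (h2.smul_left (l m)).smul_right (l n)
  · -- `A n x = l n • R n z`, and `l n • R n e → e` for every `e`
    have hAR : ∀ x z, (x, z) ∈ 𝒢 → ∀ n, l n • R n x - x = R n z := by
      intro x z hxz n
      have h1 : x = R n (l n • x - z) := by
        refine h.resolvent_unique (hlω n) (e := l n • x - z) ?_ (hR n _)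
        simpa using hxz
      have h2 : R n (l n • x - z) = l n • R n x - R n z := by simp
      rw [h2] at h1
      nth_rewrite 2 [h1]
      abel
    have hinv : Tendsto (fun n => (l n - ω)⁻¹) atTop (𝓝 0) :=
      tendsto_inv_atTop_zero.comp (tendsto_atTop_add_const_right _ (-ω) hltop)
    have hR0 : ∀ e, Tendsto (fun n => R n e) atTop (𝓝 0) := by
      intro e
      refine squeeze_zero_norm (hRn · e) ?_
      simpa using (hinv.const_mul (√(‖B‖ / c))).mul_const ‖e‖
    have hlR : ∀ e, Tendsto (fun n => l n • R n e) atTop (𝓝 e) := by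
      have hbd : ∀ n, ‖l n • R n‖ ≤ 2 * √(‖B‖ / c) := by
        intro n
        refine ContinuousLinearMap.opNorm_le_bound _ (by positivity) fun e => ?_
        have h5 : 0 < l n := by linarith [hl2 n]
        have h6 : 0 < l n - ω := sub_pos.2 (hlω n)
        have h7 : l n * (l n - ω)⁻¹ ≤ 2 := by
          rw [← div_eq_mul_inv, div_le_iff₀ h6]; linarith [hl2 n]
        rw [smul_apply, norm_smul, Real.norm_of_nonneg h5.le]
        calc l n * ‖R n e‖ ≤ l n * (√(‖B‖ / c) * (l n - ω)⁻¹ * ‖e‖) := by gcongr; exact hRn n e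
          _ = (l n * (l n - ω)⁻¹) * (√(‖B‖ / c) * ‖e‖) := by ring
          _ ≤ 2 * (√(‖B‖ / c) * ‖e‖) := by gcongr
          _ = _ := by ring
      intro e
      set C := 2 * √(‖B‖ / c) with hC
      have hC0 : 0 ≤ C := by positivity
      rw [Metric.tendsto_nhds]
      intro ε hε
      obtain ⟨x, ⟨z, hxz⟩, hex⟩ :=
        h.dense_domain.exists_dist_lt e (show 0 < ε / (2 * (C + 1)) by positivity)
      have h1 := (hR0 z).norm
      rw [norm_zero] at h1
      filter_upwards [h1.eventually_lt_const (show 0 < ε / 2 by positivity)] with n hn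
      have h2 : ‖(l n • R n) (e - x)‖ ≤ C * ‖e - x‖ := (l n • R n).le_of_opNorm_le (hbd n) _
      rw [dist_eq_norm, lt_div_iff₀ (by positivity)] at hex
      calc dist (l n • R n e) e = ‖(l n • R n) (e - x) + (l n • R n x - x) + (x - e)‖ := by
            rw [dist_eq_norm, map_sub]; congr 1; simp only [smul_apply]; abel
        _ ≤ C * ‖e - x‖ + ‖R n z‖ + ‖e - x‖ := by
            refine (norm_add₃_le).trans ?_
            rw [norm_sub_rev x e, hAR x z hxz n]
            gcongr
        _ < ε := by nlinarith
    intro x z hxz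
    refine (hlR z).congr fun n => ?_
    rw [hAa, hAR x z hxz n]

/-- Uniqueness for the equation integrated in time: if `∫₀ᵗ d` is in the domain and is mapped to
`d(t)` for every `t`, then `d = 0`, at every time. The resolvent makes `∫₀ᵗ d` a `C¹` solution,
to which the energy estimate applies. -/
theorem eq_zero_of_integral_mem [CompleteSpace E] (h : IsMaximalQuasiDissipative 𝒢 B c ω Λ) {T : ℝ}
    {d : ℝ → E} (hd : IntegrableOn d (Ioc 0 T))
    (hmem : ∀ t ∈ Icc 0 T, (∫ s in (0 : ℝ)..t, d s, d t) ∈ 𝒢) : ∀ t ∈ Icc 0 T, d t = 0 := by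
  have hlω : ω < max ω Λ + 1 := by linarith [le_max_left ω Λ]
  obtain ⟨R, hR⟩ := h.exists_resolvent hlω (by linarith [le_max_right ω Λ])
  set l := max ω Λ + 1
  intro t ht
  have hdt : IntervalIntegrable d volume 0 t :=
    (intervalIntegrable_iff_integrableOn_Ioc_of_le ht.1).2
      (hd.mono_set (Ioc_subset_Ioc_right ht.2))
  let w : ℝ → E := fun s => ∫ σ in (0 : ℝ)..s, d σ
  have hw : ContinuousOn w (Icc 0 t) := by
    have := intervalIntegral.continuousOn_primitive_interval (a := 0) (b := t) (f := d)
      (μ := volume) (by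
        rw [uIcc_of_le ht.1, integrableOn_Icc_iff_integrableOn_Ioc]
        exact hd.mono_set (Ioc_subset_Ioc_right ht.2))
    rwa [uIcc_of_le ht.1] at this
  have hRd : ∀ s ∈ Icc 0 t, R (d s) = l • R (w s) - w s := by
    intro s hs
    have h1 : w s = R (l • w s - d s) := by
      refine h.resolvent_unique hlω (e := l • w s - d s) ?_ (hR _)
      simpa using hmem s ⟨hs.1, hs.2.trans ht.2⟩
    have h2 : R (l • w s - d s) = l • R (w s) - R (d s) := by simp
    rw [h2] at h1
    nth_rewrite 2 [h1]
    abel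
  have hRc : ContinuousOn (fun s => l • R (w s) - w s) (Icc 0 t) :=
    ((R.continuous.comp_continuousOn hw).const_smul l).sub hw
  have hu : ∀ s ∈ Ico 0 t, HasDerivWithinAt (fun s => R (w s)) (l • R (w s) - w s) (Ici s) s := by
    intro s hs
    have hprim : ∀ s' ∈ Icc 0 t, R (w s') = ∫ σ in (0 : ℝ)..s', (l • R (w σ) - w σ) := by
      intro s' hs'
      have hds' : IntervalIntegrable d volume 0 s' := hdt.mono_set (by
        rw [uIcc_of_le hs'.1, uIcc_of_le ht.1]; exact Icc_subset_Icc_right hs'.2)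
      change R (∫ σ in (0 : ℝ)..s', d σ) = _
      rw [← ContinuousLinearMap.intervalIntegral_comp_comm _ hds']
      refine intervalIntegral.integral_congr fun σ hσ => ?_
      rw [uIcc_of_le hs'.1] at hσ
      exact hRd σ ⟨hσ.1, hσ.2.trans hs'.2⟩
    have hnhds : Icc 0 t ∈ 𝓝[>] s := by
      refine mem_of_superset (Ioo_mem_nhdsGT hs.2) fun σ hσ => ⟨hs.1.trans hσ.1.le, hσ.2.le⟩
    have hI : IntervalIntegrable (fun σ => l • R (w σ) - w σ) volume 0 s := by
      refine ContinuousOn.intervalIntegrable (hRc.mono ?_)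
      rw [uIcc_of_le hs.1]; exact Icc_subset_Icc_right hs.2.le
    have hmeas : StronglyMeasurableAtFilter (fun σ => l • R (w σ) - w σ) (𝓝[>] s) volume :=
      ⟨Icc 0 t, hnhds, hRc.aestronglyMeasurable measurableSet_Icc⟩
    have hcw : ContinuousWithinAt (fun σ => l • R (w σ) - w σ) (Ioi s) s :=
      (hRc s ⟨hs.1, hs.2.le⟩).mono_of_mem_nhdsWithin hnhds
    have h1 := intervalIntegral.integral_hasDerivWithinAt_right hI hmeas hcw (s := Ici s)
    refine h1.congr_of_eventuallyEq ?_ (hprim s ⟨hs.1, hs.2.le⟩)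
    have : Icc s t ∈ 𝓝[≥] s := Icc_mem_nhdsGE hs.2
    filter_upwards [this] with s' hs'
    exact hprim s' ⟨hs.1.trans hs'.1, hs'.2⟩
  -- the energy estimate
  have hzero : B (R (w t)) (R (w t)) ≤ 0 := by
    have key := image_le_of_deriv_right_le_deriv_boundary (a := 0) (b := t)
      (f := fun s => Real.exp (-(2 * ω * s)) * B (R (w s)) (R (w s)))
      (f' := fun s => Real.exp (-(2 * ω * s)) * (-(2 * ω)) * B (R (w s)) (R (w s))
        + Real.exp (-(2 * ω * s)) * (B (l • R (w s) - w s) (R (w s))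
          + B (R (w s)) (l • R (w s) - w s)))
      (B := fun _ => 0) (B' := fun _ => 0) ?_ ?_ ?_ continuousOn_const ?_ ?_
      (x := t) ⟨ht.1, le_rfl⟩
    · have hp := Real.exp_pos (-(2 * ω * t))
      by_contra hc
      push Not at hc
      exact absurd key (not_le.2 (mul_pos hp hc))
    · have hc : ContinuousOn (fun s => R (w s)) (Icc 0 t) := R.continuous.comp_continuousOn hw
      exact ContinuousOn.mul (by fun_prop) ((B.continuous.comp_continuousOn hc).clm_apply hc)
    · intro s hs
      have h1 : HasDerivWithinAt (fun s : ℝ => Real.exp (-(2 * ω * s)))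
          (Real.exp (-(2 * ω * s)) * (-(2 * ω))) (Ici s) s := by
        have := (((hasDerivAt_id s).const_mul (2 * ω)).neg).exp
        simpa using this.hasDerivWithinAt
      have h2 := (B.hasFDerivAt.comp_hasDerivWithinAt s (hu s hs)).clm_apply (hu s hs)
      exact h1.mul h2
    · simp [w]
    · exact fun s _ => hasDerivWithinAt_const _ _ _
    · intro s hs
      have h1 := h.dissipative _ _ (hR (w s))
      rw [h.symm (R (w s)) (l • R (w s) - w s)]
      have hp := Real.exp_pos (-(2 * ω * s))
      nlinarith
  have hRw : R (w t) = 0 := h.eq_zero_of_form hzero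
  have hwt : w t = 0 := by
    have h1 := hR (w t)
    rw [hRw] at h1
    simpa using h.single_valued _ h1
  have h2 := hmem t ht
  change (w t, d t) ∈ 𝒢 at h2
  rw [hwt] at h2
  exact h.single_valued _ h2

end IsMaximalQuasiDissipative

end Dissipative

/-! ### Primitives of integrable functions -/

section AbsolutelyContinuous

theorem AbsolutelyContinuousOnInterval.of_dist_le {X Y : Type*} [PseudoMetricSpace X]
    [PseudoMetricSpace Y] {f : ℝ → X} {g : ℝ → Y} {a b C : ℝ}
    (hg : AbsolutelyContinuousOnInterval g a b)
    (h : ∀ x ∈ uIcc a b, ∀ y ∈ uIcc a b, dist (f x) (f y) ≤ C * dist (g x) (g y)) :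
    AbsolutelyContinuousOnInterval f a b := by
  unfold AbsolutelyContinuousOnInterval at hg ⊢
  refine squeeze_zero' (Eventually.of_forall fun _ => Finset.sum_nonneg fun i _ => dist_nonneg) ?_
    (by simpa using hg.const_mul C)
  rw [eventually_inf_principal]
  filter_upwards with E hE
  rw [Finset.mul_sum]
  refine Finset.sum_le_sum fun i hi => ?_
  simp only [AbsolutelyContinuousOnInterval.disjWithin, mem_ofPred_eq] at hE
  exact h _ (hE.1 i hi).1 _ (hE.1 i hi).2

variable {V : Type*} [NormedAddCommGroup V]

/-- The primitive of a Bochner integrable function is absolutely continuous: its increments are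
dominated by those of the primitive of the norm. -/
theorem IntervalIntegrable.absolutelyContinuous_primitive [NormedSpace ℝ V] {g : ℝ → V} {a b : ℝ}
    (hg : IntervalIntegrable g volume a b) :
    AbsolutelyContinuousOnInterval (fun θ => ∫ s in θ..b, g s) a b := by
  refine (hg.norm.absolutelyContinuousOnInterval_intervalIntegral (c := b) right_mem_uIcc).of_dist_le
    (C := 1) fun x hx y hy => ?_
  have hi : ∀ u ∈ uIcc a b, ∀ v ∈ uIcc a b, IntervalIntegrable g volume u v := fun u hu v hv =>
    hg.mono_set (uIcc_subset_uIcc hu hv)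
  rw [one_mul, dist_comm, dist_eq_norm, dist_comm, Real.dist_eq,
    intervalIntegral.integral_interval_sub_left (hi b right_mem_uIcc y hy).norm
      (hi b right_mem_uIcc x hx).norm]
  have h1 : (∫ s in y..b, g s) - ∫ s in x..b, g s = -∫ s in x..y, g s := by
    rw [← intervalIntegral.integral_add_adjacent_intervals (hi x hx y hy) (hi y hy b right_mem_uIcc)]
    abel
  rw [h1, norm_neg]
  exact intervalIntegral.norm_integral_le_abs_integral_norm

theorem ae_hasDerivAt_primitive [NormedSpace ℝ V] [CompleteSpace V] {g : ℝ → V} {a b : ℝ}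
    (hg : IntervalIntegrable g volume a b) :
    ∀ᵐ θ, θ ∈ uIcc a b → HasDerivAt (fun θ => ∫ s in θ..b, g s) (-g θ) θ := by
  filter_upwards [hg.ae_hasDerivAt_integral] with θ hθ hmem
  have h := (hθ hmem b right_mem_uIcc).neg
  refine h.congr_of_eventuallyEq (Eventually.of_forall fun u => ?_)
  simp [intervalIntegral.integral_symm u b]

/-- Variation of constants for `f' = l f - e`, `f(0) = c`, on the interval from `a` to `0`, with a
merely integrable right-hand side. -/
theorem variation_of_constants [NormedSpace ℝ V] [CompleteSpace V] {e : ℝ → V} {a : ℝ}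
    (he : IntervalIntegrable e volume a 0) (l : ℝ) (c : V) {f : ℝ → V}
    (hf : f = fun θ => Real.exp (l * θ) • (c + ∫ s in θ..0, Real.exp (-(l * s)) • e s)) :
    ContinuousOn f (uIcc a 0) ∧ ∀ θ ∈ uIcc a 0, f θ = c - ∫ s in θ..0, (l • f s - e s) := by
  have he' : IntervalIntegrable (fun s => Real.exp (-(l * s)) • e s) volume a 0 :=
    he.continuousOn_smul (by fun_prop)
  have hexp : AbsolutelyContinuousOnInterval (fun θ => Real.exp (l * θ)) a 0 :=
    ContDiffOn.absolutelyContinuousOnInterval (by fun_prop)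
  have hprim := he'.absolutelyContinuous_primitive
  have hconst : AbsolutelyContinuousOnInterval (fun _ : ℝ => c) a 0 :=
    ContDiffOn.absolutelyContinuousOnInterval contDiffOn_const
  have hfac : AbsolutelyContinuousOnInterval f a 0 := by
    rw [hf]
    exact hexp.smul (hconst.add hprim)
  have hg : IntervalIntegrable (fun s => l • f s - e s) volume a 0 :=
    (hfac.continuousOn.intervalIntegrable.smul l).sub he
  refine ⟨hfac.continuousOn, ?_⟩
  have hHac : AbsolutelyContinuousOnInterval
      (fun θ => f θ + ∫ s in θ..0, (l • f s - e s)) a 0 :=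
    hfac.add hg.absolutelyContinuous_primitive
  have hH0 : ∀ᵐ θ, θ ∈ uIcc a 0 →
      HasDerivAt (fun θ => f θ + ∫ s in θ..0, (l • f s - e s)) 0 θ := by
    filter_upwards [ae_hasDerivAt_primitive hg, ae_hasDerivAt_primitive he'] with θ h1 h2 hθ
    have h3 : HasDerivAt (fun θ : ℝ => Real.exp (l * θ)) (Real.exp (l * θ) * l) θ := by
      simpa using ((hasDerivAt_id θ).const_mul l).exp
    have h4 : HasDerivAt f (Real.exp (l * θ) • (-(Real.exp (-(l * θ)) • e θ))
        + (Real.exp (l * θ) * l) • (c + ∫ s in θ..0, Real.exp (-(l * s)) • e s)) θ := by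
      rw [hf]
      exact h3.smul ((h2 hθ).const_add c)
    refine (h4.add (h1 hθ)).congr_deriv ?_
    have h5 : f θ = Real.exp (l * θ) • (c + ∫ s in θ..0, Real.exp (-(l * s)) • e s) := by rw [hf]
    rw [h5, smul_neg, smul_smul, ← Real.exp_add, add_neg_cancel, Real.exp_zero, one_smul,
      mul_comm (Real.exp (l * θ)) l, mul_smul]
    abel
  -- An absolutely continuous function whose derivative vanishes almost everywhere is constant.
  obtain ⟨C, hC⟩ := hHac.const_of_ae_hasDerivAt_zero hH0
  intro θ hθ
  have h1 := hC θ hθ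
  have h2 := hC 0 right_mem_uIcc
  have h3 : f 0 = c := by simp [hf]
  simp only [intervalIntegral.integral_same, add_zero, h3] at h2
  rw [h2, ← h1]
  abel

variable [InnerProductSpace ℝ V] [CompleteSpace V]

/-- The energy identity with an affine weight for the primitive of an integrable function. -/
theorem integral_weight_mul_inner {g : ℝ → V} {a b : ℝ} (hg : IntervalIntegrable g volume a b)
    (v : V) (m k : ℝ) {f : ℝ → V} (hf : f = fun θ => v - ∫ s in θ..b, g s) :
    2 * ∫ θ in a..b, (m + k * θ) * inner ℝ (g θ) (f θ)
      = (m + k * b) * ‖f b‖ ^ 2 - (m + k * a) * ‖f a‖ ^ 2 - k * ∫ θ in a..b, ‖f θ‖ ^ 2 := by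
  have hfac : AbsolutelyContinuousOnInterval f a b := by
    refine hg.absolutelyContinuous_primitive.of_dist_le (C := 1) fun x _ y _ => ?_
    rw [hf, one_mul, dist_sub_left]
  obtain ⟨C, hC⟩ := hfac.exists_bound
  have hsq : AbsolutelyContinuousOnInterval (fun θ => ‖f θ‖ ^ 2) a b := by
    refine hfac.of_dist_le (C := 2 * C) fun x hx y hy => ?_
    rw [Real.dist_eq, show ‖f x‖ ^ 2 - ‖f y‖ ^ 2 = (‖f x‖ + ‖f y‖) * (‖f x‖ - ‖f y‖) by ring, abs_mul,
      dist_eq_norm]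
    have h1 := hC x hx
    have h2 := hC y hy
    refine mul_le_mul ?_ (abs_norm_sub_norm_le _ _) (abs_nonneg _) ?_
    · rw [abs_of_nonneg (by positivity)]; linarith
    · linarith [norm_nonneg (f x)]
  have hw : AbsolutelyContinuousOnInterval (fun θ : ℝ => m + k * θ) a b :=
    ContDiffOn.absolutelyContinuousOnInterval (by fun_prop)
  have hfc := hfac.continuousOn
  have hprod := (hw.mul hsq).integral_deriv_eq_sub
  have hderiv : ∀ᵐ θ, θ ∈ uIoc a b →
      deriv ((fun θ : ℝ => m + k * θ) * fun θ => ‖f θ‖ ^ 2) θ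
        = k * ‖f θ‖ ^ 2 + 2 * ((m + k * θ) * inner ℝ (g θ) (f θ)) := by
    filter_upwards [ae_hasDerivAt_primitive hg] with θ h1 hθ
    have h2 : HasDerivAt f (g θ) θ := by
      have := (h1 (uIoc_subset_uIcc hθ)).const_sub v
      rw [hf]
      simpa using this
    have h3 : HasDerivAt (fun θ : ℝ => m + k * θ) k θ := by
      simpa using ((hasDerivAt_id θ).const_mul k).const_add m
    have h4 := h3.mul h2.norm_sq
    rw [h4.deriv, real_inner_comm]
    ring
  rw [intervalIntegral.integral_congr_ae hderiv] at hprod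
  have hi1 : IntervalIntegrable (fun θ => k * ‖f θ‖ ^ 2) volume a b :=
    ContinuousOn.intervalIntegrable (by fun_prop)
  have hi2 : IntervalIntegrable (fun θ => (m + k * θ) * inner ℝ (g θ) (f θ)) volume a b := by
    refine IntervalIntegrable.continuousOn_mul ?_ (by fun_prop)
    rw [intervalIntegrable_iff] at hg ⊢
    refine Integrable.mono' (hg.norm.mul_const C) ?_ ?_
    · exact hg.1.inner ((hfc.mono uIoc_subset_uIcc).aestronglyMeasurable measurableSet_uIoc)
    · refine (ae_restrict_iff' measurableSet_uIoc).2 (Eventually.of_forall fun θ hθ => ?_)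
      refine (norm_inner_le_norm _ _).trans ?_
      gcongr
      exact hC θ (uIoc_subset_uIcc hθ)
  rw [intervalIntegral.integral_add hi1 (hi2.const_mul 2), intervalIntegral.integral_const_mul,
    intervalIntegral.integral_const_mul] at hprod
  simp only [Pi.mul_apply] at hprod
  linarith

end AbsolutelyContinuous

/-! ### Functions of two variables as functions with values in `L²` -/

section Sections

variable {X Θ V : Type*} [MeasurableSpace X] [MeasurableSpace Θ] {μ : Measure X} {ν : Measure Θ}
  [NormedAddCommGroup V] [InnerProductSpace ℝ V]

/-- Vectors of an orthonormal family are at distance `√2` from each other, so a separable space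
has room for countably many only. -/
theorem Orthonormal.countable_index {E : Type*} [NormedAddCommGroup E] [InnerProductSpace ℝ E]
    [TopologicalSpace.SeparableSpace E] {ι : Type*} {b : ι → E} (hb : Orthonormal ℝ b) :
    Countable ι := by
  have hdist : ∀ i j, i ≠ j → 1 < ‖b i - b j‖ := by
    intro i j hij
    have h1 := norm_sub_sq_real (b i) (b j)
    rw [hb.1 i, hb.1 j, hb.2 hij] at h1
    by_contra hc
    push Not at hc
    nlinarith [norm_nonneg (b i - b j)]
  rw [← countable_univ_iff]
  refine PairwiseDisjoint.countable_of_isOpen (s := fun i => Metric.ball (b i) (1 / 2)) ?_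
    (fun i _ => Metric.isOpen_ball) (fun i _ => ⟨b i, Metric.mem_ball_self (by norm_num)⟩)
  intro i _ j _ hij
  refine Metric.ball_disjoint_ball ?_
  rw [dist_eq_norm]
  linarith [hdist i j hij]

/-- Weak measurability implies strong measurability in a separable Hilbert space. -/
theorem aestronglyMeasurable_of_inner {E : Type*} [NormedAddCommGroup E] [InnerProductSpace ℝ E]
    [CompleteSpace E] [TopologicalSpace.SeparableSpace E] {G : X → E}
    (hG : ∀ e, AEStronglyMeasurable (fun x => inner ℝ e (G x)) μ) : AEStronglyMeasurable G μ := by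
  obtain ⟨w, b, -⟩ := exists_hilbertBasis ℝ E
  have : Countable w := b.orthonormal.countable_index
  refine aestronglyMeasurable_of_tendsto_ae (u := (atTop : Filter (Finset w)))
    (f := fun s x => ∑ i ∈ s, inner ℝ (b i) (G x) • b i) (fun s => ?_)
    (Eventually.of_forall fun x => ?_)
  · refine Finset.aestronglyMeasurable_fun_sum _ fun i _ => ?_
    exact (hG (b i)).smul_const _
  · have := b.hasSum_repr (G x)
    simpa [HasSum, b.repr_apply_apply] using this

variable [CompleteSpace V]

/-- The Bochner integral of an `L²`-valued function is computed pointwise. -/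
theorem integral_section_ae_eq [SFinite μ] [IsFiniteMeasure ν] {f : X → Θ → V}
    (hf : Integrable (Function.uncurry f) (μ.prod ν)) {G : X → Lp V 2 ν} (hGi : Integrable G μ)
    (hG : ∀ᵐ x ∂μ, G x =ᵐ[ν] f x) :
    (∫ x, G x ∂μ : Lp V 2 ν) =ᵐ[ν] fun θ => ∫ x, f x θ ∂μ := by
  have hint : ∀ g : Lp V 2 ν, Integrable g ν := fun g =>
    (Lp.memLp g).integrable (by norm_num)
  refine Integrable.ae_eq_of_forall_setIntegral_eq _ _ (hint _) hf.integral_prod_right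
    fun s hs _ => ?_
  let Λ : Lp V 2 ν →L[ℝ] V := (ContinuousLinearMap.lsmul ℝ ℝ).lpPairing ν 2 2
    (indicatorConstLp 2 hs (measure_ne_top ν s) (1 : ℝ))
  have hΛ : ∀ g : Lp V 2 ν, Λ g = ∫ θ in s, g θ ∂ν := by
    intro g
    simp only [Λ, ContinuousLinearMap.lpPairing_eq_integral]
    rw [← integral_indicator hs]
    refine integral_congr_ae ?_
    filter_upwards [indicatorConstLp_coeFn (p := 2) (hs := hs) (hμs := measure_ne_top ν s)
      (c := (1 : ℝ))] with θ hθ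
    rw [hθ]
    by_cases h : θ ∈ s <;> simp [h]
  rw [← hΛ, ← ContinuousLinearMap.integral_comp_comm _ hGi]
  have h2 : ∫ x, Λ (G x) ∂μ = ∫ x, ∫ θ in s, f x θ ∂ν ∂μ := by
    refine integral_congr_ae ?_
    filter_upwards [hG] with x hx
    rw [hΛ]
    exact integral_congr_ae (ae_restrict_of_ae hx)
  rw [h2]
  refine integral_integral_swap (μ := μ) (ν := ν.restrict s) (f := f) ?_
  exact hf.mono_measure (Measure.prod_mono le_rfl Measure.restrict_le_self)

variable [TopologicalSpace.SeparableSpace V]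

/-- A jointly measurable function of two variables is measurable as a function of the first one
with values in `L²` of the second one. -/
theorem aestronglyMeasurable_of_section [SFinite μ] [SFinite ν] [MeasurableSpace.CountablyGenerated Θ]
    {f : X → Θ → V} (hf : AEStronglyMeasurable (Function.uncurry f) (μ.prod ν))
    {G : X → Lp V 2 ν} (hG : ∀ᵐ x ∂μ, G x =ᵐ[ν] f x) : AEStronglyMeasurable G μ := by
  have : Fact ((2 : ℝ≥0∞) ≠ ∞) := ⟨by norm_num⟩
  refine aestronglyMeasurable_of_inner fun e => ?_
  have h1 : AEStronglyMeasurable (fun x => ∫ θ, inner ℝ (e θ) (f x θ) ∂ν) μ := by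
    have h2 : AEStronglyMeasurable (fun p : X × Θ => inner ℝ (e p.2) (Function.uncurry f p))
        (μ.prod ν) := (Lp.aestronglyMeasurable e).comp_snd.inner hf
    exact h2.integral_prod_right'
  refine h1.congr ?_
  filter_upwards [hG] with x hx
  rw [L2.inner_def]
  refine integral_congr_ae ?_
  filter_upwards [hx] with θ hθ
  rw [hθ]

/-- A square integrable function of two variables is square integrable as a function of the first
one with values in `L²` of the second one. -/
theorem memLp_of_section [SFinite μ] [SFinite ν] [MeasurableSpace.CountablyGenerated Θ]
    {f : X → Θ → V} (hf : MemLp (Function.uncurry f) 2 (μ.prod ν))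
    {G : X → Lp V 2 ν} (hG : ∀ᵐ x ∂μ, G x =ᵐ[ν] f x) : MemLp G 2 μ := by
  refine ⟨aestronglyMeasurable_of_section hf.1 hG, ?_⟩
  rw [eLpNorm_lt_top_iff_lintegral_rpow_enorm_lt_top (by norm_num) (by norm_num)]
  have h1 := hf.2
  rw [eLpNorm_lt_top_iff_lintegral_rpow_enorm_lt_top (by norm_num) (by norm_num),
    lintegral_prod _ (hf.1.enorm.pow_const _)] at h1
  refine lt_of_eq_of_lt (lintegral_congr_ae ?_) h1
  filter_upwards [hG] with x hx
  rw [Lp.enorm_def, eLpNorm_congr_ae hx,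
    eLpNorm_eq_lintegral_rpow_enorm_toReal (by norm_num) (by norm_num)]
  simp only [ENNReal.toReal_ofNat, Function.uncurry_apply_pair]
  rw [← ENNReal.rpow_mul]
  simp

end Sections

/-! ### The state space and the graph of the generator -/

section Tensor

variable {X : Type*} [MeasurableSpace X] {μ : Measure X}
  {E : Type*} [NormedAddCommGroup E] [NormedSpace ℝ E]

/-- The bilinear map `(v, ξ) ↦ ξ(·) v` from `E × L²(μ)` to `L²(μ; E)`. -/
def lpTensor (μ : Measure X) : E →L[ℝ] Lp ℝ 2 μ →L[ℝ] Lp E 2 μ :=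
  (ContinuousLinearMap.lsmul ℝ ℝ : ℝ →L[ℝ] E →L[ℝ] E).flip.compLpL₂ 2 μ

theorem coeFn_lpTensor (v : E) (ξ : Lp ℝ 2 μ) : lpTensor μ v ξ =ᵐ[μ] fun x => ξ x • v := by
  simp only [lpTensor, ContinuousLinearMap.compLpL₂_apply_apply]
  exact ContinuousLinearMap.coeFn_compLp _ _

theorem norm_lpTensor_le (v : E) (ξ : Lp ℝ 2 μ) : ‖lpTensor μ v ξ‖ ≤ ‖v‖ * ‖ξ‖ := by
  rw [lpTensor, ContinuousLinearMap.compLpL₂_apply_apply]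
  refine (ContinuousLinearMap.norm_compLp_le _ _).trans ?_
  gcongr
  refine ContinuousLinearMap.opNorm_le_bound _ (norm_nonneg _) fun c => ?_
  simp [norm_smul, mul_comm]

end Tensor

section Segment

variable {V : Type*} [NormedAddCommGroup V]

theorem segment_intervalIntegrable {r : ℝ} (hr : 0 ≤ r) (g : SegmentSpace V r) :
    IntervalIntegrable g volume (-r) 0 := by
  rw [intervalIntegrable_iff_integrableOn_Ioc_of_le (by linarith),
    ← integrableOn_Icc_iff_integrableOn_Ioc]
  exact (Lp.memLp g).integrable (by norm_num)

end Segment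

namespace NeutralSystem

variable {U V H : Type*}
  [NormedAddCommGroup U] [InnerProductSpace ℝ U]
  [NormedAddCommGroup V] [InnerProductSpace ℝ V]
  [NormedAddCommGroup H] [InnerProductSpace ℝ H]
  (N : NeutralSystem U V H)

theorem toDual_apply (h : H) (w : V) : N.toDual h w = inner ℝ h (N.j w) := rfl

theorem toDual_add (h k : H) : N.toDual (h + k) = N.toDual h + N.toDual k := by
  ext w; simp [toDual_apply, inner_add_left]

theorem toDual_sub (h k : H) : N.toDual (h - k) = N.toDual h - N.toDual k := by
  ext w; simp [toDual_apply, inner_sub_left]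

theorem toDual_smul (c : ℝ) (h : H) : N.toDual (c • h) = c • N.toDual h := by
  ext w; simp [toDual_apply, inner_smul_left]

/-- The embedding `H → V*` as a continuous linear map. -/
def toDualL : H →L[ℝ] StrongDual ℝ V :=
  LinearMap.mkContinuous ⟨⟨N.toDual, N.toDual_add⟩, N.toDual_smul⟩ ‖N.j‖ fun h => by
    refine ContinuousLinearMap.opNorm_le_bound _ (by positivity) fun w => ?_
    refine (norm_inner_le_norm _ _).trans ?_
    calc ‖h‖ * ‖N.j w‖ ≤ ‖h‖ * (‖N.j‖ * ‖w‖) := by gcongr; exact N.j.le_opNorm w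
      _ = _ := by ring

@[simp] theorem toDualL_apply (h : H) : N.toDualL h = N.toDual h := rfl

theorem toDual_injective : Function.Injective N.toDual := by
  intro h k hk
  rw [← sub_eq_zero]
  refine N.j_dense.eq_zero_of_inner_left ℝ fun w => ?_
  rw [inner_sub_left, ← toDual_apply, ← toDual_apply, hk, sub_self]

theorem A_apply (v w : V) : N.A v w = N.a w v := rfl

theorem ae_restrict_Icc_intervalIntegral_congr {r : ℝ} {g g' : ℝ → V}
    (h : g =ᵐ[volume.restrict (Icc (-r) 0)] g') {θ : ℝ} (hθ : θ ∈ Icc (-r) 0) :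
    ∫ s in θ..0, g s = ∫ s in θ..0, g' s := by
  refine intervalIntegral.integral_congr_ae ?_
  rw [uIoc_of_le hθ.2]
  filter_upwards [(ae_restrict_iff' measurableSet_Icc).1 h] with s hs hmem
  exact hs ⟨hθ.1.trans hmem.1.le, hmem.2⟩

/-- The value `φ₁(θ) = c - ∫_θ^0 φ₁'` of the absolutely continuous representative. -/
def primitive {r : ℝ} (c : V) (g : SegmentSpace V r) (θ : ℝ) : V := c - ∫ s in θ..0, g s

/-- The domain of the generator in terms of `c = φ₁(0)` and `v = φ₁(0) - D φ₁`: the function `φ₁` is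
the primitive of its derivative that takes the value `c` at `0`. -/
theorem mem_graphGenerator_iff (p : StateSpace H V N.r × StateSpace H V N.r) :
    p ∈ N.graphGenerator ↔ ∃ c v : V,
      p.1.snd =ᵐ[volume.restrict (Icc (-N.r) 0)] primitive c p.2.snd ∧
      v = c - (N.D₁ (primitive c p.2.snd (-N.r)) + N.D₂ p.1.snd) ∧
      p.1.fst = N.j v ∧
      N.toDual p.2.fst = N.A v + (N.F₁ (primitive c p.2.snd (-N.r)) + N.F₂ p.1.snd) := by
  have hr : -N.r ∈ Icc (-N.r) 0 := ⟨le_rfl, by linarith [N.r_pos]⟩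
  have h0 : (0 : ℝ) ∈ Icc (-N.r) 0 := ⟨by linarith [N.r_pos], le_rfl⟩
  constructor
  · rintro ⟨f, v, h1, h2, h3, h4, h5⟩
    have h6 : f (-N.r) = primitive (f 0) p.2.snd (-N.r) := h2 _ hr
    refine ⟨f 0, v, ?_, by rw [← h6]; exact h3, h4, by rw [← h6]; exact h5⟩
    refine h1.trans ((ae_restrict_iff' measurableSet_Icc).2 (Eventually.of_forall fun θ hθ => ?_))
    exact h2 θ hθ
  · rintro ⟨c, v, h1, h2, h3, h4⟩
    refine ⟨primitive c p.2.snd, v, h1, fun θ _ => by simp [primitive], ?_, h3, h4⟩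
    simpa [primitive] using h2

theorem primitive_zero {r : ℝ} (c : V) (g : SegmentSpace V r) : primitive c g 0 = c := by
  simp [primitive]

theorem primitive_congr {r : ℝ} (c : V) {g : SegmentSpace V r} {g' : ℝ → V}
    (h : g =ᵐ[volume.restrict (Icc (-r) 0)] g') {θ : ℝ} (hθ : θ ∈ Icc (-r) 0) :
    primitive c g θ = c - ∫ s in θ..0, g' s := by
  rw [primitive, ae_restrict_Icc_intervalIntegral_congr h hθ]

theorem primitive_add {r : ℝ} (hr : 0 ≤ r) (c c' : V) (g g' : SegmentSpace V r) {θ : ℝ}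
    (hθ : θ ∈ Icc (-r) 0) :
    primitive (c + c') (g + g') θ = primitive c g θ + primitive c' g' θ := by
  rw [primitive_congr (c + c') (Lp.coeFn_add g g') hθ]
  have hi : ∀ g : SegmentSpace V r, IntervalIntegrable g volume θ 0 := fun g =>
    (segment_intervalIntegrable hr g).mono_set (by
      rw [uIcc_of_le hθ.2, uIcc_of_le (by linarith)]; exact Icc_subset_Icc_left hθ.1)
  simp only [Pi.add_apply]
  rw [intervalIntegral.integral_add (hi g) (hi g'), primitive, primitive]
  abel

theorem primitive_smul {r : ℝ} (a : ℝ) (c : V) (g : SegmentSpace V r) {θ : ℝ}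
    (hθ : θ ∈ Icc (-r) 0) : primitive (a • c) (a • g) θ = a • primitive c g θ := by
  rw [primitive_congr (a • c) (Lp.coeFn_smul a g) hθ]
  simp only [Pi.smul_apply]
  rw [intervalIntegral.integral_smul, primitive, smul_sub]

/-- The graph of the generator as a linear subspace. -/
def generatorSubmodule : Submodule ℝ (StateSpace H V N.r × StateSpace H V N.r) where
  carrier := N.graphGenerator
  add_mem' := by
    intro p q hp hq
    rw [mem_graphGenerator_iff] at hp hq ⊢
    obtain ⟨c, v, h1, h2, h3, h4⟩ := hp
    obtain ⟨c', v', h1', h2', h3', h4'⟩ := hq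
    have hr : -N.r ∈ Icc (-N.r) 0 := ⟨le_rfl, by linarith [N.r_pos]⟩
    have hP : ∀ θ ∈ Icc (-N.r) 0, primitive (c + c') (p + q).2.snd θ
        = primitive c p.2.snd θ + primitive c' q.2.snd θ := fun θ hθ => by
      rw [Prod.snd_add, WithLp.add_snd, primitive_add N.r_pos.le _ _ _ _ hθ]
    refine ⟨c + c', v + v', ?_, ?_, ?_, ?_⟩
    · rw [Prod.fst_add, WithLp.add_snd]
      filter_upwards [Lp.coeFn_add p.1.snd q.1.snd, h1, h1', ae_restrict_mem measurableSet_Icc]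
        with θ e1 e2 e3 hθ
      rw [e1, Pi.add_apply, e2, e3, hP θ hθ]
    · rw [hP _ hr, Prod.fst_add, WithLp.add_snd, map_add, map_add, h2, h2']; abel
    · rw [Prod.fst_add, WithLp.add_fst, h3, h3', map_add]
    · rw [hP _ hr, Prod.snd_add, WithLp.add_fst, N.toDual_add, h4, h4', Prod.fst_add,
        WithLp.add_snd, map_add, map_add, map_add]; abel
  zero_mem' := by
    rw [mem_graphGenerator_iff]
    have hr : -N.r ∈ Icc (-N.r) 0 := ⟨le_rfl, by linarith [N.r_pos]⟩
    have hP : ∀ θ ∈ Icc (-N.r) 0,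
        primitive 0 (0 : StateSpace H V N.r × StateSpace H V N.r).2.snd θ = 0 := by
      intro θ hθ
      have := primitive_smul (0 : ℝ) (0 : V) (0 : SegmentSpace V N.r) hθ
      simpa using this
    refine ⟨0, 0, ?_, ?_, ?_, ?_⟩
    · filter_upwards [Lp.coeFn_zero V 2 (volume.restrict (Icc (-N.r) 0)),
        ae_restrict_mem measurableSet_Icc] with θ e1 hθ
      rw [hP θ hθ]; exact e1
    · rw [hP _ hr]; simp
    · simp
    · rw [hP _ hr]
      have : N.toDual 0 = 0 := N.toDualL.map_zero
      simp [this]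
  smul_mem' := by
    intro a p hp
    rw [mem_graphGenerator_iff] at hp ⊢
    obtain ⟨c, v, h1, h2, h3, h4⟩ := hp
    have hr : -N.r ∈ Icc (-N.r) 0 := ⟨le_rfl, by linarith [N.r_pos]⟩
    have hP : ∀ θ ∈ Icc (-N.r) 0, primitive (a • c) (a • p).2.snd θ
        = a • primitive c p.2.snd θ := fun θ hθ => by
      rw [Prod.smul_snd, WithLp.smul_snd, primitive_smul _ _ _ hθ]
    refine ⟨a • c, a • v, ?_, ?_, ?_, ?_⟩
    · rw [Prod.smul_fst, WithLp.smul_snd]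
      filter_upwards [Lp.coeFn_smul a p.1.snd, h1, ae_restrict_mem measurableSet_Icc]
        with θ e1 e2 hθ
      rw [e1, Pi.smul_apply, e2, hP θ hθ]
    · rw [hP _ hr, Prod.smul_fst, WithLp.smul_snd, map_smul, map_smul, h2, smul_sub, smul_add]
    · rw [Prod.smul_fst, WithLp.smul_fst, h3, map_smul]
    · rw [hP _ hr, Prod.smul_snd, WithLp.smul_fst, N.toDual_smul, h4, Prod.smul_fst,
        WithLp.smul_snd, map_smul, map_smul, map_smul, smul_add, smul_add]

theorem continuousOn_primitive {r : ℝ} (hr : 0 ≤ r) (c : V) (g : SegmentSpace V r) :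
    ContinuousOn (primitive c g) (Icc (-r) 0) := by
  have h := (segment_intervalIntegrable hr g).absolutelyContinuous_primitive.continuousOn
  rw [uIcc_of_le (by linarith)] at h
  exact continuousOn_const.sub h

/-- The derivative of `φ₁` is determined by `φ₁`, and then `A φ₀ + F φ₁` is determined as well. -/
theorem generator_single_valued [CompleteSpace V] (z : StateSpace H V N.r)
    (hz : (0, z) ∈ N.generatorSubmodule) : z = 0 := by
  obtain ⟨c, v, h1, h2, h3, h4⟩ := (N.mem_graphGenerator_iff _).1 hz
  have hr := N.r_pos
  simp only [WithLp.zero_snd, WithLp.zero_fst, map_zero, add_zero] at h1 h2 h3 h4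
  have hP : EqOn (primitive c z.snd) (fun _ => 0) (Icc (-N.r) 0) := by
    refine Measure.eqOn_Icc_of_ae_eq volume (by linarith : -N.r ≠ 0) ?_
      (continuousOn_primitive hr.le _ _) continuousOn_const
    filter_upwards [h1, Lp.coeFn_zero V 2 (volume.restrict (Icc (-N.r) 0))] with θ e1 e2
    rw [← e1, e2]; rfl
  have hv : v = 0 := N.j_injective (by rw [← h3, map_zero])
  have hPr : primitive c z.snd (-N.r) = 0 := hP ⟨le_rfl, by linarith⟩
  have hfst : z.fst = 0 := by
    refine N.toDual_injective ?_
    have h0 : N.toDual 0 = 0 := N.toDualL.map_zero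
    rw [h4, hv, hPr, h0]; simp
  have hsnd : z.snd = 0 := by
    rw [Lp.eq_zero_iff_ae_eq_zero]
    refine (ae_restrict_iff' measurableSet_Icc).2 ?_
    filter_upwards [ae_hasDerivAt_primitive (segment_intervalIntegrable hr.le z.snd),
      Measure.ae_ne volume (-N.r), Measure.ae_ne volume (0 : ℝ)] with θ hθ hne1 hne2 hmem
    have h5 := (hθ (by rw [uIcc_of_le (by linarith)]; exact hmem)).const_sub c
    have h6 : HasDerivAt (primitive c z.snd) 0 θ := by
      refine (hasDerivAt_const θ (0 : V)).congr_of_eventuallyEq ?_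
      have : Ioo (-N.r) 0 ∈ 𝓝 θ :=
        Ioo_mem_nhds (lt_of_le_of_ne hmem.1 (Ne.symm hne1)) (lt_of_le_of_ne hmem.2 hne2)
      filter_upwards [this] with s hs
      exact hP ⟨hs.1.le, hs.2.le⟩
    have h7 := h5.unique h6
    simpa using h7
  refine (WithLp.equiv 2 _).injective (Prod.ext hfst hsnd)

end NeutralSystem

/-! ### Quasi-dissipativity of the generator -/

section Segment

variable {V : Type*} [NormedAddCommGroup V]

theorem integrable_norm_sq_segment {r : ℝ} (g : SegmentSpace V r) :
    Integrable (fun θ => ‖g θ‖ ^ 2) (volume.restrict (Icc (-r) 0)) :=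
  (memLp_two_iff_integrable_sq_norm (Lp.aestronglyMeasurable g)).1 (Lp.memLp g)

theorem memLp_segment_of_continuousOn {r : ℝ} {f : ℝ → V} (hf : ContinuousOn f (Icc (-r) 0)) :
    MemLp f 2 ((volume : Measure ℝ).restrict (Icc (-r) 0)) := by
  obtain ⟨C, hC⟩ := isCompact_Icc.exists_bound_of_continuousOn hf
  have hm : AEStronglyMeasurable f ((volume : Measure ℝ).restrict (Icc (-r) 0)) :=
    (hf.aestronglyMeasurable_of_isCompact isCompact_Icc measurableSet_Icc)
  exact MemLp.of_bound hm C
    ((ae_restrict_iff' measurableSet_Icc).2 (Eventually.of_forall hC))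

end Segment

namespace NeutralSystem

variable {U V H : Type*}
  [NormedAddCommGroup U] [InnerProductSpace ℝ U]
  [NormedAddCommGroup V] [InnerProductSpace ℝ V]
  [NormedAddCommGroup H] [InnerProductSpace ℝ H]
  (N : NeutralSystem U V H)

theorem memLp_affine_weight (r m k : ℝ) :
    MemLp (fun θ : ℝ => m + k * θ) ∞ ((volume : Measure ℝ).restrict (Icc (-r) 0)) := by
  obtain ⟨C, hC⟩ := (isCompact_Icc (a := -r) (b := (0 : ℝ))).exists_bound_of_continuousOn
    (f := fun θ : ℝ => m + k * θ) (by fun_prop)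
  exact memLp_top_of_bound (by fun_prop : Continuous fun θ : ℝ => m + k * θ).aestronglyMeasurable C
    ((ae_restrict_iff' measurableSet_Icc).2 (Eventually.of_forall hC))

/-- The form `⟨φ₀, ψ₀⟩_H + ∫ (m + k θ) ⟨φ₁(θ), ψ₁(θ)⟩_V dθ` on the state space. -/
def weightedForm (m k : ℝ) :
    StateSpace H V N.r →L[ℝ] StateSpace H V N.r →L[ℝ] ℝ :=
  (innerSL ℝ).bilinearComp (WithLp.fstL 2 ℝ H (SegmentSpace V N.r))
      (WithLp.fstL 2 ℝ H (SegmentSpace V N.r))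
    + (innerSL ℝ).bilinearComp
      (((ContinuousLinearMap.lsmul ℝ ℝ : ℝ →L[ℝ] V →L[ℝ] V).holderL
          (volume.restrict (Icc (-N.r) 0)) ∞ 2 2 (memLp_affine_weight N.r m k).toLp)
        ∘L WithLp.sndL 2 ℝ H (SegmentSpace V N.r))
      (WithLp.sndL 2 ℝ H (SegmentSpace V N.r))

theorem weightedForm_apply (m k : ℝ) (p q : StateSpace H V N.r) :
    N.weightedForm m k p q = inner ℝ p.fst q.fst
      + ∫ θ in Icc (-N.r) 0, (m + k * θ) * inner ℝ (p.snd θ) (q.snd θ) := by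
  change inner ℝ p.fst q.fst + inner ℝ ((ContinuousLinearMap.lsmul ℝ ℝ : ℝ →L[ℝ] V →L[ℝ] V).holder 2
    (memLp_affine_weight N.r m k).toLp p.snd) q.snd = _
  rw [L2.inner_def]
  congr 1
  refine integral_congr_ae ?_
  filter_upwards [(ContinuousLinearMap.lsmul ℝ ℝ : ℝ →L[ℝ] V →L[ℝ] V).coeFn_holder (r := 2)
    (memLp_affine_weight N.r m k).toLp p.snd, (memLp_affine_weight N.r m k).coeFn_toLp]
    with θ h1 h2
  rw [h1, h2, ContinuousLinearMap.lsmul_apply, real_inner_smul_left]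

theorem norm_sq_segment {r : ℝ} (g : SegmentSpace V r) :
    ‖g‖ ^ 2 = ∫ θ in Icc (-r) 0, ‖g θ‖ ^ 2 := by
  rw [← real_inner_self_eq_norm_sq, L2.inner_def]
  simp

theorem weightedForm_coercive {m k : ℝ} (hk : k ≤ 0) (p : StateSpace H V N.r) :
    ‖p.fst‖ ^ 2 + m * ‖p.snd‖ ^ 2 ≤ N.weightedForm m k p p := by
  rw [weightedForm_apply, real_inner_self_eq_norm_sq, norm_sq_segment]
  gcongr
  rw [← integral_const_mul]
  obtain ⟨C, hC⟩ := (isCompact_Icc (a := -N.r) (b := (0 : ℝ))).exists_bound_of_continuousOn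
    (f := fun θ : ℝ => m + k * θ) (by fun_prop)
  refine integral_mono_ae ((integrable_norm_sq_segment p.snd).const_mul m) ?_ ?_
  · simp only [real_inner_self_eq_norm_sq]
    refine (integrable_norm_sq_segment p.snd).bdd_mul (c := C)
      (by fun_prop : Continuous fun θ : ℝ => m + k * θ).aestronglyMeasurable ?_
    exact (ae_restrict_iff' measurableSet_Icc).2 (Eventually.of_forall hC)
  · refine (ae_restrict_iff' measurableSet_Icc).2 (Eventually.of_forall fun θ hθ => ?_)
    simp only [real_inner_self_eq_norm_sq]
    have : 0 ≤ k * θ := mul_nonneg_of_nonpos_of_nonpos hk hθ.2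
    gcongr
    linarith

/-- The generator is quasi-dissipative for a weight that is small at `0` and large at `-r`: the
boundary term at `-r` absorbs the point delays and coercivity absorbs the boundary term at `0`. -/
theorem exists_quasiDissipative_weight [CompleteSpace V] :
    ∃ m k ω : ℝ, 0 < m ∧ k ≤ 0 ∧ 0 ≤ ω ∧ ∀ x z, (x, z) ∈ N.graphGenerator →
      N.weightedForm m k z x ≤ ω * N.weightedForm m k x x := by
  obtain ⟨κ, hκ, hcoer⟩ := N.coercive
  have hr := N.r_pos
  set d₁ := ‖N.D₁‖
  set d₂ := ‖N.D₂‖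
  set f₁ := ‖N.F₁‖
  set f₂ := ‖N.F₂‖
  have hd₁ : 0 ≤ d₁ := N.D₁.opNorm_nonneg
  have hd₂ : 0 ≤ d₂ := N.D₂.opNorm_nonneg
  have hf₁ : 0 ≤ f₁ := N.F₁.opNorm_nonneg
  have hf₂ : 0 ≤ f₂ := N.F₂.opNorm_nonneg
  -- The inequality of Young turns the terms with the point delay `q` into `M / 2 * ‖q‖ ^ 2`.
  set M := 2 * (f₁ ^ 2 / κ + κ / 4 * d₁ ^ 2) with hM
  have hM0 : 0 ≤ M := by positivity
  -- the weight is `κ / 6` at `0` and `κ / 6 + M` at `-r`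
  set m := κ / 6 with hm
  set k := -(M / N.r) with hk
  set ω₀ := f₂ ^ 2 / κ + κ / 4 * d₂ ^ 2 + M / (2 * N.r) with hω₀
  have hω₀0 : 0 ≤ ω₀ := by positivity
  have hm0 : 0 < m := by positivity
  have hk0 : k ≤ 0 := neg_nonpos.2 (by positivity)
  refine ⟨m, k, ω₀ / m, hm0, hk0, by positivity, fun x z hxz => ?_⟩
  obtain ⟨c, v, h1, h2, h3, h4⟩ := (N.mem_graphGenerator_iff _).1 hxz
  simp only at h1 h2 h3 h4
  set q := primitive c z.snd (-N.r) with hq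
  have hint := segment_intervalIntegrable hr.le z.snd
  have hE := integral_weight_mul_inner hint c m k (f := primitive c z.snd) rfl
  have hform : N.weightedForm m k z x = inner ℝ z.fst x.fst
      + ∫ θ in (-N.r)..0, (m + k * θ) * inner ℝ (z.snd θ) (primitive c z.snd θ) := by
    rw [weightedForm_apply, intervalIntegral.integral_of_le (by linarith),
      ← integral_Icc_eq_integral_Ioc]
    congr 1
    refine integral_congr_ae ?_
    filter_upwards [h1] with θ hθ
    rw [hθ]
  have hnorm : ‖x.snd‖ ^ 2 = ∫ θ in (-N.r)..0, ‖primitive c z.snd θ‖ ^ 2 := by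
    rw [norm_sq_segment, intervalIntegral.integral_of_le (by linarith),
      ← integral_Icc_eq_integral_Ioc]
    refine integral_congr_ae ?_
    filter_upwards [h1] with θ hθ
    rw [hθ]
  rw [← hnorm, primitive_zero] at hE
  have hend : m + k * -N.r = m + M := by rw [hk]; field_simp
  rw [hend, ← hq, mul_zero, add_zero] at hE
  have hfst : inner ℝ z.fst x.fst ≤ -κ * ‖v‖ ^ 2 + (f₁ * ‖q‖ + f₂ * ‖x.snd‖) * ‖v‖ := by
    rw [h3, ← toDual_apply, h4]
    simp only [add_apply, A_apply]
    have e1 : N.F₁ q v ≤ f₁ * ‖q‖ * ‖v‖ := (le_abs_self _).trans (N.F₁.le_opNorm₂ q v)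
    have e2 : N.F₂ x.snd v ≤ f₂ * ‖x.snd‖ * ‖v‖ :=
      (le_abs_self _).trans (N.F₂.le_opNorm₂ x.snd v)
    linarith [hcoer v]
  have hc : ‖c‖ ≤ ‖v‖ + d₁ * ‖q‖ + d₂ * ‖x.snd‖ := by
    have : c = v + N.D₁ q + N.D₂ x.snd := by rw [h2]; abel
    rw [this]
    refine norm_add₃_le.trans ?_
    gcongr
    · exact N.D₁.le_opNorm q
    · exact N.D₂.le_opNorm _
  have hc2 : ‖c‖ ^ 2 ≤ 3 * (‖v‖ ^ 2 + d₁ ^ 2 * ‖q‖ ^ 2 + d₂ ^ 2 * ‖x.snd‖ ^ 2) := by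
    have : ‖c‖ ^ 2 ≤ (‖v‖ + d₁ * ‖q‖ + d₂ * ‖x.snd‖) ^ 2 := by gcongr
    nlinarith [sq_nonneg (‖v‖ - d₁ * ‖q‖), sq_nonneg (‖v‖ - d₂ * ‖x.snd‖),
      sq_nonneg (d₁ * ‖q‖ - d₂ * ‖x.snd‖)]
  have hy : ∀ s t : ℝ, s * t ≤ κ / 4 * t ^ 2 + s ^ 2 / κ := by
    intro s t
    have : 0 ≤ (κ / 2 * t - s) ^ 2 / κ := by positivity
    have e : (κ / 2 * t - s) ^ 2 / κ = κ / 4 * t ^ 2 + s ^ 2 / κ - s * t := by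
      field_simp; ring
    linarith
  have hy1 := hy (f₁ * ‖q‖) ‖v‖
  have hy2 := hy (f₂ * ‖x.snd‖) ‖v‖
  have hco := N.weightedForm_coercive (m := m) hk0 x
  have hkey : N.weightedForm m k z x ≤ ω₀ * ‖x.snd‖ ^ 2 := by
    rw [hform]
    have e1 : m * ‖c‖ ^ 2 ≤ κ / 2 * (‖v‖ ^ 2 + d₁ ^ 2 * ‖q‖ ^ 2 + d₂ ^ 2 * ‖x.snd‖ ^ 2) := by
      have := mul_le_mul_of_nonneg_left hc2 hm0.le
      refine this.trans_eq ?_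
      rw [hm]; ring
    have e2 : (M / 2) * ‖q‖ ^ 2 = (f₁ * ‖q‖) ^ 2 / κ + κ / 4 * d₁ ^ 2 * ‖q‖ ^ 2 := by
      rw [hM]; ring
    have e3 : ω₀ * ‖x.snd‖ ^ 2 = (f₂ * ‖x.snd‖) ^ 2 / κ + κ / 4 * d₂ ^ 2 * ‖x.snd‖ ^ 2
        + -k / 2 * ‖x.snd‖ ^ 2 := by
      rw [hω₀, hk]; ring
    have e4 : 0 ≤ m * ‖q‖ ^ 2 := by positivity
    have e5 : 0 ≤ κ * ‖v‖ ^ 2 := by positivity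
    clear_value m k M ω₀ d₁ d₂ f₁ f₂
    linarith
  refine hkey.trans ?_
  rw [div_mul_eq_mul_div, le_div_iff₀ hm0]
  have : m * ‖x.snd‖ ^ 2 ≤ N.weightedForm m k x x := by linarith [sq_nonneg ‖x.fst‖]
  calc ω₀ * ‖x.snd‖ ^ 2 * m = ω₀ * (m * ‖x.snd‖ ^ 2) := by ring
    _ ≤ _ := by gcongr

/-! ### The range condition -/

theorem memLp_exp (r l : ℝ) :
    MemLp (fun θ : ℝ => Real.exp (l * θ)) 2 ((volume : Measure ℝ).restrict (Icc (-r) 0)) :=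
  memLp_segment_of_continuousOn (by fun_prop)

/-- The map `c ↦ e^{l ·} c` from `V` to `L²_r`. -/
def expSegment (r l : ℝ) : V →L[ℝ] SegmentSpace V r :=
  (lpTensor (volume.restrict (Icc (-r) 0))).flip (memLp_exp r l).toLp

theorem coeFn_expSegment (r l : ℝ) (c : V) :
    expSegment r l c =ᵐ[volume.restrict (Icc (-r) 0)] fun θ => Real.exp (l * θ) • c := by
  filter_upwards [coeFn_lpTensor c (memLp_exp r l).toLp, (memLp_exp r l).coeFn_toLp] with θ h1 h2
  rw [expSegment, ContinuousLinearMap.flip_apply, h1, h2]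

/-- `∫_{-r}^0 e^{2lθ} dθ → 0` as `l → ∞`. -/
theorem tendsto_norm_toLp_exp (r : ℝ) :
    Tendsto (fun l => ‖(memLp_exp r l).toLp‖) atTop (𝓝 0) := by
  have h1 : ∀ l, ‖(memLp_exp r l).toLp‖ = √(∫ θ in Icc (-r) 0, Real.exp (l * θ) ^ 2) := by
    intro l
    rw [← Real.sqrt_sq (norm_nonneg (memLp_exp r l).toLp), norm_sq_segment]
    congr 1
    refine integral_congr_ae ?_
    filter_upwards [(memLp_exp r l).coeFn_toLp] with θ hθ
    rw [hθ, Real.norm_eq_abs, sq_abs]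
  have h2 : Tendsto (fun l : ℝ => ∫ θ in Icc (-r) 0, Real.exp (l * θ) ^ 2) atTop
      (𝓝 (∫ _ in Icc (-r) 0, (0 : ℝ))) := by
    refine tendsto_integral_filter_of_dominated_convergence (fun _ => 1) ?_ ?_ ?_ ?_
    · exact Eventually.of_forall fun l =>
        (by fun_prop : Continuous fun θ : ℝ => Real.exp (l * θ) ^ 2).aestronglyMeasurable
    · filter_upwards [eventually_ge_atTop 0] with l hl
      refine (ae_restrict_iff' measurableSet_Icc).2 (Eventually.of_forall fun θ hθ => ?_)
      rw [Real.norm_of_nonneg (by positivity)]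
      refine pow_le_one₀ (Real.exp_pos _).le (Real.exp_le_one_iff.2 ?_)
      exact mul_nonpos_of_nonneg_of_nonpos hl hθ.2
    · exact integrable_const _
    · refine (ae_restrict_iff' measurableSet_Icc).2 ?_
      filter_upwards [Measure.ae_ne volume (0 : ℝ)] with θ hne hθ
      have h2 : Tendsto (fun l : ℝ => l * θ) atTop atBot :=
        tendsto_id.atTop_mul_const_of_neg (lt_of_le_of_ne hθ.2 hne)
      simpa using (Real.tendsto_exp_atBot.comp h2).pow 2
  rw [integral_zero] at h2
  have h3 := h2.sqrt
  rw [Real.sqrt_zero] at h3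
  exact h3.congr fun l => (h1 l).symm

theorem norm_expSegment_apply_le (r l : ℝ) (c : V) :
    ‖expSegment r l c‖ ≤ ‖(memLp_exp r l).toLp‖ * ‖c‖ := by
  rw [mul_comm]
  exact norm_lpTensor_le c _

/-- A delay operator is small on the exponentials `e^{l ·} c` for large `l`. -/
theorem tendsto_norm_delay_symbol {W : Type*} [NormedAddCommGroup W] [NormedSpace ℝ W] {r : ℝ}
    (hr : 0 < r) (G₁ : V →L[ℝ] W) (G₂ : SegmentSpace V r →L[ℝ] W) :
    Tendsto (fun l => ‖Real.exp (l * -r) • G₁ + G₂ ∘L expSegment r l‖) atTop (𝓝 0) := by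
  have h1 : Tendsto (fun l : ℝ => Real.exp (l * -r)) atTop (𝓝 0) :=
    Real.tendsto_exp_atBot.comp (tendsto_id.atTop_mul_const_of_neg (by linarith))
  have h2 : Tendsto (fun l => Real.exp (l * -r) * ‖G₁‖ + ‖G₂‖ * ‖(memLp_exp r l).toLp‖) atTop
      (𝓝 0) := by
    simpa using (h1.mul_const ‖G₁‖).add ((tendsto_norm_toLp_exp r).const_mul ‖G₂‖)
  refine squeeze_zero (fun l => ContinuousLinearMap.opNorm_nonneg _) (fun l => ?_) h2
  refine ContinuousLinearMap.opNorm_le_bound _ (by positivity) fun c => ?_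
  calc ‖Real.exp (l * -r) • G₁ c + G₂ (expSegment r l c)‖
      ≤ Real.exp (l * -r) * (‖G₁‖ * ‖c‖) + ‖G₂‖ * (‖(memLp_exp r l).toLp‖ * ‖c‖) := by
        refine (norm_add_le _ _).trans (add_le_add ?_ ?_)
        · rw [norm_smul, Real.norm_of_nonneg (Real.exp_pos _).le]
          gcongr
          exact G₁.le_opNorm c
        · refine (G₂.le_opNorm _).trans ?_
          gcongr
          exact norm_expSegment_apply_le r l c
    _ = _ := by ring

/-- Neumann series, with an explicit bound. -/
theorem exists_inverse_one_sub [CompleteSpace V] {D : V →L[ℝ] V} (hD : ‖D‖ ≤ 1 / 2) :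
    ∃ G : V →L[ℝ] V, (∀ v, G v - D (G v) = v) ∧ ‖G‖ ≤ 2 := by
  have hlt : ‖D‖ < 1 := by linarith
  let u := Units.oneSub D hlt
  have hu : (1 - D) * (↑u⁻¹ : V →L[ℝ] V) = 1 := by
    exact u.mul_inv
  have hG : ∀ v, (↑u⁻¹ : V →L[ℝ] V) v - D ((↑u⁻¹ : V →L[ℝ] V) v) = v := by
    intro v
    have := congrArg (fun L : V →L[ℝ] V => L v) hu
    simpa [sub_mul] using this
  refine ⟨↑u⁻¹, hG, ContinuousLinearMap.opNorm_le_bound _ (by norm_num) fun v => ?_⟩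
  set g := (↑u⁻¹ : V →L[ℝ] V) v with hg
  have h1 : g = v + D g := by rw [← hG v]; abel
  have h2 : ‖g‖ ≤ ‖v‖ + ‖D g‖ := by
    calc ‖g‖ = ‖v + D g‖ := by rw [← h1]
      _ ≤ _ := norm_add_le _ _
  have h3 : ‖D g‖ ≤ 1 / 2 * ‖g‖ := D.le_of_opNorm_le hD g
  linarith

/-- The range condition. The solution of `l φ - 𝒜 φ = e` is sought as `φ₁ = e^{l ·} c + p`, with `p`
the solution of `p' = l p - e₁`, `p(0) = 0`; for large `l` the unknowns `c = φ₁(0)` and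
`v = φ₁(0) - D φ₁` determine each other, and the equation for `v` is solved by Lax-Milgram. -/
theorem exists_range_bound [CompleteSpace V] [CompleteSpace H] :
    ∃ Λ : ℝ, ∀ l, Λ < l → ∀ e : StateSpace H V N.r, ∃ x, (x, l • x - e) ∈ N.graphGenerator := by
  obtain ⟨κ, hκ, hcoer⟩ := N.coercive
  have hr := N.r_pos
  have hsmallD := (tendsto_norm_delay_symbol hr N.D₁ N.D₂).eventually_le_const
    (show (0 : ℝ) < 1 / 2 by norm_num)
  have hsmallF := (tendsto_norm_delay_symbol hr N.F₁ N.F₂).eventually_le_const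
    (show (0 : ℝ) < κ / 4 by positivity)
  obtain ⟨Λ, hΛ⟩ := eventually_atTop.1 ((hsmallD.and hsmallF).and (eventually_ge_atTop 0))
  refine ⟨Λ, fun l hl e => ?_⟩
  obtain ⟨⟨hDl, hFl⟩, hl0⟩ := hΛ l hl.le
  set Dl := Real.exp (l * -N.r) • N.D₁ + N.D₂ ∘L expSegment N.r l
  set Fl := Real.exp (l * -N.r) • N.F₁ + N.F₂ ∘L expSegment N.r l
  obtain ⟨G, hG, hGn⟩ := exists_inverse_one_sub hDl
  -- the particular solution
  have hei := segment_intervalIntegrable hr.le e.snd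
  obtain ⟨p, hpdef⟩ : ∃ p : ℝ → V, p = fun θ => Real.exp (l * θ) •
    ((0 : V) + ∫ s in θ..0, Real.exp (-(l * s)) • e.snd s) := ⟨_, rfl⟩
  have hp := variation_of_constants hei l 0 hpdef
  have huIcc : uIcc (-N.r) 0 = Icc (-N.r) 0 := uIcc_of_le (by linarith)
  rw [huIcc] at hp
  have hpL : MemLp p 2 (volume.restrict (Icc (-N.r) 0)) :=
    memLp_segment_of_continuousOn hp.1
  set d := N.D₁ (p (-N.r)) + N.D₂ hpL.toLp with hd
  -- Lax-Milgram
  let Q : V →L[ℝ] V →L[ℝ] ℝ := l • (N.toDualL ∘L N.j) - N.A - Fl ∘L G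
  have hQa : ∀ v w, Q v w = l * inner ℝ (N.j v) (N.j w) - N.a w v - Fl (G v) w := by
    intro v w; simp [Q, A_apply, toDual_apply]
  have hQ : IsCoercive Q := by
    refine ⟨κ / 2, by positivity, fun v => ?_⟩
    rw [hQa, real_inner_self_eq_norm_sq]
    have h1 : Fl (G v) v ≤ κ / 4 * (2 * ‖v‖) * ‖v‖ := by
      refine (le_abs_self _).trans ((Fl.le_opNorm₂ (G v) v).trans ?_)
      gcongr
      exact G.le_of_opNorm_le hGn v
    have h2 := hcoer v
    have h3 : 0 ≤ l * ‖N.j v‖ ^ 2 := by positivity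
    nlinarith
  let ℓ : StrongDual ℝ V := N.toDual e.fst + (N.F₁ (p (-N.r)) + N.F₂ hpL.toLp) + Fl (G d)
  obtain ⟨v, hv⟩ := hQ.continuousLinearEquivOfBilin.surjective ((InnerProductSpace.toDual ℝ V).symm ℓ)
  have hQv : ∀ w, Q v w = ℓ w := by
    intro w
    rw [← hQ.continuousLinearEquivOfBilin_apply, hv, InnerProductSpace.toDual_symm_apply]
  -- `c - D_l c - d = v`, so `v` is indeed `φ₁(0) - D φ₁`.
  set c := G (v + d) with hc
  have hcv : v = c - Dl c - d := by rw [hc, hG]; abel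
  let x : StateSpace H V N.r := WithLp.toLp 2 (N.j v, expSegment N.r l c + hpL.toLp)
  have hx1 : x.fst = N.j v := rfl
  have hx2 : x.snd = expSegment N.r l c + hpL.toLp := rfl
  -- the representative of the second component
  obtain ⟨f, hfdef⟩ : ∃ f : ℝ → V, f = fun θ => Real.exp (l * θ) •
    (c + ∫ s in θ..0, Real.exp (-(l * s)) • e.snd s) := ⟨_, rfl⟩
  have hf := variation_of_constants hei l c hfdef
  rw [huIcc] at hf
  have hfp : ∀ θ, f θ = Real.exp (l * θ) • c + p θ := fun θ => by
    rw [hfdef, hpdef]; simp only [smul_add, zero_add]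
  have hxf : x.snd =ᵐ[volume.restrict (Icc (-N.r) 0)] f := by
    rw [hx2]
    filter_upwards [Lp.coeFn_add (expSegment N.r l c) hpL.toLp, coeFn_expSegment N.r l c,
      hpL.coeFn_toLp] with θ h1 h2 h3
    rw [h1, Pi.add_apply, h2, h3, hfp]
  have hzf : (l • x - e).snd =ᵐ[volume.restrict (Icc (-N.r) 0)] fun θ => l • f θ - e.snd θ := by
    rw [WithLp.sub_snd, WithLp.smul_snd]
    filter_upwards [Lp.coeFn_sub (l • x.snd) e.snd, Lp.coeFn_smul l x.snd, hxf] with θ h1 h2 h3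
    rw [h1, Pi.sub_apply, h2, Pi.smul_apply, h3]
  have hprim : ∀ θ ∈ Icc (-N.r) 0, primitive c (l • x - e).snd θ = f θ := fun θ hθ => by
    rw [primitive_congr c hzf hθ, hf.2 θ hθ]
  have hrmem : -N.r ∈ Icc (-N.r) 0 := ⟨le_rfl, by linarith⟩
  have hfr : f (-N.r) = Real.exp (l * -N.r) • c + p (-N.r) := hfp _
  have hdelay : ∀ {W : Type _} [NormedAddCommGroup W] [NormedSpace ℝ W] (G₁ : V →L[ℝ] W)
      (G₂ : SegmentSpace V N.r →L[ℝ] W), G₁ (f (-N.r)) + G₂ x.snd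
        = (Real.exp (l * -N.r) • G₁ + G₂ ∘L expSegment N.r l) c
          + (G₁ (p (-N.r)) + G₂ hpL.toLp) := by
    intro W _ _ G₁ G₂
    rw [hfr, hx2]
    simp only [map_add, map_smul, add_apply, smul_apply, ContinuousLinearMap.comp_apply]
    abel
  refine ⟨x, (N.mem_graphGenerator_iff _).2 ⟨c, v, ?_, ?_, hx1, ?_⟩⟩
  · filter_upwards [hxf, ae_restrict_mem measurableSet_Icc] with θ h1 hθ
    rw [h1, hprim θ hθ]
  · rw [hprim _ hrmem, hdelay N.D₁ N.D₂, hcv]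
    simp only [hd]
    rw [sub_sub]
  · rw [hprim _ hrmem, hdelay N.F₁ N.F₂, WithLp.sub_fst, WithLp.smul_fst, N.toDual_sub,
      N.toDual_smul]
    ext w
    have h1 := hQv w
    rw [hQa] at h1
    have h2 : Fl c w = Fl (G v) w + Fl (G d) w := by rw [hc, map_add, map_add]; rfl
    simp only [ℓ, add_apply] at h1
    simp only [sub_apply, add_apply, smul_apply, toDual_apply, A_apply, hx1, smul_eq_mul]
    change _ = N.a w v + (Fl c w + _)
    rw [h2]
    rw [toDual_apply] at h1
    linarith

/-- The operator `𝒜` is maximal quasi-dissipative for a weighted inner product. -/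
theorem exists_isMaximalQuasiDissipative [CompleteSpace V] [CompleteSpace H] :
    ∃ B c ω Λ, IsMaximalQuasiDissipative N.generatorSubmodule B c ω Λ := by
  obtain ⟨m, k, ω, hm, hk, hω, hdiss⟩ := N.exists_quasiDissipative_weight
  obtain ⟨Λ, hΛ⟩ := N.exists_range_bound
  refine ⟨N.weightedForm m k, min 1 m, ω, Λ, ?_, by positivity, ?_, hω, hdiss,
    N.generator_single_valued, hΛ⟩
  · intro x y
    simp only [weightedForm_apply, real_inner_comm]
  · intro x
    refine le_trans ?_ (N.weightedForm_coercive hk x)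
    rw [WithLp.prod_norm_sq_eq_of_L2]
    have h1 := min_le_left 1 m
    have h2 := min_le_right 1 m
    nlinarith [sq_nonneg ‖x.fst‖, sq_nonneg ‖x.snd‖]

end NeutralSystem

/-! ### Segments of square integrable functions -/

section Shift

variable {V : Type*} [NormedAddCommGroup V] {x : ℝ → V}

theorem coeFn_historySegment (hx : MemLp x 2 volume) (r t : ℝ) :
    historySegment V r x t =ᵐ[volume.restrict (Icc (-r) 0)] fun θ => x (t + θ) := by
  have h : MemLp (fun θ => x (t + θ)) 2 ((volume : Measure ℝ).restrict (Icc (-r) 0)) :=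
    (hx.comp_measurePreserving (measurePreserving_add_left volume t)).restrict _
  rw [historySegment, dif_pos h]
  exact h.coeFn_toLp

theorem integrableOn_shift (hx : MemLp x 2 volume) (a t : ℝ) :
    IntegrableOn (fun s => x (s + a)) (Ioc 0 t) :=
  ((hx.comp_measurePreserving (measurePreserving_add_right volume a)).restrict _).integrable
    (by norm_num)

end Shift

section History

variable {X : Type*} [MeasurableSpace X] {μ : Measure X} [SFinite μ]
  {V : Type*} [NormedAddCommGroup V]

/-- The map `(x, s) ↦ (x, τ(x) + s)`, which turns joint measurability of a function into joint
measurability of its segments. -/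
theorem measurePreserving_shear {τ : X → ℝ} (hτ : Measurable τ) :
    MeasurePreserving (fun p : X × ℝ => (p.1, τ p.1 + p.2)) (μ.prod volume) (μ.prod volume) := by
  refine (MeasurePreserving.id μ).skew_product (g := fun x s => τ x + s) ?_ ?_
  · exact (hτ.comp measurable_fst).add measurable_snd
  · exact Eventually.of_forall fun x => (measurePreserving_add_left volume (τ x)).map_eq

theorem memLp_history {u : X → ℝ → V} (hu : MemLp (Function.uncurry u) 2 (μ.prod volume))
    {τ : X → ℝ} (hτ : Measurable τ) (r : ℝ) :
    MemLp (Function.uncurry fun x θ => u x (τ x + θ)) 2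
      (μ.prod (volume.restrict (Icc (-r) 0))) := by
  have h1 := hu.comp_measurePreserving (measurePreserving_shear (μ := μ) hτ)
  exact h1.mono_measure (Measure.prod_mono le_rfl Measure.restrict_le_self)

theorem ae_memLp_section {Θ : Type*} [MeasurableSpace Θ] {ν : Measure Θ} [SFinite ν]
    {f : X → Θ → V} (hf : MemLp (Function.uncurry f) 2 (μ.prod ν)) :
    ∀ᵐ x ∂μ, MemLp (f x) 2 ν := by
  have h1 := (memLp_two_iff_integrable_sq_norm hf.1).1 hf
  filter_upwards [h1.prod_right_ae, hf.1.prodMk_left] with x hx hx'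
  exact (memLp_two_iff_integrable_sq_norm hx').2 hx

theorem ae_historySegment_eq {u : X → ℝ → V}
    (hu : MemLp (Function.uncurry u) 2 (μ.prod volume)) {τ : X → ℝ} (hτ : Measurable τ) (r : ℝ) :
    ∀ᵐ x ∂μ, historySegment V r (u x) (τ x)
      =ᵐ[volume.restrict (Icc (-r) 0)] fun θ => u x (τ x + θ) := by
  filter_upwards [ae_memLp_section (memLp_history hu hτ r)] with x hx
  rw [historySegment, dif_pos hx]
  exact hx.coeFn_toLp

/-- The absolutely continuous representative of `∫₀ᵗ x_s ds` has derivative `x_t - x_0`. -/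
theorem NeutralSystem.primitive_history [InnerProductSpace ℝ V] [CompleteSpace V] {x : ℝ → V}
    (hx : MemLp x 2 volume) {r t θ : ℝ} (hθ : θ ∈ Icc (-r) 0) {g : SegmentSpace V r}
    (hg : g = historySegment V r x t - historySegment V r x 0) :
    NeutralSystem.primitive (∫ s in (0 : ℝ)..t, x s) g θ = ∫ s in (0 : ℝ)..t, x (s + θ) := by
  have hii : ∀ a b, IntervalIntegrable x volume a b := fun a b =>
    ((hx.locallyIntegrable (by norm_num)).integrableOn_isCompact isCompact_uIcc).intervalIntegrable
  have h1 : g =ᵐ[volume.restrict (Icc (-r) 0)] fun θ => x (t + θ) - x θ := by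
    rw [hg]
    filter_upwards [Lp.coeFn_sub (historySegment V r x t) (historySegment V r x 0),
      coeFn_historySegment hx r t, coeFn_historySegment hx r 0] with θ h1 h2 h3
    rw [h1, Pi.sub_apply, h2, h3, zero_add]
  have h2 : IntervalIntegrable (fun s => x (t + s)) volume θ 0 := by
    have := (hx.comp_measurePreserving (measurePreserving_add_left volume t))
    exact ((this.locallyIntegrable (by norm_num)).integrableOn_isCompact
      isCompact_uIcc).intervalIntegrable
  rw [NeutralSystem.primitive_congr _ h1 hθ, intervalIntegral.integral_sub h2 (hii _ _),
    intervalIntegral.integral_comp_add_left, intervalIntegral.integral_comp_add_right, add_zero,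
    zero_add]
  rw [← intervalIntegral.integral_add_adjacent_intervals (hii 0 (t + θ)) (hii (t + θ) t),
    ← intervalIntegral.integral_add_adjacent_intervals (hii θ 0) (hii 0 (t + θ))]
  abel

variable [InnerProductSpace ℝ V] [CompleteSpace V] [TopologicalSpace.SeparableSpace V]

theorem memLp_historySegment {u : X → ℝ → V}
    (hu : MemLp (Function.uncurry u) 2 (μ.prod volume)) {τ : X → ℝ} (hτ : Measurable τ) (r : ℝ) :
    MemLp (fun x => historySegment V r (u x) (τ x)) 2 μ :=
  memLp_of_section (memLp_history hu hτ r) (ae_historySegment_eq hu hτ r)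

/-- Integrals of segments are computed pointwise. -/
theorem integral_historySegment [IsFiniteMeasure μ] {u : X → ℝ → V}
    (hu : MemLp (Function.uncurry u) 2 (μ.prod volume)) {τ : X → ℝ} (hτ : Measurable τ) (r : ℝ) :
    (∫ x, historySegment V r (u x) (τ x) ∂μ : SegmentSpace V r)
      =ᵐ[volume.restrict (Icc (-r) 0)] fun θ => ∫ x, u x (τ x + θ) ∂μ := by
  refine integral_section_ae_eq (μ := μ) ((memLp_history hu hτ r).integrable (by norm_num))
    ((memLp_historySegment hu hτ r).integrable (by norm_num)) (ae_historySegment_eq hu hτ r)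

theorem integrableOn_historySegment {x : ℝ → V} (hx : MemLp x 2 volume) (r t : ℝ) :
    IntegrableOn (historySegment V r x) (Ioc 0 t) :=
  (memLp_historySegment (μ := volume.restrict (Ioc 0 t)) (u := fun _ => x) (hx.comp_snd _)
    measurable_id r).integrable (by norm_num)

theorem integral_historySegment_interval {x : ℝ → V} (hx : MemLp x 2 volume) (r : ℝ) {t : ℝ}
    (ht : 0 ≤ t) : (∫ s in (0 : ℝ)..t, historySegment V r x s : SegmentSpace V r)
      =ᵐ[volume.restrict (Icc (-r) 0)] fun θ => ∫ s in (0 : ℝ)..t, x (s + θ) := by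
  simp only [intervalIntegral.integral_of_le ht]
  exact integral_historySegment (μ := volume.restrict (Ioc 0 t)) (u := fun _ => x) (hx.comp_snd _)
    measurable_id r

end History

section Product

variable {X : Type*} [MeasurableSpace X] {μ : Measure X}
  {E F : Type*} [NormedAddCommGroup E] [NormedSpace ℝ E] [NormedAddCommGroup F] [NormedSpace ℝ F]

theorem integrable_toLp_prod {f : X → E} {g : X → F} (hf : Integrable f μ) (hg : Integrable g μ) :
    Integrable (fun x => WithLp.toLp 2 (f x, g x)) μ :=
  (WithLp.prodContinuousLinearEquiv 2 ℝ E F).symm.toContinuousLinearMap.integrable_comp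
    (hf.prodMk hg)

theorem integral_toLp_prod_fst [CompleteSpace E] [CompleteSpace F] {f : X → E} {g : X → F}
    (hf : Integrable f μ) (hg : Integrable g μ) :
    (∫ x, WithLp.toLp 2 (f x, g x) ∂μ).fst = ∫ x, f x ∂μ :=
  ((WithLp.fstL 2 ℝ E F).integral_comp_comm (integrable_toLp_prod hf hg)).symm

theorem integral_toLp_prod_snd [CompleteSpace E] [CompleteSpace F] {f : X → E} {g : X → F}
    (hf : Integrable f μ) (hg : Integrable g μ) :
    (∫ x, WithLp.toLp 2 (f x, g x) ∂μ).snd = ∫ x, g x ∂μ :=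
  ((WithLp.sndL 2 ℝ E F).integral_comp_comm (integrable_toLp_prod hf hg)).symm

end Product

/-! ### The deterministic neutral equation -/

namespace NeutralSystem

variable {U V H : Type*}
  [NormedAddCommGroup U] [InnerProductSpace ℝ U]
  [NormedAddCommGroup V] [InnerProductSpace ℝ V] [CompleteSpace V]
  [TopologicalSpace.SeparableSpace V]
  [NormedAddCommGroup H] [InnerProductSpace ℝ H]
  (N : NeutralSystem U V H)

theorem integrableOn_delayD {x : ℝ → V} (hx : MemLp x 2 volume) (t : ℝ) :
    IntegrableOn (N.delayD x) (Ioc 0 t) :=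
  (N.D₁.integrable_comp (integrableOn_shift hx (-N.r) t)).add
    (N.D₂.integrable_comp (integrableOn_historySegment hx N.r t))

theorem integrableOn_delayF {x : ℝ → V} (hx : MemLp x 2 volume) (t : ℝ) :
    IntegrableOn (N.delayF x) (Ioc 0 t) :=
  (N.F₁.integrable_comp (integrableOn_shift hx (-N.r) t)).add
    (N.F₂.integrable_comp (integrableOn_historySegment hx N.r t))

theorem integral_delayD {x : ℝ → V} (hx : MemLp x 2 volume) {t : ℝ} (ht : 0 ≤ t) :
    ∫ s in (0 : ℝ)..t, N.delayD x s = N.D₁ (∫ s in (0 : ℝ)..t, x (s + -N.r))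
      + N.D₂ (∫ s in (0 : ℝ)..t, historySegment V N.r x s) := by
  simp only [intervalIntegral.integral_of_le ht]
  have h1 := integrableOn_shift hx (-N.r) t
  have h2 := integrableOn_historySegment hx N.r t
  rw [← N.D₁.integral_comp_comm h1, ← N.D₂.integral_comp_comm h2,
    ← integral_add (N.D₁.integrable_comp h1) (N.D₂.integrable_comp h2)]
  rfl

theorem integral_delayF {x : ℝ → V} (hx : MemLp x 2 volume) {t : ℝ} (ht : 0 ≤ t) :
    ∫ s in (0 : ℝ)..t, N.delayF x s = N.F₁ (∫ s in (0 : ℝ)..t, x (s + -N.r))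
      + N.F₂ (∫ s in (0 : ℝ)..t, historySegment V N.r x s) := by
  simp only [intervalIntegral.integral_of_le ht]
  have h1 := integrableOn_shift hx (-N.r) t
  have h2 := integrableOn_historySegment hx N.r t
  rw [← N.F₁.integral_comp_comm h1, ← N.F₂.integral_comp_comm h2,
    ← integral_add (N.F₁.integrable_comp h1) (N.F₂.integrable_comp h2)]
  rfl

/-- A mild solution of the deterministic neutral equation with forcing `h`, viewed in the state
space, is the mild solution of the abstract Cauchy problem. -/
theorem state_eq_of_mild [CompleteSpace H] {SA : ℝ → StrongDual ℝ V →L[ℝ] StrongDual ℝ V}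
    (hSA : IsC0SemigroupGeneratedBy N.graphA SA)
    {S : ℝ → StateSpace H V N.r →L[ℝ] StateSpace H V N.r}
    (hS : IsC0SemigroupGeneratedBy N.graphGenerator S) {T : ℝ}
    {x : ℝ → V} (hx : MemLp x 2 volume) {y h : ℝ → H} (hh : IntegrableOn h (Ioc 0 T))
    {φ : StateSpace H V N.r} (h0 : historySegment V N.r x 0 = φ.snd)
    (hneutral : ∀ᵐ t ∂((volume : Measure ℝ).restrict (Icc 0 T)), y t = N.j (x t - N.delayD x t))
    (hmild : ∀ t ∈ Icc (0 : ℝ) T, N.toDual (y t) = SA t (N.toDual φ.fst)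
      + ∫ s in (0 : ℝ)..t, SA (t - s) (N.delayF x s + N.toDual (h s))) :
    ∀ t ∈ Icc (0 : ℝ) T, (WithLp.toLp 2 (y t, historySegment V N.r x t) : StateSpace H V N.r)
      = S t φ + ∫ s in (0 : ℝ)..t, S (t - s) (WithLp.toLp 2 (h s, 0)) := by
  have hh' : ∀ {t}, t ≤ T → IntegrableOn h (Ioc 0 t) := fun ht =>
    hh.mono_set (Ioc_subset_Ioc_right ht)
  have hx0 : ∀ t, IntegrableOn x (Ioc 0 t) := fun t => (hx.restrict _).integrable (by norm_num)
  have hxD : ∀ t, IntegrableOn (fun s => x s - N.delayD x s) (Ioc 0 t) := fun t =>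
    (hx0 t).sub (N.integrableOn_delayD hx t)
  have hne : ∀ {t}, t ≤ T → ∀ᵐ s ∂((volume : Measure ℝ).restrict (Ioc 0 t)),
      y s = N.j (x s - N.delayD x s) := fun {t} ht =>
    ae_restrict_of_ae_restrict_of_subset
      (Ioc_subset_Icc_self.trans (Icc_subset_Icc_right ht)) hneutral
  have hy : ∀ {t}, t ≤ T → IntegrableOn y (Ioc 0 t) := fun {t} ht =>
    (N.j.integrable_comp (hxD t)).congr ((hne ht).mono fun s hs => hs.symm)
  have hyI : ∀ {t}, 0 ≤ t → t ≤ T → ∫ s in (0 : ℝ)..t, y s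
      = N.j (∫ s in (0 : ℝ)..t, (x s - N.delayD x s)) := by
    intro t ht0 ht
    simp only [intervalIntegral.integral_of_le ht0]
    rw [← N.j.integral_comp_comm (hxD t)]
    exact integral_congr_ae (hne ht)
  set Z : ℝ → StateSpace H V N.r := fun t =>
    S t φ + ∫ s in (0 : ℝ)..t, S (t - s) (WithLp.toLp 2 (h s, 0)) with hZ
  set Y : ℝ → StateSpace H V N.r := fun t => WithLp.toLp 2 (y t, historySegment V N.r x t) with hY
  have hlift : ∀ {t}, t ≤ T → IntegrableOn
      (fun s => (WithLp.toLp 2 (h s, 0) : StateSpace H V N.r)) (Ioc 0 t) := fun ht =>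
    integrable_toLp_prod (hh' ht) (integrable_zero _ _ _)
  -- the integrated equation for the state
  have hYmem : ∀ t ∈ Icc (0 : ℝ) T, (∫ s in (0 : ℝ)..t, Y s,
      Y t - φ - ∫ s in (0 : ℝ)..t, (WithLp.toLp 2 (h s, 0) : StateSpace H V N.r))
        ∈ N.generatorSubmodule := by
    intro t ht
    have hFh : IntegrableOn (fun s => N.toDual (h s)) (Ioc 0 t) :=
      N.toDualL.integrable_comp (hh' ht.2)
    have hA := hSA.integral_mild_mem ht.1 ((N.integrableOn_delayF hx t).add hFh)
      (N.toDual φ.fst) (z := fun s => N.toDual (y s)) (fun s hs => hmild s ⟨hs.1, hs.2.trans ht.2⟩)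
    obtain ⟨v', hv'⟩ := hA
    obtain ⟨hv1, hv2⟩ := Prod.ext_iff.1 hv'
    simp only at hv1 hv2
    have hv : v' = ∫ s in (0 : ℝ)..t, (x s - N.delayD x s) := by
      refine N.j_injective (N.toDual_injective ?_)
      rw [← hv1, ← hyI ht.1 ht.2, intervalIntegral.integral_of_le ht.1,
        intervalIntegral.integral_of_le ht.1]
      exact N.toDualL.integral_comp_comm (hy ht.2)
    have hrmem : -N.r ∈ Icc (-N.r) 0 := ⟨le_rfl, by linarith [N.r_pos]⟩
    have hYfst : (∫ s in (0 : ℝ)..t, Y s).fst = ∫ s in (0 : ℝ)..t, y s := by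
      simp only [intervalIntegral.integral_of_le ht.1]
      exact integral_toLp_prod_fst (hy ht.2) (integrableOn_historySegment hx N.r t)
    have hYsnd : (∫ s in (0 : ℝ)..t, Y s).snd = ∫ s in (0 : ℝ)..t, historySegment V N.r x s := by
      simp only [intervalIntegral.integral_of_le ht.1]
      exact integral_toLp_prod_snd (hy ht.2) (integrableOn_historySegment hx N.r t)
    have hHfst : (∫ s in (0 : ℝ)..t, (WithLp.toLp 2 (h s, 0) : StateSpace H V N.r)).fst
        = ∫ s in (0 : ℝ)..t, h s := by
      simp only [intervalIntegral.integral_of_le ht.1]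
      exact integral_toLp_prod_fst (hh' ht.2) (integrable_zero _ _ _)
    have hHsnd : (∫ s in (0 : ℝ)..t, (WithLp.toLp 2 (h s, 0) : StateSpace H V N.r)).snd = 0 := by
      simp only [intervalIntegral.integral_of_le ht.1]
      rw [integral_toLp_prod_snd (hh' ht.2) (integrable_zero _ _ _)]
      simp
    have hsnd : (Y t - φ - ∫ s in (0 : ℝ)..t, (WithLp.toLp 2 (h s, 0) : StateSpace H V N.r)).snd
        = historySegment V N.r x t - historySegment V N.r x 0 := by
      rw [WithLp.sub_snd, WithLp.sub_snd, hHsnd, sub_zero, h0]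
      rfl
    have hprim : ∀ θ ∈ Icc (-N.r) 0, primitive (∫ s in (0 : ℝ)..t, x s)
        (Y t - φ - ∫ s in (0 : ℝ)..t, (WithLp.toLp 2 (h s, 0) : StateSpace H V N.r)).snd θ
          = ∫ s in (0 : ℝ)..t, x (s + θ) := fun θ hθ => primitive_history hx hθ hsnd
    have hsub : ∫ s in (0 : ℝ)..t, (x s - N.delayD x s)
        = (∫ s in (0 : ℝ)..t, x s) - ∫ s in (0 : ℝ)..t, N.delayD x s :=
      intervalIntegral.integral_sub
        ((intervalIntegrable_iff_integrableOn_Ioc_of_le ht.1).2 (hx0 t))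
        ((intervalIntegrable_iff_integrableOn_Ioc_of_le ht.1).2 (N.integrableOn_delayD hx t))
    refine (N.mem_graphGenerator_iff _).2 ⟨∫ s in (0 : ℝ)..t, x s, v', ?_, ?_, ?_, ?_⟩
    · dsimp only
      rw [hYsnd]
      filter_upwards [integral_historySegment_interval hx N.r ht.1,
        ae_restrict_mem measurableSet_Icc] with θ h1 hθ
      rw [h1, hprim θ hθ]
    · rw [hprim _ hrmem, hYsnd, ← N.integral_delayD hx ht.1, hv, hsub]
    · rw [hYfst, hyI ht.1 ht.2, hv]
    · rw [hprim _ hrmem, hYsnd, ← N.integral_delayF hx ht.1, ← hv2, WithLp.sub_fst, WithLp.sub_fst,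
        hHfst, N.toDual_sub, N.toDual_sub]
      have hadd := intervalIntegral.integral_add
          ((intervalIntegrable_iff_integrableOn_Ioc_of_le ht.1).2 (N.integrableOn_delayF hx t))
          ((intervalIntegrable_iff_integrableOn_Ioc_of_le ht.1).2 hFh)
      have h3 : ∫ s in (0 : ℝ)..t, N.toDual (h s) = N.toDual (∫ s in (0 : ℝ)..t, h s) := by
        simp only [intervalIntegral.integral_of_le ht.1]
        exact N.toDualL.integral_comp_comm (hh' ht.2)
      rw [h3] at hadd
      have hY1 : (Y t).fst = y t := rfl
      simp only [Pi.add_apply, hadd, hY1]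
      abel
  have hZmem : ∀ t ∈ Icc (0 : ℝ) T, (∫ s in (0 : ℝ)..t, Z s,
      Z t - φ - ∫ s in (0 : ℝ)..t, (WithLp.toLp 2 (h s, 0) : StateSpace H V N.r))
        ∈ N.generatorSubmodule := fun t ht =>
    hS.integral_mild_mem ht.1 (hlift ht.2) φ (z := Z) fun s _ => rfl
  obtain ⟨B, c, ω, Λ, hmax⟩ := N.exists_isMaximalQuasiDissipative
  have hYi : ∀ {t}, t ≤ T → IntegrableOn Y (Ioc 0 t) := fun ht =>
    integrable_toLp_prod (hy ht) (integrableOn_historySegment hx N.r _)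
  have hZi : ∀ {t}, t ≤ T → IntegrableOn Z (Ioc 0 t) := fun {t} ht => by
    refine Integrable.add ?_ (hS.integrableOn_convolution (hlift ht))
    exact ((hS.continuousOn_apply φ).mono Icc_subset_Ici_self).integrableOn_Icc.mono_set
      Ioc_subset_Icc_self
  -- Both `Y` and `Z` satisfy it, so it remains to apply uniqueness to their difference.
  have key := hmax.eq_zero_of_integral_mem (d := fun t => Y t - Z t) (T := T)
    ((hYi le_rfl).sub (hZi le_rfl)) (fun t ht => by
      have h1 := N.generatorSubmodule.sub_mem (hYmem t ht) (hZmem t ht)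
      rw [Prod.mk_sub_mk] at h1
      rw [intervalIntegral.integral_sub
        ((intervalIntegrable_iff_integrableOn_Ioc_of_le ht.1).2 (hYi ht.2))
        ((intervalIntegrable_iff_integrableOn_Ioc_of_le ht.1).2 (hZi ht.2))]
      convert h1 using 2
      abel)
  intro t ht
  exact sub_eq_zero.1 (key t ht)

end NeutralSystem

/-! ### Regular Volterra kernels and the operator `𝒦*` -/

section Kernel

/-- The fractional power `v ↦ v₊^(α - 1)`. -/
def posRpow (α v : ℝ) : ℝ := (Ioi (0 : ℝ)).indicator (fun v => v ^ (α - 1)) v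

theorem posRpow_nonneg (α v : ℝ) : 0 ≤ posRpow α v :=
  indicator_nonneg (fun _ hv => Real.rpow_nonneg (le_of_lt hv) _) v

theorem measurable_posRpow (α : ℝ) : Measurable (posRpow α) :=
  (measurable_id.pow_const _).indicator measurableSet_Ioi

theorem integrableOn_posRpow {α : ℝ} (hα : 0 < α) (a b : ℝ) :
    IntegrableOn (posRpow α) (Icc a b) := by
  have h1 : IntegrableOn (fun v : ℝ => v ^ (α - 1)) (Ioc 0 (max b 0)) :=
    (intervalIntegrable_iff_integrableOn_Ioc_of_le (le_max_right _ _)).1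
      (intervalIntegral.intervalIntegrable_rpow' (by linarith))
  have h2 : IntegrableOn (fun v : ℝ => v ^ (α - 1)) (Icc a b ∩ Ioi 0) :=
    h1.mono_set fun v hv => ⟨hv.2, hv.1.2.trans (le_max_left _ _)⟩
  change IntegrableOn ((Ioi (0 : ℝ)).indicator (fun v => v ^ (α - 1))) _
  rw [IntegrableOn, integrable_indicator_iff measurableSet_Ioi, IntegrableOn,
    Measure.restrict_restrict measurableSet_Ioi, inter_comm]
  exact h2

theorem integrableOn_posRpow_sub {α : ℝ} (hα : 0 < α) (a b ρ : ℝ) :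
    IntegrableOn (fun u => posRpow α (u - ρ)) (Icc a b) := by
  have h := (measurePreserving_sub_right volume ρ).integrableOn_comp_preimage
    (MeasurableEquiv.subRight ρ).measurableEmbedding (f := posRpow α) (s := Icc (a - ρ) (b - ρ))
  have h2 : (fun u : ℝ => u - ρ) ⁻¹' Icc (a - ρ) (b - ρ) = Icc a b := by
    ext u; simp
  rw [h2] at h
  exact h.2 (integrableOn_posRpow hα _ _)

/-- The function `ρ ↦ ∫_a^b (u - ρ)₊^(α - 1) du`, which dominates `𝒦* f` for bounded `f`
supported in `[a, b]`. -/
def kernelMajorant (α a b ρ : ℝ) : ℝ := ∫ u in Icc a b, posRpow α (u - ρ)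

theorem measurable_kernelMajorant (α a b : ℝ) : StronglyMeasurable (kernelMajorant α a b) := by
  have : StronglyMeasurable (Function.uncurry fun ρ u : ℝ => posRpow α (u - ρ)) :=
    ((measurable_posRpow α).comp (measurable_snd.sub measurable_fst)).stronglyMeasurable
  exact this.integral_prod_right

theorem kernelMajorant_nonneg (α a b ρ : ℝ) : 0 ≤ kernelMajorant α a b ρ :=
  integral_nonneg fun _ => posRpow_nonneg _ _

/-- Square integrability of `v ^ (α - 1)` at infinity; this is where `α < 1 / 2` is needed. -/
theorem memLp_two_rpow_tail {α : ℝ} (hα : α < 1 / 2) :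
    MemLp ((Ioi (1 : ℝ)).indicator fun v : ℝ => v ^ (α - 1)) 2 volume := by
  rw [memLp_indicator_iff_restrict measurableSet_Ioi, memLp_two_iff_integrable_sq
    (by fun_prop)]
  have h1 : IntegrableOn (fun v : ℝ => v ^ (2 * (α - 1))) (Ioi 1) :=
    integrableOn_Ioi_rpow_of_lt (by linarith) one_pos
  refine h1.congr_fun (fun v hv => ?_) measurableSet_Ioi
  have hv0 : (0 : ℝ) ≤ v := zero_le_one.trans (le_of_lt hv)
  change v ^ (2 * (α - 1)) = _
  rw [mul_comm, Real.rpow_mul hv0]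
  simp

/-- For `ρ < a - 1` the integrand is at most `(a - ρ) ^ (α - 1)`; for `ρ` closer to `[a, b]` the
whole integral is at most a constant, and for `ρ > b` it vanishes. -/
theorem kernelMajorant_le {α : ℝ} (hα : 0 < α) (hα' : α < 1 / 2) {a b : ℝ} (hab : a ≤ b) (ρ : ℝ) :
    kernelMajorant α a b ρ ≤
      (b - a) * (Ioi (1 : ℝ)).indicator (fun v : ℝ => v ^ (α - 1)) (a - ρ)
        + (Icc (a - 1) b).indicator (fun _ => ∫ v in Icc (a - b) (b - a + 1), posRpow α v) ρ := by
  have hc : 0 ≤ ∫ v in Icc (a - b) (b - a + 1), posRpow α v :=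
    integral_nonneg fun _ => posRpow_nonneg _ _
  rcases lt_or_ge ρ (a - 1) with h | h
  · have h1 : kernelMajorant α a b ρ ≤ ∫ u in Icc a b, (a - ρ) ^ (α - 1) := by
      refine setIntegral_mono_on (integrableOn_posRpow_sub hα a b ρ)
        (integrableOn_const (by simp)) measurableSet_Icc fun u hu => ?_
      have h2 : 0 < u - ρ := by linarith [hu.1]
      rw [posRpow, indicator_of_mem (mem_Ioi.2 h2)]
      exact Real.rpow_le_rpow_of_nonpos (by linarith) (by linarith [hu.1]) (by linarith)
    rw [setIntegral_const] at h1
    rw [indicator_of_mem (show a - ρ ∈ Ioi (1 : ℝ) by simp; linarith),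
      indicator_of_notMem (fun h' => by linarith [h'.1]), add_zero]
    refine h1.trans (le_of_eq ?_)
    simp [hab]
  · rw [indicator_of_notMem (show a - ρ ∉ Ioi (1 : ℝ) by simp; linarith), mul_zero, zero_add]
    rcases lt_or_ge b ρ with h' | h'
    · rw [indicator_of_notMem (fun h'' => by linarith [h''.2]), kernelMajorant]
      refine le_of_eq (setIntegral_eq_zero_of_forall_eq_zero fun u hu => ?_)
      exact indicator_of_notMem (by simp; linarith [hu.2]) _
    · rw [indicator_of_mem (mem_Icc.2 ⟨h, h'⟩), kernelMajorant]
      have h2 := (measurePreserving_sub_right volume ρ).setIntegral_preimage_emb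
        (MeasurableEquiv.subRight ρ).measurableEmbedding (posRpow α) (Icc (a - ρ) (b - ρ))
      have h3 : (fun u : ℝ => u - ρ) ⁻¹' Icc (a - ρ) (b - ρ) = Icc a b := by
        ext u; simp
      rw [h3] at h2
      rw [h2]
      refine setIntegral_mono_set (integrableOn_posRpow hα _ _)
        (Eventually.of_forall fun _ => posRpow_nonneg _ _) (LE.le.eventuallyLE ?_)
      exact Icc_subset_Icc (by linarith) (by linarith)

/-- The majorant of `𝒦* f` is square integrable, in spite of the singularity of the kernel. -/
theorem memLp_kernelMajorant {α : ℝ} (hα : 0 < α) (hα' : α < 1 / 2) {a b : ℝ} (hab : a ≤ b) :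
    MemLp (kernelMajorant α a b) 2 volume := by
  have h1 : MemLp (fun ρ : ℝ => (b - a) * (Ioi (1 : ℝ)).indicator (fun v : ℝ => v ^ (α - 1)) (a - ρ)
        + (Icc (a - 1) b).indicator (fun _ => ∫ v in Icc (a - b) (b - a + 1), posRpow α v) ρ)
        2 volume := by
    refine MemLp.add ?_ (memLp_indicator_const 2 measurableSet_Icc _ (Or.inr (by simp)))
    exact ((memLp_two_rpow_tail hα').comp_measurePreserving
      (Measure.measurePreserving_sub_left volume a)).const_mul (b - a)
  refine h1.mono (measurable_kernelMajorant α a b).aestronglyMeasurable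
    (Eventually.of_forall fun ρ => ?_)
  rw [Real.norm_of_nonneg (kernelMajorant_nonneg _ _ _ _)]
  exact (kernelMajorant_le hα hα' hab ρ).trans (Real.le_norm_self _)

/-- The derivative `∂K/∂u (u, ρ)`, extended by zero to `u ≤ ρ`. -/
def truncDeriv (K : ℝ → ℝ → ℝ) (u ρ : ℝ) : ℝ := (Ioi ρ).indicator (fun u => kernelDeriv K u ρ) u

variable {E : Type*} [NormedAddCommGroup E] [NormedSpace ℝ E]

theorem kernelAdjoint_eq (K : ℝ → ℝ → ℝ) (f : ℝ → E) (ρ : ℝ) :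
    kernelAdjoint K f ρ = ∫ u, truncDeriv K u ρ • f u := by
  rw [kernelAdjoint, ← integral_indicator measurableSet_Ioi]
  congr 1
  ext u
  by_cases h : u ∈ Ioi ρ <;> simp [truncDeriv, h]

namespace IsRegularVolterraKernel

variable {α : ℝ} {K : ℝ → ℝ → ℝ}

theorem hasDerivAt (hK : IsRegularVolterraKernel α K) {u ρ : ℝ} (h : ρ < u) :
    HasDerivAt (fun v => K v ρ) (kernelDeriv K u ρ) u :=
  (((hK.contDiffOn ρ).contDiffAt (Ioi_mem_nhds h)).differentiableAt one_ne_zero).hasDerivAt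

/-- The derivative is the limit of the difference quotients with increments `1 / (n + 1)`. -/
theorem measurable_truncDeriv (hK : IsRegularVolterraKernel α K) :
    Measurable (Function.uncurry (truncDeriv K)) := by
  have hs : MeasurableSet {p : ℝ × ℝ | p.2 < p.1} := measurableSet_lt measurable_snd measurable_fst
  refine measurable_of_tendsto_metrizable (f := fun (n : ℕ) (p : ℝ × ℝ) =>
    {p : ℝ × ℝ | p.2 < p.1}.indicator (fun p => ((1 / ((n : ℝ) + 1) : ℝ))⁻¹ *
      (K (p.1 + 1 / ((n : ℝ) + 1)) p.2 - K p.1 p.2)) p) (fun n => ?_) ?_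
  · refine Measurable.indicator ?_ hs
    refine Measurable.const_mul (Measurable.sub ?_ ?_) _
    · exact hK.measurable.comp ((measurable_fst.add_const _).prodMk measurable_snd)
    · exact hK.measurable.comp (measurable_fst.prodMk measurable_snd)
  · rw [tendsto_pi_nhds]
    rintro ⟨u, ρ⟩
    by_cases h : ρ < u
    · have h1 := (hK.hasDerivAt h).tendsto_slope_zero
      have h2 : Tendsto (fun n : ℕ => (1 / ((n : ℝ) + 1) : ℝ)) atTop (𝓝[≠] 0) := by
        rw [tendsto_nhdsWithin_iff]
        refine ⟨tendsto_one_div_add_atTop_nhds_zero_nat, Eventually.of_forall fun n => ?_⟩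
        have : (0 : ℝ) < 1 / ((n : ℝ) + 1) := by positivity
        exact this.ne'
      simpa [truncDeriv, h, Function.comp_def] using h1.comp h2
    · simp [truncDeriv, h]

theorem exists_truncDeriv_bound (hK : IsRegularVolterraKernel α K) :
    ∃ C : ℝ, 0 < C ∧ ∀ u ρ : ℝ, |truncDeriv K u ρ| ≤ C * posRpow α (u - ρ) := by
  obtain ⟨C, hC, h⟩ := hK.deriv_bound
  refine ⟨C, hC, fun u ρ => ?_⟩
  by_cases hu : ρ < u
  · simpa [truncDeriv, posRpow, hu] using h u ρ hu
  · simp [truncDeriv, posRpow, hu]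

/-- The bound for `∂K/∂u`, as chosen from the definition. -/
def const (hK : IsRegularVolterraKernel α K) : ℝ := hK.exists_truncDeriv_bound.choose

theorem const_pos (hK : IsRegularVolterraKernel α K) : 0 < hK.const :=
  hK.exists_truncDeriv_bound.choose_spec.1

theorem abs_truncDeriv_le (hK : IsRegularVolterraKernel α K) (u ρ : ℝ) :
    |truncDeriv K u ρ| ≤ hK.const * posRpow α (u - ρ) :=
  hK.exists_truncDeriv_bound.choose_spec.2 u ρ

theorem integrableOn_truncDeriv (hK : IsRegularVolterraKernel α K) (a b ρ : ℝ) :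
    IntegrableOn (fun u => truncDeriv K u ρ) (Icc a b) := by
  refine Integrable.mono' ((integrableOn_posRpow_sub hK.alpha_pos a b ρ).const_mul hK.const)
    ?_ (Eventually.of_forall fun u => hK.abs_truncDeriv_le u ρ)
  exact (hK.measurable_truncDeriv.comp (measurable_id.prodMk measurable_const)).aestronglyMeasurable

/-- The fundamental theorem of calculus for the kernel; the point `ρ`, where the value of
`K(·, ρ)` is not prescribed, is avoided. -/
theorem integral_truncDeriv (hK : IsRegularVolterraKernel α K) {a b ρ : ℝ} (hab : a ≤ b)
    (ha : ρ ≠ a) (hb : ρ ≠ b) : ∫ u in Ico a b, truncDeriv K u ρ = K b ρ - K a ρ := by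
  classical
  -- With the value `0` at `u = ρ` the kernel is continuous in `u`.
  set f : ℝ → ℝ := fun u => if u = ρ then 0 else K u ρ with hf
  have hfe : ∀ {u}, u ≠ ρ → f =ᶠ[𝓝 u] fun v => K v ρ := fun {u} hu => by
    filter_upwards [isOpen_ne.mem_nhds hu] with v hv
    exact if_neg hv
  have hd : ∀ u, u ≠ ρ → HasDerivAt f (truncDeriv K u ρ) u := by
    intro u hu
    rcases lt_or_gt_of_ne hu with h | h
    · have h1 : f =ᶠ[𝓝 u] fun _ => 0 := by
        filter_upwards [Iio_mem_nhds h] with v hv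
        simp [hf, hK.eq_zero v ρ hv]
      have h2 : truncDeriv K u ρ = 0 := by simp [truncDeriv, h.le]
      rw [h2]
      exact (hasDerivAt_const u (0 : ℝ)).congr_of_eventuallyEq h1
    · have h2 : truncDeriv K u ρ = kernelDeriv K u ρ := by simp [truncDeriv, h]
      rw [h2]
      exact (hK.hasDerivAt h).congr_of_eventuallyEq (hfe hu)
  have hc : Continuous f := by
    rw [continuous_iff_continuousAt]
    intro u
    by_cases hu : u = ρ
    · subst hu
      have h0 : f u = 0 := by simp [hf]
      rw [ContinuousAt, h0, tendsto_iff_norm_sub_tendsto_zero]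
      have h1 : 𝓝 u = 𝓝[≤] u ⊔ 𝓝[>] u := (nhdsLE_sup_nhdsGT u).symm
      rw [h1, tendsto_sup]
      constructor
      · refine tendsto_const_nhds.congr' ?_
        filter_upwards [self_mem_nhdsWithin] with v hv
        rcases eq_or_lt_of_le (show v ≤ u from hv) with h | h
        · simp [hf, h]
        · simp [hf, hK.eq_zero v u h]
      · have h2 := (hK.tendsto_diag u).norm
        rw [norm_zero] at h2
        refine h2.congr' ?_
        filter_upwards [self_mem_nhdsWithin] with v hv
        simp [hf, (show u < v from hv).ne']
    · exact (hd u hu).continuousAt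
  rw [integral_Ico_eq_integral_Ioc, ← intervalIntegral.integral_of_le hab,
    integral_eq_of_hasDerivAt_off_countable (s := {ρ}) f _ (countable_singleton ρ)
    hc.continuousOn (fun u hu => hd u hu.2) ?_]
  · simp [hf, ha.symm, hb.symm]
  · rw [intervalIntegrable_iff_integrableOn_Ioc_of_le hab]
    exact (hK.integrableOn_truncDeriv a b ρ).mono_set Ioc_subset_Icc_self

/-! ### The function `𝒦* f` for bounded `f` supported in `[a, b]` -/

section Bounded

variable {f : ℝ → E} {a b M : ℝ}

theorem norm_truncDeriv_smul_le (hK : IsRegularVolterraKernel α K)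
    (hM : ∀ u, ‖f u‖ ≤ M) (hs : ∀ u, u ∉ Icc a b → f u = 0) (u ρ : ℝ) :
    ‖truncDeriv K u ρ • f u‖ ≤
      (Icc a b).indicator (fun u => hK.const * M * posRpow α (u - ρ)) u := by
  by_cases hu : u ∈ Icc a b
  · rw [indicator_of_mem hu, norm_smul, Real.norm_eq_abs]
    have h0 : 0 ≤ M := (norm_nonneg _).trans (hM u)
    calc |truncDeriv K u ρ| * ‖f u‖ ≤ (hK.const * posRpow α (u - ρ)) * M :=
        mul_le_mul (hK.abs_truncDeriv_le u ρ) (hM u) (norm_nonneg _)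
          (mul_nonneg hK.const_pos.le (posRpow_nonneg _ _))
      _ = _ := by ring
  · rw [hs u hu, indicator_of_notMem hu]
    simp

theorem integrable_truncDeriv_smul (hK : IsRegularVolterraKernel α K)
    (hf : AEStronglyMeasurable f volume) (hM : ∀ u, ‖f u‖ ≤ M)
    (hs : ∀ u, u ∉ Icc a b → f u = 0) (ρ : ℝ) :
    Integrable (fun u => truncDeriv K u ρ • f u) := by
  refine Integrable.mono' (g := (Icc a b).indicator (fun u => hK.const * M * posRpow α (u - ρ)))
    ?_ ?_ (Eventually.of_forall fun u => hK.norm_truncDeriv_smul_le hM hs u ρ)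
  · rw [integrable_indicator_iff measurableSet_Icc]
    exact (integrableOn_posRpow_sub hK.alpha_pos a b ρ).const_mul _
  · exact (hK.measurable_truncDeriv.comp
      (measurable_id.prodMk measurable_const)).aestronglyMeasurable.smul hf

theorem integrableOn_kernelDeriv_smul (hK : IsRegularVolterraKernel α K)
    (hf : AEStronglyMeasurable f volume) (hM : ∀ u, ‖f u‖ ≤ M)
    (hs : ∀ u, u ∉ Icc a b → f u = 0) (ρ : ℝ) :
    IntegrableOn (fun u => kernelDeriv K u ρ • f u) (Ioi ρ) := by
  rw [← integrable_indicator_iff measurableSet_Ioi]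
  refine (hK.integrable_truncDeriv_smul hf hM hs ρ).congr (Eventually.of_forall fun u => ?_)
  by_cases h : u ∈ Ioi ρ <;> simp [truncDeriv, h]

theorem norm_kernelAdjoint_le (hK : IsRegularVolterraKernel α K)
    (hM : ∀ u, ‖f u‖ ≤ M) (hs : ∀ u, u ∉ Icc a b → f u = 0) (ρ : ℝ) :
    ‖kernelAdjoint K f ρ‖ ≤ hK.const * M * kernelMajorant α a b ρ := by
  rw [kernelAdjoint_eq, kernelMajorant, ← integral_const_mul, ← integral_indicator measurableSet_Icc]
  refine norm_integral_le_of_norm_le ?_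
    (Eventually.of_forall fun u => hK.norm_truncDeriv_smul_le hM hs u ρ)
  rw [integrable_indicator_iff measurableSet_Icc]
  exact (integrableOn_posRpow_sub hK.alpha_pos a b ρ).const_mul _

theorem aestronglyMeasurable_kernelAdjoint (hK : IsRegularVolterraKernel α K)
    (hf : AEStronglyMeasurable f volume) :
    AEStronglyMeasurable (kernelAdjoint K f) volume := by
  have h1 : AEStronglyMeasurable (fun p : ℝ × ℝ => truncDeriv K p.2 p.1 • f p.2)
      (volume.prod volume) :=
    (hK.measurable_truncDeriv.comp measurable_swap).aestronglyMeasurable.smul hf.comp_snd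
  refine h1.integral_prod_right'.congr (Eventually.of_forall fun ρ => ?_)
  exact (kernelAdjoint_eq K f ρ).symm

theorem memLp_kernelAdjoint (hK : IsRegularVolterraKernel α K)
    (hf : AEStronglyMeasurable f volume) (hM : ∀ u, ‖f u‖ ≤ M) (hab : a ≤ b)
    (hs : ∀ u, u ∉ Icc a b → f u = 0) : MemLp (kernelAdjoint K f) 2 volume :=
  MemLp.mono' ((memLp_kernelMajorant hK.alpha_pos hK.alpha_lt hab).const_mul (hK.const * M))
    (hK.aestronglyMeasurable_kernelAdjoint hf)
    (Eventually.of_forall fun ρ => hK.norm_kernelAdjoint_le hM hs ρ)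

/-- The `L²` norm of `𝒦* f` is controlled by the sup norm of `f`, for `f` supported in `[a, b]`. -/
theorem eLpNorm_kernelAdjoint_le (hK : IsRegularVolterraKernel α K)
    (hM : ∀ u, ‖f u‖ ≤ M) (hs : ∀ u, u ∉ Icc a b → f u = 0) :
    eLpNorm (kernelAdjoint K f) 2 volume ≤
      ENNReal.ofReal (hK.const * M) * eLpNorm (kernelMajorant α a b) 2 volume := by
  refine eLpNorm_le_mul_eLpNorm_of_ae_le_mul (Eventually.of_forall fun ρ => ?_) 2
  rw [Real.norm_of_nonneg (kernelMajorant_nonneg _ _ _ _)]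
  exact hK.norm_kernelAdjoint_le hM hs ρ

end Bounded

/-- Increments of the kernel are square integrable. -/
theorem memLp_increment (hK : IsRegularVolterraKernel α K) (s t : ℝ) :
    MemLp (fun ρ => K t ρ - K s ρ) 2 volume := by
  wlog hst : s ≤ t generalizing s t
  · refine (this t s (le_of_not_ge hst)).neg.congr_norm ?_ ?_
    · exact ((hK.measurable.comp (measurable_const.prodMk measurable_id)).sub
        (hK.measurable.comp (measurable_const.prodMk measurable_id))).aestronglyMeasurable
    · exact Eventually.of_forall fun ρ => by simp [norm_sub_rev]
  have h1 : MemLp (kernelAdjoint K ((Ico s t).indicator fun _ => (1 : ℝ))) 2 volume := by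
    refine hK.memLp_kernelAdjoint (a := s) (b := t) (M := 1)
      (aestronglyMeasurable_const.indicator measurableSet_Ico) (fun u => ?_) hst (fun u hu => ?_)
    · exact (norm_indicator_le_norm_self _ _).trans (by simp)
    · exact indicator_of_notMem (fun h => hu ⟨h.1, h.2.le⟩) _
  refine (memLp_congr_ae ?_).1 h1
  filter_upwards [compl_mem_ae_iff.2 (Real.volume_singleton (a := s)),
    compl_mem_ae_iff.2 (Real.volume_singleton (a := t))] with ρ hs ht
  rw [← hK.integral_truncDeriv hst hs ht, kernelAdjoint_eq, ← integral_indicator measurableSet_Ico]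
  congr 1
  ext u
  by_cases h : u ∈ Ico s t <;> simp [h]

/-- `𝒦*` of a step function. -/
theorem kernelAdjoint_step [CompleteSpace E] (hK : IsRegularVolterraKernel α K) (g : StepData E) :
    kernelAdjoint K g.toFun =ᵐ[volume] fun ρ =>
      ∑ k, (K (g.node k.succ) ρ - K (g.node k.castSucc) ρ) • g.val k := by
  have h : ∀ᵐ ρ : ℝ, ∀ i, ρ ≠ g.node i :=
    ae_all_iff.2 fun i => compl_mem_ae_iff.2 (Real.volume_singleton (a := g.node i))
  filter_upwards [h] with ρ hρ
  rw [kernelAdjoint_eq]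
  have h1 : ∀ u, truncDeriv K u ρ • g.toFun u = ∑ k, (Ico (g.node k.castSucc)
      (g.node k.succ)).indicator (fun u => truncDeriv K u ρ • g.val k) u := by
    intro u
    rw [StepData.toFun, Finset.smul_sum]
    refine Finset.sum_congr rfl fun k _ => ?_
    by_cases hu : u ∈ Ico (g.node k.castSucc) (g.node k.succ) <;> simp [hu]
  simp only [h1]
  have hI : ∀ k, IntegrableOn (fun u => truncDeriv K u ρ)
      (Ico (g.node (Fin.castSucc k)) (g.node k.succ)) := fun k =>
    (hK.integrableOn_truncDeriv _ _ ρ).mono_set Ico_subset_Icc_self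
  rw [integral_finsetSum]
  · refine Finset.sum_congr rfl fun k _ => ?_
    rw [integral_indicator measurableSet_Ico, integral_smul_const, hK.integral_truncDeriv
      (g.strictMono (Fin.castSucc_lt_succ)).le (hρ _) (hρ _)]
  · intro k _
    rw [integrable_indicator_iff measurableSet_Ico]
    exact (hI k).smul_const _

end IsRegularVolterraKernel

end Kernel

/-! ### Wiener integrals and their covariance with the noise -/

section Mean

variable {X : Type*} [MeasurableSpace X] {μ : Measure X}
  {E : Type*} [NormedAddCommGroup E] [NormedSpace ℝ E]

theorem coeFn_sum_lpTensor {ι : Type*} (s : Finset ι) (v : ι → E) (ξ : ι → Lp ℝ 2 μ) :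
    (∑ k ∈ s, lpTensor μ (v k) (ξ k) : Lp E 2 μ) =ᵐ[μ] fun x => ∑ k ∈ s, ξ k x • v k := by
  refine (Lp.coeFn_finsetSum _ _).trans ?_
  have h : ∀ᵐ x ∂μ, ∀ k ∈ s, lpTensor μ (v k) (ξ k) x = ξ k x • v k :=
    (s.eventually_all).2 fun k _ => coeFn_lpTensor (v k) (ξ k)
  filter_upwards [h] with x hx
  rw [Finset.sum_apply]
  exact Finset.sum_congr rfl hx

theorem inner_eq_integral_mul (ξ η : Lp ℝ 2 μ) : inner ℝ ξ η = ∫ x, ξ x * η x ∂μ := by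
  rw [L2.inner_def]
  refine integral_congr_ae (Eventually.of_forall fun x => ?_)
  simp [mul_comm]

variable [CompleteSpace E]

/-- The bilinear map `(ξ, Y) ↦ ∫ ξ Y` from `L²(μ) × L²(μ; E)` to `E`. -/
def lpMean (μ : Measure X) : Lp ℝ 2 μ →L[ℝ] Lp E 2 μ →L[ℝ] E :=
  (ContinuousLinearMap.lsmul ℝ ℝ : ℝ →L[ℝ] E →L[ℝ] E).lpPairing μ 2 2

theorem lpMean_apply (ξ : Lp ℝ 2 μ) (Y : Lp E 2 μ) :
    lpMean μ ξ Y = ∫ x, ξ x • Y x ∂μ := by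
  rw [lpMean, ContinuousLinearMap.lpPairing_eq_integral]
  rfl

theorem lpMean_lpTensor (ξ η : Lp ℝ 2 μ) (v : E) :
    lpMean μ ξ (lpTensor μ v η) = (inner ℝ ξ η : ℝ) • v := by
  rw [lpMean_apply, inner_eq_integral_mul, ← integral_smul_const]
  refine integral_congr_ae ?_
  filter_upwards [coeFn_lpTensor v η] with x hx
  rw [hx, smul_smul]

end Mean

section InnerMean

variable {X : Type*} [MeasurableSpace X] {μ : Measure X}
  {E : Type*} [NormedAddCommGroup E] [InnerProductSpace ℝ E] [CompleteSpace E]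

theorem inner_lpTensor_left (v : E) (ξ : Lp ℝ 2 μ) (Y : Lp E 2 μ) :
    inner ℝ (lpTensor μ v ξ) Y = (inner ℝ v (lpMean μ ξ Y) : ℝ) := by
  have hint : Integrable (fun x => ξ x • Y x) μ :=
    memLp_one_iff_integrable.1 ((Lp.memLp Y).smul (Lp.memLp ξ))
  rw [L2.inner_def, lpMean_apply, ← integral_inner hint]
  refine integral_congr_ae ?_
  filter_upwards [coeFn_lpTensor v ξ] with x hx
  rw [hx, real_inner_smul_left, real_inner_smul_right]

theorem inner_lpTensor_lpTensor (v w : E) (ξ η : Lp ℝ 2 μ) :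
    inner ℝ (lpTensor μ v ξ) (lpTensor μ w η) = (inner ℝ ξ η * inner ℝ v w : ℝ) := by
  rw [inner_lpTensor_left, lpMean_lpTensor, real_inner_smul_right]

/-- A vector-valued random variable is determined by its means against scalar ones. -/
theorem eq_zero_of_lpMean_eq_zero [IsFiniteMeasure μ] {Y : Lp E 2 μ}
    (h : ∀ ξ, lpMean μ ξ Y = 0) : Y = 0 := by
  rw [Lp.eq_zero_iff_ae_eq_zero]
  refine Lp.ae_eq_zero_of_forall_setIntegral_eq_zero Y (by norm_num) (by norm_num)
    (fun s _ _ => ((Lp.memLp Y).integrable (by norm_num)).integrableOn) fun s hs _ => ?_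
  have h1 := h (indicatorConstLp 2 hs (measure_ne_top μ s) (1 : ℝ))
  rw [lpMean_apply] at h1
  rw [← h1, ← integral_indicator hs]
  refine integral_congr_ae ?_
  filter_upwards [indicatorConstLp_coeFn (p := 2) (hs := hs) (hμs := measure_ne_top μ s)
    (c := (1 : ℝ))] with x hx
  rw [hx]
  by_cases hxs : x ∈ s <;> simp [hxs]

end InnerMean

section Step

variable {Ω : Type*} [MeasurableSpace Ω] {P : Measure Ω}
  {U : Type*} [NormedAddCommGroup U] [InnerProductSpace ℝ U]
  {E : Type*} [NormedAddCommGroup E] [NormedSpace ℝ E]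

/-- The elementary integral as an element of `L²(Ω; E)`. -/
def StepData.integralLp (g : StepData E) (b : ℝ → Lp ℝ 2 P) : Lp E 2 P :=
  ∑ k, lpTensor P (g.val k) (b (g.node k.succ) - b (g.node k.castSucc))

theorem StepData.coeFn_integralLp (g : StepData E) (b : ℝ → Lp ℝ 2 P) :
    g.integralLp b =ᵐ[P] g.integral b := by
  have h : ∀ᵐ ω ∂P, ∀ k : Fin g.n, (b (g.node k.succ) - b (g.node k.castSucc) : Lp ℝ 2 P) ω
      = b (g.node k.succ) ω - b (g.node k.castSucc) ω :=
    ae_all_iff.2 fun k => Lp.coeFn_sub _ _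
  filter_upwards [coeFn_sum_lpTensor Finset.univ g.val
    fun k => b (g.node k.succ) - b (g.node k.castSucc), h] with ω h1 h2
  rw [integralLp, h1, StepData.integral]
  exact Finset.sum_congr rfl fun k _ => by rw [h2 k]

theorem StepData.tendsto_integralLp_iff {g : ℕ → StepData E} {b : ℝ → Lp ℝ 2 P} {I : Lp E 2 P} :
    Tendsto (fun n => (g n).integralLp b) atTop (𝓝 I) ↔
      Tendsto (fun n => eLpNorm (fun ω => (g n).integral b ω - I ω) 2 P) atTop (𝓝 0) := by
  rw [Lp.tendsto_Lp_iff_tendsto_eLpNorm']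
  refine tendsto_congr fun n => eLpNorm_congr_ae ?_
  filter_upwards [(g n).coeFn_integralLp b] with ω h
  rw [Pi.sub_apply, h]

/-- A Wiener integral with respect to `b` lies in the closed span of the products `b τ ⊗ v`. -/
theorem IsWienerIntegral.mem_of_lpTensor_mem {K : ℝ → ℝ → ℝ} {b : ℝ → Lp ℝ 2 P} {f : ℝ → E}
    {I : Lp E 2 P} (hI : IsWienerIntegral K b f I) {M : Submodule ℝ (Lp E 2 P)}
    (hM : IsClosed (M : Set (Lp E 2 P))) (h : ∀ τ v, lpTensor P v (b τ) ∈ M) : I ∈ M := by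
  obtain ⟨-, g, -, hg⟩ := hI
  refine hM.mem_of_tendsto (StepData.tendsto_integralLp_iff.2 hg) (Eventually.of_forall fun n => ?_)
  refine M.sum_mem fun k _ => ?_
  rw [map_sub]
  exact M.sub_mem (h _ _) (h _ _)

/-- A random variable orthogonal to the driving process is uncorrelated with Wiener integrals. -/
theorem IsWienerIntegral.lpMean_eq_zero [CompleteSpace E] {K : ℝ → ℝ → ℝ} {b : ℝ → Lp ℝ 2 P}
    {f : ℝ → E} {I : Lp E 2 P} (hI : IsWienerIntegral K b f I) {ξ : Lp ℝ 2 P}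
    (hξ : ∀ τ, inner ℝ ξ (b τ) = 0) : lpMean P ξ I = 0 := by
  have := hI.mem_of_lpTensor_mem (M := (lpMean P ξ : Lp E 2 P →L[ℝ] E).ker)
    (ContinuousLinearMap.isClosed_ker _) fun τ v => by
      rw [LinearMap.mem_ker]
      exact (lpMean_lpTensor _ _ _).trans (by rw [hξ, zero_smul])
  exact this

/-- A Wiener integral is orthogonal to what is uncorrelated with the driving process. -/
theorem IsWienerIntegral.inner_eq_zero {E : Type*} [NormedAddCommGroup E] [InnerProductSpace ℝ E]
    [CompleteSpace E] {K : ℝ → ℝ → ℝ} {b : ℝ → Lp ℝ 2 P} {f : ℝ → E} {I Y : Lp E 2 P}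
    (hI : IsWienerIntegral K b f I) (hY : ∀ τ, lpMean P (b τ) Y = 0) : inner ℝ I Y = 0 := by
  have := hI.mem_of_lpTensor_mem (M := (innerSL ℝ Y).ker)
    (ContinuousLinearMap.isClosed_ker _) fun τ v => by
      rw [LinearMap.mem_ker]
      change inner ℝ Y _ = (0 : ℝ)
      rw [real_inner_comm, inner_lpTensor_left, hY, inner_zero_right]
  rw [real_inner_comm]
  exact this

theorem IsCylindricalVolterra.inner_sub_sub {K : ℝ → ℝ → ℝ} {W : ℝ → U →L[ℝ] Lp ℝ 2 P}
    (hW : IsCylindricalVolterra K W) (s₁ t₁ s₂ t₂ : ℝ) (u₁ u₂ : U) :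
    inner ℝ (W t₁ u₁ - W s₁ u₁) (W t₂ u₂ - W s₂ u₂) = volterraCov K s₁ t₁ s₂ t₂ * inner ℝ u₁ u₂ := by
  rw [← hW.covariance, inner_eq_integral_mul]
  refine integral_congr_ae ?_
  filter_upwards [Lp.coeFn_sub (W t₁ u₁) (W s₁ u₁), Lp.coeFn_sub (W t₂ u₂) (W s₂ u₂)] with ω h1 h2
  rw [h1, h2, Pi.sub_apply, Pi.sub_apply]

/-- The covariance of the value `W τ u₁` with an increment; `W 0 = 0` makes the value an increment. -/
theorem IsCylindricalVolterra.inner_eq {K : ℝ → ℝ → ℝ} {W : ℝ → U →L[ℝ] Lp ℝ 2 P}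
    (hW : IsCylindricalVolterra K W) (τ s t : ℝ) (u₁ u₂ : U) :
    inner ℝ (W τ u₁) (W t u₂ - W s u₂) = volterraCov K 0 τ s t * inner ℝ u₁ u₂ := by
  have := hW.inner_sub_sub 0 τ s t u₁ u₂
  rwa [hW.zero u₁, sub_zero] at this

theorem IsCylindricalVolterra.inner_eq_zero {K : ℝ → ℝ → ℝ} {W : ℝ → U →L[ℝ] Lp ℝ 2 P}
    (hW : IsCylindricalVolterra K W) (τ t : ℝ) {u₁ u₂ : U} (h : inner ℝ u₁ u₂ = (0 : ℝ)) :
    inner ℝ (W τ u₁) (W t u₂) = (0 : ℝ) := by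
  have := hW.inner_eq τ 0 t u₁ u₂
  rwa [hW.zero u₂, sub_zero, h, mul_zero] at this

variable {α : ℝ} {K : ℝ → ℝ → ℝ}

namespace IsRegularVolterraKernel

/-- The increment `K(t, ·) - K(s, ·)` as an element of `L²(ℝ)`. -/
def increment (hK : IsRegularVolterraKernel α K) (s t : ℝ) : Lp ℝ 2 (volume : Measure ℝ) :=
  (hK.memLp_increment s t).toLp

theorem coeFn_increment (hK : IsRegularVolterraKernel α K) (s t : ℝ) :
    hK.increment s t =ᵐ[volume] fun ρ => K t ρ - K s ρ := MemLp.coeFn_toLp _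

theorem inner_increment (hK : IsRegularVolterraKernel α K) (s₁ t₁ s₂ t₂ : ℝ) :
    inner ℝ (hK.increment s₁ t₁) (hK.increment s₂ t₂) = volterraCov K s₁ t₁ s₂ t₂ := by
  rw [inner_eq_integral_mul, volterraCov]
  refine integral_congr_ae ?_
  filter_upwards [hK.coeFn_increment s₁ t₁, hK.coeFn_increment s₂ t₂] with ρ h1 h2
  rw [h1, h2]

/-- `𝒦* g` for a step function `g`, as an element of `L²(ℝ; E)`. -/
def stepAdjoint (hK : IsRegularVolterraKernel α K) (g : StepData E) :
    Lp E 2 (volume : Measure ℝ) :=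
  ∑ k, lpTensor volume (g.val k) (hK.increment (g.node k.castSucc) (g.node k.succ))

theorem coeFn_stepAdjoint [CompleteSpace E] (hK : IsRegularVolterraKernel α K) (g : StepData E) :
    hK.stepAdjoint g =ᵐ[volume] kernelAdjoint K g.toFun := by
  have h : ∀ᵐ ρ : ℝ, ∀ k : Fin g.n, hK.increment (g.node k.castSucc) (g.node k.succ) ρ
      = K (g.node k.succ) ρ - K (g.node k.castSucc) ρ :=
    ae_all_iff.2 fun k => hK.coeFn_increment _ _
  filter_upwards [coeFn_sum_lpTensor Finset.univ g.val
    fun k => hK.increment (g.node k.castSucc) (g.node k.succ), h, hK.kernelAdjoint_step g]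
    with ρ h1 h2 h3
  rw [stepAdjoint, h1, h3]
  exact Finset.sum_congr rfl fun k _ => by rw [h2 k]

/-- The covariance of an elementary integral with the noise is read off from `𝒦*`. -/
theorem lpMean_integralLp [CompleteSpace E] (hK : IsRegularVolterraKernel α K)
    {W : ℝ → U →L[ℝ] Lp ℝ 2 P} (hW : IsCylindricalVolterra K W) (τ : ℝ) (u' u : U)
    (g : StepData E) : lpMean P (W τ u') (g.integralLp fun t => W t u)
      = (inner ℝ u' u : ℝ) • lpMean volume (hK.increment 0 τ) (hK.stepAdjoint g) := by
  simp only [StepData.integralLp, stepAdjoint, map_sum, Finset.smul_sum]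
  refine Finset.sum_congr rfl fun k _ => ?_
  rw [lpMean_lpTensor, lpMean_lpTensor, hW.inner_eq, hK.inner_increment, smul_smul, mul_comm]

/-- The covariance of a Wiener integral with the noise, in terms of `𝒦*`. -/
theorem lpMean_wienerIntegral [CompleteSpace E] (hK : IsRegularVolterraKernel α K)
    {W : ℝ → U →L[ℝ] Lp ℝ 2 P} (hW : IsCylindricalVolterra K W) (τ : ℝ) (u' u : U)
    {f : ℝ → E} (hf : MemLp (kernelAdjoint K f) 2 volume) {I : Lp E 2 P}
    (hI : IsWienerIntegral K (fun t => W t u) f I) :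
    lpMean P (W τ u') I
      = (inner ℝ u' u : ℝ) • ∫ ρ, (K τ ρ - K 0 ρ) • kernelAdjoint K f ρ := by
  obtain ⟨-, g, hg1, hg2⟩ := hI
  have h1 : Tendsto (fun n => hK.stepAdjoint (g n)) atTop (𝓝 hf.toLp) := by
    rw [Lp.tendsto_Lp_iff_tendsto_eLpNorm]
    refine hg1.congr fun n => eLpNorm_congr_ae ?_
    filter_upwards [hK.coeFn_stepAdjoint (g n)] with ρ h
    rw [Pi.sub_apply, h]
  have h2 := ((lpMean volume (hK.increment 0 τ)).continuous.tendsto _).comp h1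
  have h3 := ((lpMean P (W τ u')).continuous.tendsto _).comp (StepData.tendsto_integralLp_iff.2 hg2)
  have h4 : lpMean volume (hK.increment 0 τ) hf.toLp
      = ∫ ρ, (K τ ρ - K 0 ρ) • kernelAdjoint K f ρ := by
    rw [lpMean_apply]
    refine integral_congr_ae ?_
    filter_upwards [hK.coeFn_increment 0 τ, hf.coeFn_toLp] with ρ h5 h6
    rw [h5, h6]
  rw [← h4]
  refine tendsto_nhds_unique h3 ((h2.const_smul (inner ℝ u' u : ℝ)).congr fun n => ?_)
  exact (hK.lpMean_integralLp hW τ u' u (g n)).symm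

/-- The elementary integrals and their images under `𝒦*` have proportional inner products. -/
theorem inner_integralLp {E : Type*} [NormedAddCommGroup E] [InnerProductSpace ℝ E]
    [CompleteSpace E] (hK : IsRegularVolterraKernel α K)
    {W : ℝ → U →L[ℝ] Lp ℝ 2 P} (hW : IsCylindricalVolterra K W) (u : U) (g g' : StepData E) :
    inner ℝ (g.integralLp fun t => W t u) (g'.integralLp fun t => W t u)
      = (inner ℝ u u * inner ℝ (hK.stepAdjoint g) (hK.stepAdjoint g') : ℝ) := by
  simp only [StepData.integralLp, stepAdjoint, sum_inner, inner_sum, Finset.mul_sum]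
  refine Finset.sum_congr rfl fun k _ => Finset.sum_congr rfl fun l _ => ?_
  rw [inner_lpTensor_lpTensor, inner_lpTensor_lpTensor, hW.inner_sub_sub, hK.inner_increment]
  ring

/-- The isometry behind the Wiener integral. -/
theorem norm_integralLp_sub {E : Type*} [NormedAddCommGroup E] [InnerProductSpace ℝ E]
    [CompleteSpace E] (hK : IsRegularVolterraKernel α K)
    {W : ℝ → U →L[ℝ] Lp ℝ 2 P} (hW : IsCylindricalVolterra K W) (u : U) (g g' : StepData E) :
    ‖(g.integralLp fun t => W t u) - g'.integralLp fun t => W t u‖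
      = ‖u‖ * ‖hK.stepAdjoint g - hK.stepAdjoint g'‖ := by
  rw [← sq_eq_sq₀ (norm_nonneg _) (by positivity), mul_pow, ← real_inner_self_eq_norm_sq,
    ← real_inner_self_eq_norm_sq, ← real_inner_self_eq_norm_sq]
  simp only [inner_sub_left, inner_sub_right, hK.inner_integralLp hW]
  ring

/-- Existence of Wiener integrals: it suffices to approximate the integrand. -/
theorem exists_wienerIntegral {E : Type*} [NormedAddCommGroup E] [InnerProductSpace ℝ E]
    [CompleteSpace E] (hK : IsRegularVolterraKernel α K)
    {W : ℝ → U →L[ℝ] Lp ℝ 2 P} (hW : IsCylindricalVolterra K W) (u : U) {f : ℝ → E}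
    (hfi : ∀ᵐ ρ : ℝ, IntegrableOn (fun u => kernelDeriv K u ρ • f u) (Ioi ρ))
    (hf : MemLp (kernelAdjoint K f) 2 volume) {g : ℕ → StepData E}
    (hg : Tendsto (fun n => eLpNorm
      (fun ρ => kernelAdjoint K (g n).toFun ρ - kernelAdjoint K f ρ) 2 volume) atTop (𝓝 0)) :
    ∃ I : Lp E 2 P, IsWienerIntegral K (fun t => W t u) f I := by
  have h1 : Tendsto (fun n => hK.stepAdjoint (g n)) atTop (𝓝 hf.toLp) := by
    rw [Lp.tendsto_Lp_iff_tendsto_eLpNorm]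
    refine hg.congr fun n => eLpNorm_congr_ae ?_
    filter_upwards [hK.coeFn_stepAdjoint (g n)] with ρ h
    rw [Pi.sub_apply, h]
  have h2 : CauchySeq fun n => (g n).integralLp fun t => W t u := by
    have h3 := h1.cauchySeq
    rw [Metric.cauchySeq_iff] at h3 ⊢
    intro ε hε
    obtain ⟨N, hN⟩ := h3 (ε / (‖u‖ + 1)) (by positivity)
    refine ⟨N, fun m hm n hn => ?_⟩
    have h4 := hN m hm n hn
    rw [dist_eq_norm] at h4 ⊢
    rw [hK.norm_integralLp_sub hW]
    rw [lt_div_iff₀ (by positivity)] at h4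
    nlinarith [norm_nonneg (hK.stepAdjoint (g m) - hK.stepAdjoint (g n))]
  obtain ⟨I, hI⟩ := cauchySeq_tendsto_of_complete h2
  exact ⟨I, hfi, g, hg, StepData.tendsto_integralLp_iff.1 hI⟩

end IsRegularVolterraKernel

end Step

/-! ### Covariance with convolutions, and existence of Wiener integrals -/

section Correlation

variable {E : Type*} [NormedAddCommGroup E] [NormedSpace ℝ E]

/-- The density `s ↦ ∫ (K(τ, ρ) - K(0, ρ)) ∂K/∂s(s, ρ) dρ` of the covariance of the noise at
time `τ` with a Wiener integral. -/
def kernelCorrelation (K : ℝ → ℝ → ℝ) (τ s : ℝ) : ℝ :=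
  ∫ ρ, (K τ ρ - K 0 ρ) * truncDeriv K s ρ

namespace IsRegularVolterraKernel

variable {α : ℝ} {K : ℝ → ℝ → ℝ}

section Fubini

variable {f : ℝ → E} {a b M : ℝ}

theorem integrable_correlation_prod (hK : IsRegularVolterraKernel α K) (τ : ℝ)
    (hf : AEStronglyMeasurable f volume) (hM : ∀ u, ‖f u‖ ≤ M) (hab : a ≤ b)
    (hs : ∀ u, u ∉ Icc a b → f u = 0) :
    Integrable (Function.uncurry fun ρ s => (K τ ρ - K 0 ρ) • truncDeriv K s ρ • f s)
      (volume.prod volume) := by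
  have hψ : AEStronglyMeasurable (fun p : ℝ × ℝ => K τ p.1 - K 0 p.1) (volume.prod volume) :=
    (((hK.measurable.comp (measurable_const.prodMk measurable_fst)).sub
        (hK.measurable.comp (measurable_const.prodMk measurable_fst)))).aestronglyMeasurable
  have hmeas : AEStronglyMeasurable
      (Function.uncurry fun ρ s => (K τ ρ - K 0 ρ) • truncDeriv K s ρ • f s)
      (volume.prod volume) :=
    hψ.smul ((hK.measurable_truncDeriv.comp measurable_swap).aestronglyMeasurable.smul hf.comp_snd)
  rw [integrable_prod_iff hmeas]
  refine ⟨Eventually.of_forall fun ρ => (hK.integrable_truncDeriv_smul hf hM hs ρ).smul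
    (K τ ρ - K 0 ρ), ?_⟩
  have hdom : Integrable (fun ρ => ‖K τ ρ - K 0 ρ‖ * (hK.const * M * kernelMajorant α a b ρ)) := by
    have h1 := (memLp_kernelMajorant hK.alpha_pos hK.alpha_lt hab).const_mul (hK.const * M)
    exact (memLp_one_iff_integrable.1 (h1.smul (hK.memLp_increment 0 τ).norm))
  refine hdom.mono' hmeas.norm.integral_prod_right' (Eventually.of_forall fun ρ => ?_)
  rw [Real.norm_of_nonneg (integral_nonneg fun _ => norm_nonneg _)]
  simp only [Function.uncurry_apply_pair, norm_smul (K τ ρ - K 0 ρ)]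
  rw [integral_const_mul]
  refine mul_le_mul_of_nonneg_left ?_ (norm_nonneg _)
  rw [kernelMajorant, ← integral_const_mul, ← integral_indicator measurableSet_Icc]
  refine integral_mono (hK.integrable_truncDeriv_smul hf hM hs ρ).norm ?_
    fun u => hK.norm_truncDeriv_smul_le hM hs u ρ
  rw [integrable_indicator_iff measurableSet_Icc]
  exact (integrableOn_posRpow_sub hK.alpha_pos a b ρ).const_mul _

/-- Fubini: the covariance of a Wiener integral with the noise at time `τ` has the density
`kernelCorrelation K τ`. -/
theorem integral_smul_kernelAdjoint [CompleteSpace E] (hK : IsRegularVolterraKernel α K) (τ : ℝ)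
    (hf : AEStronglyMeasurable f volume) (hM : ∀ u, ‖f u‖ ≤ M) (hab : a ≤ b)
    (hs : ∀ u, u ∉ Icc a b → f u = 0) :
    ∫ ρ, (K τ ρ - K 0 ρ) • kernelAdjoint K f ρ = ∫ s, kernelCorrelation K τ s • f s := by
  simp only [kernelAdjoint_eq, ← integral_smul]
  rw [integral_integral_swap (hK.integrable_correlation_prod τ hf hM hab hs)]
  simp only [smul_smul, kernelCorrelation, integral_smul_const]

end Fubini

/-- Integrability of the density is the case of an indicator function in the Fubini argument. -/
theorem integrableOn_kernelCorrelation (hK : IsRegularVolterraKernel α K) (τ a b : ℝ) :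
    IntegrableOn (kernelCorrelation K τ) (Icc a b) := by
  rcases lt_or_ge b a with h | hab
  · simp [Icc_eq_empty (not_le.2 h)]
  have h1 := (hK.integrable_correlation_prod τ (f := (Icc a b).indicator fun _ => (1 : ℝ)) (M := 1)
    (aestronglyMeasurable_const.indicator measurableSet_Icc)
    (fun u => (norm_indicator_le_norm_self _ _).trans (by simp)) hab
    (fun u hu => indicator_of_notMem hu _)).integral_prod_right
  rw [← integrable_indicator_iff measurableSet_Icc]
  refine h1.congr (Eventually.of_forall fun s => ?_)
  by_cases h : s ∈ Icc a b <;> simp [h, kernelCorrelation]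

end IsRegularVolterraKernel

end Correlation

section StepApproximation

variable {E : Type*} [NormedAddCommGroup E]

namespace StepData

theorem toFun_of_mem (g : StepData E) {s : ℝ} {k : Fin g.n}
    (hs : s ∈ Ico (g.node k.castSucc) (g.node k.succ)) : g.toFun s = g.val k := by
  rw [toFun, Finset.sum_eq_single k, indicator_of_mem hs]
  · intro l _ hl
    refine indicator_of_notMem (fun h => ?_) _
    rcases lt_or_gt_of_ne hl with h1 | h1
    · have h2 : g.node l.succ ≤ g.node k.castSucc :=
        g.strictMono.monotone (Fin.succ_le_castSucc_iff.2 h1)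
      linarith [h.2, hs.1]
    · have h2 : g.node k.succ ≤ g.node l.castSucc :=
        g.strictMono.monotone (Fin.succ_le_castSucc_iff.2 h1)
      linarith [h.1, hs.2]
  · simp

theorem toFun_of_notMem (g : StepData E) {s : ℝ}
    (hs : s ∉ Ico (g.node 0) (g.node (Fin.last g.n))) : g.toFun s = 0 := by
  refine Finset.sum_eq_zero fun k _ => indicator_of_notMem (fun h => hs ⟨?_, ?_⟩) _
  · exact (g.strictMono.monotone (Fin.zero_le _)).trans h.1
  · exact h.2.trans_le (g.strictMono.monotone (Fin.le_last _))

theorem aestronglyMeasurable_toFun (g : StepData E) : AEStronglyMeasurable g.toFun volume :=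
  Finset.aestronglyMeasurable_fun_sum _ fun _ _ =>
    aestronglyMeasurable_const.indicator measurableSet_Ico

/-- The step function that samples `c` at the left endpoints of the uniform partition of `[0, t)`
into `n + 1` intervals. -/
def uniform (c : ℝ → E) {t : ℝ} (ht : 0 < t) (n : ℕ) : StepData E where
  n := n + 1
  node k := t / (n + 1) * k
  strictMono k l h := mul_lt_mul_of_pos_left (by exact_mod_cast h) (by positivity)
  val k := c (t / (n + 1) * k)

omit [NormedAddCommGroup E] in
theorem uniform_node_last (c : ℝ → E) {t : ℝ} (ht : 0 < t) (n : ℕ) :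
    (uniform c ht n).node (Fin.last _) = t := by
  have : (n : ℝ) + 1 ≠ 0 := by positivity
  simp only [uniform, Fin.val_last, Nat.cast_add, Nat.cast_one]
  field_simp

theorem uniform_toFun_of_notMem (c : ℝ → E) {t : ℝ} (ht : 0 < t) (n : ℕ) {s : ℝ}
    (hs : s ∉ Ico 0 t) : (uniform c ht n).toFun s = 0 := by
  refine toFun_of_notMem _ fun h => hs ?_
  rw [uniform_node_last] at h
  simpa [uniform] using h

theorem exists_uniform_toFun_eq (c : ℝ → E) {t : ℝ} (ht : 0 < t) (n : ℕ) {s : ℝ}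
    (hs : s ∈ Ico 0 t) :
    ∃ s' ∈ Icc 0 t, |s - s'| ≤ t / (n + 1) ∧ (uniform c ht n).toFun s = c s' := by
  have hn : (0 : ℝ) < (n : ℝ) + 1 := by positivity
  have hd : 0 < t / (n + 1) := by positivity
  have h0 : 0 ≤ s / (t / (n + 1)) := div_nonneg hs.1 hd.le
  have hk1 : (⌊s / (t / (n + 1))⌋₊ : ℝ) ≤ s / (t / (n + 1)) := Nat.floor_le h0
  have hk2 : s / (t / (n + 1)) < ⌊s / (t / (n + 1))⌋₊ + 1 := Nat.lt_floor_add_one _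
  set k := ⌊s / (t / (n + 1))⌋₊
  have h1 : t / (n + 1) * k ≤ s := by rw [le_div_iff₀ hd] at hk1; linarith
  have h2 : s < t / (n + 1) * (k + 1) := by rw [div_lt_iff₀ hd] at hk2; linarith
  have hk : k < n + 1 := by
    have h3 : t / (n + 1) * k < t / (n + 1) * (n + 1) := by
      rw [div_mul_cancel₀ _ hn.ne']
      exact h1.trans_lt hs.2
    have := lt_of_mul_lt_mul_left h3 hd.le
    exact_mod_cast this
  refine ⟨t / (n + 1) * k, ⟨by positivity, h1.trans hs.2.le⟩, ?_, ?_⟩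
  · rw [abs_of_nonneg (by linarith)]
    linarith
  · refine toFun_of_mem (uniform c ht n) (k := ⟨k, hk⟩) ⟨?_, ?_⟩
    · simpa [uniform] using h1
    · simpa [uniform] using h2

/-- The uniform step functions converge uniformly, since `c` is uniformly continuous on `[0, t]`. -/
theorem exists_norm_uniform_sub_le {c : ℝ → E} (hc : Continuous c) {t : ℝ} (ht : 0 < t) {ε : ℝ}
    (hε : 0 < ε) : ∃ N : ℕ, ∀ n ≥ N, ∀ s,
      ‖(uniform c ht n).toFun s - (Ico 0 t).indicator c s‖ ≤ ε := by
  have h1 := (isCompact_Icc (a := (0 : ℝ)) (b := t)).uniformContinuousOn_of_continuous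
    hc.continuousOn
  obtain ⟨δ, hδ, h2⟩ := Metric.uniformContinuousOn_iff.1 h1 ε hε
  obtain ⟨N, hN⟩ := exists_nat_gt (t / δ)
  refine ⟨N, fun n hn s => ?_⟩
  by_cases hs : s ∈ Ico 0 t
  · obtain ⟨s', hs', h3, h4⟩ := exists_uniform_toFun_eq c ht n hs
    rw [h4, indicator_of_mem hs, ← dist_eq_norm]
    refine (h2 s' hs' s ⟨hs.1, hs.2.le⟩ ?_).le
    rw [dist_comm, Real.dist_eq]
    refine h3.trans_lt ?_
    rw [div_lt_iff₀ (by positivity)]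
    rw [div_lt_iff₀ hδ] at hN
    have : (N : ℝ) ≤ n := by exact_mod_cast hn
    nlinarith
  · rw [uniform_toFun_of_notMem c ht n hs, indicator_of_notMem hs]
    simpa using hε.le

end StepData

theorem exists_norm_indicator_le {c : ℝ → E} (hc : Continuous c) (t : ℝ) :
    ∃ M, 0 ≤ M ∧ ∀ s, ‖(Ico 0 t).indicator c s‖ ≤ M := by
  obtain ⟨M, hM⟩ := (isCompact_Icc (a := (0 : ℝ)) (b := t)).exists_bound_of_continuousOn
    hc.continuousOn
  refine ⟨max M 0, le_max_right _ _, fun s => ?_⟩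
  by_cases hs : s ∈ Ico 0 t
  · rw [indicator_of_mem hs]
    exact (hM s ⟨hs.1, hs.2.le⟩).trans (le_max_left _ _)
  · rw [indicator_of_notMem hs]
    simp

end StepApproximation

section Convolution

variable {Ω : Type*} [MeasurableSpace Ω] {P : Measure Ω}
  {U : Type*} [NormedAddCommGroup U] [InnerProductSpace ℝ U]
  {α : ℝ} {K : ℝ → ℝ → ℝ}

theorem indicator_Ico_eq_zero {E : Type*} [Zero E] {c : ℝ → E} {t u : ℝ} (h : u ∉ Icc 0 t) :
    (Ico 0 t).indicator c u = 0 :=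
  indicator_of_notMem (fun h' => h ⟨h'.1, h'.2.le⟩) _

namespace IsRegularVolterraKernel

/-- The covariance of the noise with the Wiener integral of a continuous function over `[0, t)`. -/
theorem lpMean_wienerIntegral_indicator {E : Type*} [NormedAddCommGroup E] [NormedSpace ℝ E]
    [CompleteSpace E] (hK : IsRegularVolterraKernel α K)
    {W : ℝ → U →L[ℝ] Lp ℝ 2 P} (hW : IsCylindricalVolterra K W) (τ : ℝ) (u' u : U)
    {c : ℝ → E} (hc : Continuous c) {t : ℝ} (ht : 0 ≤ t) {I : Lp E 2 P}
    (hI : IsWienerIntegral K (fun s => W s u) ((Ico 0 t).indicator c) I) :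
    lpMean P (W τ u') I
      = (inner ℝ u' u : ℝ) • ∫ s in (0 : ℝ)..t, kernelCorrelation K τ s • c s := by
  obtain ⟨M, -, hM⟩ := exists_norm_indicator_le hc t
  have hf : AEStronglyMeasurable ((Ico 0 t).indicator c) volume :=
    hc.aestronglyMeasurable.indicator measurableSet_Ico
  have hs : ∀ u, u ∉ Icc 0 t → (Ico 0 t).indicator c u = 0 := fun u hu => indicator_Ico_eq_zero hu
  rw [hK.lpMean_wienerIntegral hW τ u' u (hK.memLp_kernelAdjoint hf hM ht hs) hI,
    hK.integral_smul_kernelAdjoint τ hf hM ht hs, intervalIntegral.integral_of_le ht,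
    ← integral_Ico_eq_integral_Ioc, ← integral_indicator measurableSet_Ico]
  congr 2
  ext s
  by_cases h : s ∈ Ico 0 t <;> simp [h]

/-- The Wiener integral of a continuous function over `[0, t)` exists. -/
theorem exists_wienerIntegral_indicator {E : Type*} [NormedAddCommGroup E] [InnerProductSpace ℝ E]
    [CompleteSpace E] (hK : IsRegularVolterraKernel α K)
    {W : ℝ → U →L[ℝ] Lp ℝ 2 P} (hW : IsCylindricalVolterra K W) (u : U)
    {c : ℝ → E} (hc : Continuous c) {t : ℝ} (ht : 0 ≤ t) :
    ∃ I : Lp E 2 P, IsWienerIntegral K (fun s => W s u) ((Ico 0 t).indicator c) I := by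
  obtain ⟨M, hM0, hM⟩ := exists_norm_indicator_le hc t
  have hf : AEStronglyMeasurable ((Ico 0 t).indicator c) volume :=
    hc.aestronglyMeasurable.indicator measurableSet_Ico
  have hs : ∀ u, u ∉ Icc 0 t → (Ico 0 t).indicator c u = 0 := fun u hu => indicator_Ico_eq_zero hu
  have hfi : ∀ᵐ ρ : ℝ, IntegrableOn (fun u => kernelDeriv K u ρ • (Ico 0 t).indicator c u) (Ioi ρ) :=
    Eventually.of_forall fun ρ => hK.integrableOn_kernelDeriv_smul hf hM hs ρ
  have hfm := hK.memLp_kernelAdjoint hf hM ht hs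
  -- for `t = 0` there is no partition, and the integrand is zero
  rcases ht.eq_or_lt with rfl | ht
  · refine hK.exists_wienerIntegral hW u hfi hfm
      (g := fun _ => ⟨0, fun _ => 0, fun i j h => by omega, Fin.elim0⟩) ?_
    simp [StepData.toFun, kernelAdjoint]
  refine hK.exists_wienerIntegral hW u hfi hfm (g := StepData.uniform c ht) ?_
  have hC : eLpNorm (kernelMajorant α 0 t) 2 volume ≠ ∞ :=
    (memLp_kernelMajorant hK.alpha_pos hK.alpha_lt ht.le).2.ne
  rw [ENNReal.tendsto_atTop_zero]
  intro ε hε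
  -- a sup-norm error `δ` costs at most `δ C ‖∫_0^t (u - ·)₊^(α - 1) du‖` in `L²`
  obtain ⟨δ, hδ, hδε⟩ : ∃ δ : ℝ, 0 < δ ∧
      ENNReal.ofReal (hK.const * δ) * eLpNorm (kernelMajorant α 0 t) 2 volume ≤ ε := by
    have h1 : Tendsto (fun δ : ℝ => ENNReal.ofReal (hK.const * δ)
        * eLpNorm (kernelMajorant α 0 t) 2 volume) (𝓝[>] 0) (𝓝 0) := by
      have h2 : Tendsto (fun δ : ℝ => ENNReal.ofReal (hK.const * δ)) (𝓝 0) (𝓝 0) := by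
        have : Continuous fun δ : ℝ => ENNReal.ofReal (hK.const * δ) :=
          ENNReal.continuous_ofReal.comp (by fun_prop)
        simpa using this.tendsto 0
      have h3 := ENNReal.Tendsto.mul_const (h2.mono_left (nhdsWithin_le_nhds (s := Ioi 0))) (Or.inr hC)
      rwa [zero_mul] at h3
    have h4 := (h1.eventually (ge_mem_nhds hε)).and self_mem_nhdsWithin
    obtain ⟨δ, h5, h6⟩ := h4.exists
    exact ⟨δ, h6, h5⟩
  obtain ⟨N, hN⟩ := StepData.exists_norm_uniform_sub_le hc ht hδ
  refine ⟨N, fun n hn => le_trans (le_of_eq ?_) ((hK.eLpNorm_kernelAdjoint_le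
    (f := fun s => (StepData.uniform c ht n).toFun s - (Ico 0 t).indicator c s)
    (a := 0) (b := t) (hN n hn) fun u hu => ?_).trans hδε)⟩
  · have hgM : ∀ s, ‖(StepData.uniform c ht n).toFun s‖ ≤ δ + M := fun s => by
      have := norm_add_le ((StepData.uniform c ht n).toFun s - (Ico 0 t).indicator c s)
        ((Ico 0 t).indicator c s)
      rw [sub_add_cancel] at this
      linarith [hN n hn s, hM s]
    congr 1
    ext ρ
    simp only [kernelAdjoint_eq, smul_sub]
    rw [integral_sub]
    · exact hK.integrable_truncDeriv_smul (StepData.aestronglyMeasurable_toFun _) hgM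
        (a := 0) (b := t)
        (fun u hu => StepData.uniform_toFun_of_notMem c ht n fun h => hu ⟨h.1, h.2.le⟩) ρ
    · exact hK.integrable_truncDeriv_smul hf hM hs ρ
  · rw [hs u hu, StepData.uniform_toFun_of_notMem c ht n fun h => hu ⟨h.1, h.2.le⟩, sub_zero]

end IsRegularVolterraKernel

end Convolution

/-! ### Averaging against a scalar random variable -/

section Mean

variable {X Ω : Type*} [MeasurableSpace X] [MeasurableSpace Ω] {μ : Measure X} {P : Measure Ω}
  {E F : Type*} [NormedAddCommGroup E] [NormedSpace ℝ E] [NormedAddCommGroup F] [NormedSpace ℝ F]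

theorem integrable_lp_smul (ξ : Lp ℝ 2 P) {Y : Ω → E} (hY : MemLp Y 2 P) :
    Integrable (fun ω => ξ ω • Y ω) P :=
  memLp_one_iff_integrable.1 (hY.smul (Lp.memLp ξ))

theorem map_integral_lp_smul [CompleteSpace E] [CompleteSpace F] (G : E →L[ℝ] F) (ξ : Lp ℝ 2 P)
    {Y : Ω → E} (hY : MemLp Y 2 P) : G (∫ ω, ξ ω • Y ω ∂P) = ∫ ω, ξ ω • G (Y ω) ∂P := by
  rw [← G.integral_comp_comm (integrable_lp_smul ξ hY)]
  simp only [map_smul]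

theorem integrable_lp_smul_prod [IsFiniteMeasure μ] [SFinite P] (ξ : Lp ℝ 2 P) {f : X → Ω → E}
    (hf : MemLp (Function.uncurry f) 2 (μ.prod P)) :
    Integrable (fun p : X × Ω => ξ p.2 • f p.1 p.2) (μ.prod P) := by
  have h1 : MemLp (fun p : X × Ω => ξ p.2) 2 (μ.prod P) := (Lp.memLp ξ).comp_snd μ
  exact memLp_one_iff_integrable.1 (MemLp.smul (p := 2) (q := 2) (r := 1) hf h1)

theorem norm_sq_toLp {V : Type*} [NormedAddCommGroup V] [InnerProductSpace ℝ V]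
    {Y : Ω → V} (hY : MemLp Y 2 P) : ‖hY.toLp‖ ^ 2 = ∫ ω, ‖Y ω‖ ^ 2 ∂P := by
  rw [← real_inner_self_eq_norm_sq, L2.inner_def]
  refine integral_congr_ae ?_
  filter_upwards [hY.coeFn_toLp] with ω h
  rw [h, real_inner_self_eq_norm_sq]

/-- By Cauchy-Schwarz in `ω`, averaging a square integrable process against `ξ` gives a square
integrable function of time. -/
theorem memLp_mean {V : Type*} [NormedAddCommGroup V] [InnerProductSpace ℝ V] [CompleteSpace V]
    [SFinite μ] [SFinite P] {f : X → Ω → V} (hf : MemLp (Function.uncurry f) 2 (μ.prod P))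
    (ξ : Lp ℝ 2 P) : MemLp (fun s => ∫ ω, ξ ω • f s ω ∂P) 2 μ := by
  have hm : AEStronglyMeasurable (fun s => ∫ ω, ξ ω • f s ω ∂P) μ :=
    ((Lp.aestronglyMeasurable ξ).comp_snd.smul hf.1).integral_prod_right'
  rw [memLp_two_iff_integrable_sq_norm hm]
  have h1 := ((memLp_two_iff_integrable_sq_norm hf.1).1 hf).integral_prod_left
  refine (h1.const_mul (‖(lpMean P ξ : Lp V 2 P →L[ℝ] V)‖ ^ 2)).mono' (hm.norm.pow 2) ?_
  filter_upwards [ae_memLp_section hf] with s hs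
  rw [Real.norm_of_nonneg (by positivity)]
  have h2 : ∫ ω, ξ ω • f s ω ∂P = lpMean P ξ hs.toLp := by
    rw [lpMean_apply]
    refine integral_congr_ae ?_
    filter_upwards [hs.coeFn_toLp] with ω h
    rw [h]
  simp only [Function.uncurry_apply_pair]
  rw [h2, ← norm_sq_toLp hs, ← mul_pow]
  gcongr
  exact ContinuousLinearMap.le_opNorm _ _

end Mean

namespace IsC0SemigroupGeneratedBy

variable {E : Type*} [NormedAddCommGroup E] [NormedSpace ℝ E] [CompleteSpace E]
  {𝒢 : Set (E × E)} {S : ℝ → E →L[ℝ] E}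

theorem integrable_apply (hS : IsC0SemigroupGeneratedBy 𝒢 S) {X : Type*} [MeasurableSpace X]
    {μ : Measure X} {τ : X → ℝ} (hτ : Measurable τ) {T : ℝ} (hT : ∀ᵐ x ∂μ, τ x ≤ T)
    {f : X → E} (hf : Integrable f μ) : Integrable (fun x => S (max (τ x) 0) (f x)) μ := by
  obtain ⟨M, -, hM⟩ := hS.exists_norm_le (max T 0)
  refine (hf.norm.const_mul M).mono' ?_ ?_
  · exact hS.continuous_uncurry.comp_aestronglyMeasurable
      (hτ.aestronglyMeasurable.prodMk hf.1)
  · filter_upwards [hT] with x hx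
    exact ((S _).le_opNorm _).trans (mul_le_mul_of_nonneg_right
      (hM _ ⟨le_max_right _ _, max_le_max_right _ hx⟩) (norm_nonneg _))

theorem intervalIntegrable_convolution (hS : IsC0SemigroupGeneratedBy 𝒢 S) {f : ℝ → E} {t : ℝ}
    (ht : 0 ≤ t) (hf : IntegrableOn f (Ioc 0 t)) :
    IntervalIntegrable (fun s => S (t - s) (f s)) volume 0 t := by
  rw [intervalIntegrable_iff_integrableOn_Ioc_of_le ht]
  refine (hS.integrable_apply (μ := volume.restrict (Ioc 0 t)) (τ := fun s => t - s)
    (measurable_const.sub measurable_id) (T := t) ?_ hf).congr ?_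
  · filter_upwards [ae_restrict_mem measurableSet_Ioc] with s hs
    linarith [hs.1]
  · filter_upwards [ae_restrict_mem measurableSet_Ioc] with s hs
    rw [max_eq_left (by linarith [hs.2])]

/-- Averaging commutes with the deterministic convolution. -/
theorem integral_smul_convolution (hS : IsC0SemigroupGeneratedBy 𝒢 S) {Ω : Type*}
    [MeasurableSpace Ω] {P : Measure Ω} [SFinite P] (ξ : Lp ℝ 2 P) {f : ℝ → Ω → E} {t : ℝ}
    (ht : 0 ≤ t) (hf : MemLp (Function.uncurry f) 2 ((volume.restrict (Ioc 0 t)).prod P)) :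
    Integrable (fun ω => ξ ω • ∫ s in (0 : ℝ)..t, S (t - s) (f s ω)) P ∧
    ∫ ω, ξ ω • (∫ s in (0 : ℝ)..t, S (t - s) (f s ω)) ∂P
      = ∫ s in (0 : ℝ)..t, S (t - s) (∫ ω, ξ ω • f s ω ∂P) := by
  have h1 := integrable_lp_smul_prod ξ hf
  have h2 := hS.integrable_apply (τ := fun p : ℝ × Ω => t - p.1)
    (measurable_const.sub measurable_fst) (T := t) (by
      have h3 : ∀ᵐ s ∂(volume.restrict (Ioc 0 t)), t - s ≤ t := by
        filter_upwards [ae_restrict_mem measurableSet_Ioc] with s hs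
        linarith [hs.1]
      exact Measure.quasiMeasurePreserving_fst.ae h3) h1
  have h4 : ∀ ω, ξ ω • (∫ s in (0 : ℝ)..t, S (t - s) (f s ω))
      = ∫ s in Ioc 0 t, S (max (t - s) 0) (ξ ω • f s ω) := by
    intro ω
    rw [intervalIntegral.integral_of_le ht, ← integral_smul]
    refine setIntegral_congr_fun measurableSet_Ioc fun s hs => ?_
    rw [max_eq_left (by linarith [hs.2]), map_smul]
  refine ⟨?_, ?_⟩
  · exact h2.integral_prod_right.congr (Eventually.of_forall fun ω => (h4 ω).symm)
  · rw [integral_congr_ae (Eventually.of_forall h4), intervalIntegral.integral_of_le ht,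
      ← integral_integral_swap h2]
    refine integral_congr_ae ?_
    filter_upwards [h1.prod_right_ae, ae_restrict_mem measurableSet_Ioc] with s hs hs'
    rw [(S _).integral_comp_comm hs, max_eq_left (by linarith [hs'.2])]

end IsC0SemigroupGeneratedBy

section HistoryMean

variable {Ω : Type*} [MeasurableSpace Ω] {P : Measure Ω} [IsFiniteMeasure P]
  {V : Type*} [NormedAddCommGroup V]

omit [IsFiniteMeasure P] in
theorem historySegment_congr {r t : ℝ} {x x' : ℝ → V}
    (h : ∀ θ ∈ Icc (-r) 0, x (t + θ) = x' (t + θ)) :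
    historySegment V r x t = historySegment V r x' t := by
  have hae : (fun θ => x (t + θ)) =ᵐ[volume.restrict (Icc (-r) 0)] fun θ => x' (t + θ) :=
    (ae_restrict_iff' measurableSet_Icc).2 (Eventually.of_forall h)
  rw [historySegment, historySegment]
  by_cases hm : MemLp (fun θ => x (t + θ)) 2 ((volume : Measure ℝ).restrict (Icc (-r) 0))
  · rw [dif_pos hm, dif_pos ((memLp_congr_ae hae).1 hm)]
    exact MemLp.toLp_congr _ _ hae
  · rw [dif_neg hm, dif_neg (fun h' => hm ((memLp_congr_ae hae).2 h'))]

variable {x : ℝ → Ω → V}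

theorem memLp_swap (hx : MemLp (fun p : ℝ × Ω => x p.1 p.2) 2 (volume.prod P)) :
    MemLp (Function.uncurry fun ω s => x s ω) 2 (P.prod volume) :=
  hx.comp_measurePreserving Measure.measurePreserving_swap

variable [InnerProductSpace ℝ V] [CompleteSpace V] [TopologicalSpace.SeparableSpace V]

theorem memLp_random_history (hx : MemLp (fun p : ℝ × Ω => x p.1 p.2) 2 (volume.prod P))
    (r t : ℝ) : MemLp (fun ω => historySegment V r (fun s => x s ω) t) 2 P :=
  memLp_historySegment (memLp_swap hx) measurable_const r

theorem memLp_history_prod (hx : MemLp (fun p : ℝ × Ω => x p.1 p.2) 2 (volume.prod P))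
    (r t : ℝ) : MemLp (Function.uncurry fun s ω => historySegment V r (fun s => x s ω) s) 2
      ((volume.restrict (Ioc 0 t)).prod P) := by
  refine memLp_historySegment (μ := (volume.restrict (Ioc 0 t)).prod P)
    (u := fun p s => x s p.2) ?_ measurable_fst r
  have h1 : MemLp (fun q : ℝ × Ω × ℝ => x q.2.2 q.2.1) 2
      ((volume.restrict (Ioc 0 t)).prod (P.prod volume)) := (memLp_swap hx).comp_snd _
  exact h1.comp_measurePreserving (measurePreserving_prodAssoc _ _ _)

/-- Taking segments commutes with averaging. -/
theorem historySegment_mean (hx : MemLp (fun p : ℝ × Ω => x p.1 p.2) 2 (volume.prod P))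
    (ξ : Lp ℝ 2 P) (r t : ℝ) :
    historySegment V r (fun s => ∫ ω, ξ ω • x s ω ∂P) t
      = ∫ ω, ξ ω • historySegment V r (fun s => x s ω) t ∂P := by
  have hm := memLp_mean (f := x) hx ξ
  refine Lp.ext ((coeFn_historySegment hm r t).trans ?_)
  refine (integral_section_ae_eq (μ := P) (f := fun ω θ => ξ ω • x (t + θ) ω) ?_
    (integrable_lp_smul ξ (memLp_random_history hx r t)) ?_).symm
  · have h1 : MemLp (fun p : Ω × ℝ => ξ p.1) 2 (P.prod (volume.restrict (Icc (-r) 0))) :=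
      (Lp.memLp ξ).comp_fst _
    exact memLp_one_iff_integrable.1 (MemLp.smul (p := 2) (q := 2) (r := 1)
      (memLp_history (memLp_swap hx) (τ := fun _ => t) measurable_const r) h1)
  · filter_upwards [ae_historySegment_eq (memLp_swap hx) (τ := fun _ => t) measurable_const r]
      with ω hω
    filter_upwards [Lp.coeFn_smul (ξ ω) (historySegment V r (fun s => x s ω) t), hω] with θ h1 h2
    rw [h1, Pi.smul_apply, h2]

end HistoryMean

/-! ### Averages of solutions of the stochastic neutral equation -/

namespace NeutralSystem

variable {U V H : Type*}
  [NormedAddCommGroup U] [InnerProductSpace ℝ U]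
  [NormedAddCommGroup V] [InnerProductSpace ℝ V] [CompleteSpace V]
  [TopologicalSpace.SeparableSpace V]
  [NormedAddCommGroup H] [InnerProductSpace ℝ H]
  (N : NeutralSystem U V H)
  {Ω : Type*} [MeasurableSpace Ω] {P : Measure Ω} [IsFiniteMeasure P]

theorem memLp_delayF {x : ℝ → Ω → V}
    (hx : MemLp (fun p : ℝ × Ω => x p.1 p.2) 2 (volume.prod P)) (t : ℝ) :
    MemLp (Function.uncurry fun s ω => N.delayF (fun s => x s ω) s) 2
      ((volume.restrict (Ioc 0 t)).prod P) := by
  have h1 : MemLp (fun p : ℝ × Ω => x (p.1 - N.r) p.2) 2 ((volume.restrict (Ioc 0 t)).prod P) :=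
    (hx.comp_measurePreserving ((measurePreserving_sub_right volume N.r).prod
      (MeasurePreserving.id P))).mono_measure (Measure.prod_mono Measure.restrict_le_self le_rfl)
  exact (N.F₁.comp_memLp' h1).add (N.F₂.comp_memLp' (memLp_history_prod hx N.r t))

/-- Averaging a mild solution of the stochastic neutral equation against `ξ ∈ L²(Ω)` gives a mild
solution of the deterministic one, hence of the deterministic abstract Cauchy problem. -/
theorem mean_state_eq_of_memLp [CompleteSpace H] {SA : ℝ → StrongDual ℝ V →L[ℝ] StrongDual ℝ V}
    (hSA : IsC0SemigroupGeneratedBy N.graphA SA)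
    {S : ℝ → StateSpace H V N.r →L[ℝ] StateSpace H V N.r}
    (hS : IsC0SemigroupGeneratedBy N.graphGenerator S) {T : ℝ}
    {φ : Ω → StateSpace H V N.r} (hφ : MemLp φ 2 P) {x : ℝ → Ω → V} {y : ℝ → Ω → H}
    (hx : MemLp (fun p : ℝ × Ω => x p.1 p.2) 2 (volume.prod P))
    (hy : ∀ t ∈ Icc (0 : ℝ) T, MemLp (y t) 2 P)
    (h0 : ∀ᵐ ω ∂P, historySegment V N.r (fun s => x s ω) 0 = (φ ω).snd)
    (hneutral : ∀ᵐ t ∂((volume : Measure ℝ).restrict (Icc 0 T)), ∀ᵐ ω ∂P,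
      y t ω = N.j (x t ω - N.delayD (fun s => x s ω) t))
    {I : ℝ → Lp (StrongDual ℝ V) 2 P}
    (hmild : ∀ t ∈ Icc (0 : ℝ) T, ∀ᵐ ω ∂P, N.toDual (y t ω) = SA t (N.toDual (φ ω).fst)
        + (∫ s in (0 : ℝ)..t, SA (t - s) (N.delayF (fun σ => x σ ω) s)) + I t ω)
    (ξ : Lp ℝ 2 P) {h : ℝ → H} (hh : IntegrableOn h (Ioc 0 T))
    (hI : ∀ t ∈ Icc (0 : ℝ) T, lpMean P ξ (I t) = ∫ s in (0 : ℝ)..t, SA (t - s) (N.toDual (h s))) :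
    ∀ t ∈ Icc (0 : ℝ) T, ∫ ω, ξ ω • N.state x y t ω ∂P = S t (∫ ω, ξ ω • φ ω ∂P)
      + ∫ s in (0 : ℝ)..t, S (t - s) (WithLp.toLp 2 (h s, 0)) := by
  have hφ1 : MemLp (fun ω => (φ ω).fst) 2 P :=
    (WithLp.fstL 2 ℝ H (SegmentSpace V N.r)).comp_memLp' hφ
  have hφm1 : (∫ ω, ξ ω • φ ω ∂P).fst = ∫ ω, ξ ω • (φ ω).fst ∂P :=
    map_integral_lp_smul (WithLp.fstL 2 ℝ H (SegmentSpace V N.r)) ξ hφ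
  have hφm2 : (∫ ω, ξ ω • φ ω ∂P).snd = ∫ ω, ξ ω • (φ ω).snd ∂P :=
    map_integral_lp_smul (WithLp.sndL 2 ℝ H (SegmentSpace V N.r)) ξ hφ
  have hxae : ∀ᵐ s, MemLp (x s) 2 P := ae_memLp_section (f := x) hx
  have hxae' : ∀ᵐ s, MemLp (x (s - N.r)) 2 P :=
    (measurePreserving_sub_right volume N.r).quasiMeasurePreserving.ae hxae
  have hdelay : ∀ {G : Type _} [NormedAddCommGroup G] [NormedSpace ℝ G] [CompleteSpace G]
      (G₁ : V →L[ℝ] G) (G₂ : SegmentSpace V N.r →L[ℝ] G) {s : ℝ}, MemLp (x (s - N.r)) 2 P →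
      MemLp (fun ω => G₁ (x (s - N.r) ω) + G₂ (historySegment V N.r (fun s => x s ω) s)) 2 P ∧
      G₁ (∫ ω, ξ ω • x (s - N.r) ω ∂P) + G₂ (historySegment V N.r (fun s => ∫ ω, ξ ω • x s ω ∂P) s)
        = ∫ ω, ξ ω • (G₁ (x (s - N.r) ω) + G₂ (historySegment V N.r (fun s => x s ω) s)) ∂P := by
    intro G _ _ _ G₁ G₂ s hs
    have h1 : MemLp (fun ω => G₁ (x (s - N.r) ω)) 2 P := G₁.comp_memLp' hs
    have h2 : MemLp (fun ω => G₂ (historySegment V N.r (fun s => x s ω) s)) 2 P :=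
      G₂.comp_memLp' (memLp_random_history hx N.r s)
    refine ⟨h1.add h2, ?_⟩
    rw [historySegment_mean hx, map_integral_lp_smul G₁ ξ hs,
      map_integral_lp_smul G₂ ξ (memLp_random_history hx N.r s),
      ← integral_add (integrable_lp_smul ξ h1) (integrable_lp_smul ξ h2)]
    simp only [smul_add]
  have hxm := memLp_mean (f := x) hx ξ
  have key := N.state_eq_of_mild hSA hS (T := T) (x := fun s => ∫ ω, ξ ω • x s ω ∂P)
    hxm (y := fun s => ∫ ω, ξ ω • y s ω ∂P) hh (φ := ∫ ω, ξ ω • φ ω ∂P) ?_ ?_ ?_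
  · intro t ht
    rw [← key t ht, historySegment_mean hx]
    have h1 := integrable_lp_smul ξ (hy t ht)
    have h2 := integrable_lp_smul ξ (memLp_random_history hx N.r t)
    have h3 : (fun ω => ξ ω • N.state x y t ω) = fun ω => WithLp.toLp 2
        (ξ ω • y t ω, ξ ω • historySegment V N.r (fun s => x s ω) t) := rfl
    rw [h3]
    refine WithLp.ofLp_injective 2 (Prod.ext ?_ ?_)
    · exact integral_toLp_prod_fst h1 h2
    · exact integral_toLp_prod_snd h1 h2
  · rw [historySegment_mean hx, hφm2]
    refine integral_congr_ae ?_
    filter_upwards [h0] with ω hω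
    rw [hω]
  · filter_upwards [hneutral, ae_restrict_of_ae hxae, ae_restrict_of_ae hxae'] with s h1 h2 h3
    obtain ⟨h4, h5⟩ := hdelay N.D₁ N.D₂ h3
    rw [delayD, h5, ← integral_sub (integrable_lp_smul ξ h2) (integrable_lp_smul ξ h4)]
    simp only [← smul_sub]
    rw [map_integral_lp_smul N.j ξ (Y := fun ω => x s ω - (N.D₁ (x (s - N.r) ω)
      + N.D₂ (historySegment V N.r (fun s => x s ω) s))) (h2.sub h4)]
    refine integral_congr_ae ?_
    filter_upwards [h1] with ω hω
    rw [hω]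
    rfl
  · intro t ht
    obtain ⟨hc1, hc2⟩ := hSA.integral_smul_convolution ξ ht.1 (N.memLp_delayF hx t)
    have hφ3 : MemLp (fun ω => SA t (N.toDual (φ ω).fst)) 2 P :=
      ((SA t).comp N.toDualL).comp_memLp' hφ1
    have e1 : N.toDual (∫ ω, ξ ω • y t ω ∂P) = ∫ ω, ξ ω • N.toDual (y t ω) ∂P :=
      map_integral_lp_smul N.toDualL ξ (hy t ht)
    have e2 : SA t (N.toDual (∫ ω, ξ ω • φ ω ∂P).fst) = ∫ ω, ξ ω • SA t (N.toDual (φ ω).fst) ∂P := by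
      rw [hφm1]
      exact map_integral_lp_smul ((SA t).comp N.toDualL) ξ hφ1
    have e3 : ∫ ω, ξ ω • N.toDual (y t ω) ∂P = (∫ ω, ξ ω • SA t (N.toDual (φ ω).fst) ∂P)
        + (∫ ω, ξ ω • (∫ s in (0 : ℝ)..t, SA (t - s) (N.delayF (fun σ => x σ ω) s)) ∂P)
        + ∫ ω, ξ ω • I t ω ∂P := by
      have hsum : Integrable (fun ω => ξ ω • SA t (N.toDual (φ ω).fst)
          + ξ ω • ∫ s in (0 : ℝ)..t, SA (t - s) (N.delayF (fun σ => x σ ω) s)) P :=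
        (integrable_lp_smul ξ hφ3).add hc1
      rw [← integral_add (integrable_lp_smul ξ hφ3) hc1,
        ← integral_add hsum (integrable_lp_smul ξ (Lp.memLp (I t)))]
      refine integral_congr_ae ?_
      filter_upwards [hmild t ht] with ω hω
      rw [hω, smul_add, smul_add]
    have e4 : ∫ s in (0 : ℝ)..t, SA (t - s) (∫ ω, ξ ω • N.delayF (fun σ => x σ ω) s ∂P)
        = ∫ s in (0 : ℝ)..t, SA (t - s) (N.delayF (fun s => ∫ ω, ξ ω • x s ω ∂P) s) := by
      refine intervalIntegral.integral_congr_ae (hxae'.mono fun s hs _ => ?_)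
      rw [delayF, (hdelay N.F₁ N.F₂ hs).2]
      rfl
    have hFh : IntegrableOn (fun s => N.toDual (h s)) (Ioc 0 t) :=
      N.toDualL.integrable_comp (hh.mono_set (Ioc_subset_Ioc_right ht.2))
    simp only [map_add]
    rw [intervalIntegral.integral_add (hSA.intervalIntegrable_convolution ht.1
        (N.integrableOn_delayF hxm t)) (hSA.intervalIntegrable_convolution ht.1 hFh), e1, e3, hc2,
      e2, e4, ← hI t ht, lpMean_apply, add_assoc]

/-! ### Restriction to the time interval `[-r, T]` -/

section Extension

variable {N} {T : ℝ} {x : ℝ → Ω → V}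

omit [CompleteSpace V] [TopologicalSpace.SeparableSpace V] [InnerProductSpace ℝ V] in
/-- A solution is known on `[-r, T]` only; extended by zero it is square integrable on the whole
line, and segments and delays at times in `[0, T]` do not see the extension. -/
theorem memLp_extension {r : ℝ} (hx : MemLp (fun p : ℝ × Ω => x p.1 p.2) 2
    (((volume : Measure ℝ).restrict (Icc (-r) T)).prod P)) :
    MemLp (fun p : ℝ × Ω => (Icc (-r) T).indicator (fun s => x s p.2) p.1) 2 (volume.prod P) := by
  have h1 : ((volume : Measure ℝ).restrict (Icc (-r) T)).prod P
      = (volume.prod P).restrict (Icc (-r) T ×ˢ univ) := by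
    rw [← Measure.prod_restrict, Measure.restrict_univ]
  rw [h1, ← memLp_indicator_iff_restrict (measurableSet_Icc.prod MeasurableSet.univ)] at hx
  refine (memLp_congr_ae (Eventually.of_forall fun p => ?_)).1 hx
  by_cases hp : p.1 ∈ Icc (-r) T
  · rw [indicator_of_mem hp, indicator_of_mem (show p ∈ Icc (-r) T ×ˢ univ from ⟨hp, mem_univ _⟩)]
  · rw [indicator_of_notMem hp, indicator_of_notMem fun h => hp h.1]

omit [CompleteSpace V] [TopologicalSpace.SeparableSpace V] [InnerProductSpace ℝ V]
  [MeasurableSpace Ω] in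
theorem historySegment_extension {r t : ℝ} (ht : t ∈ Icc 0 T) (x : ℝ → V) :
    historySegment V r ((Icc (-r) T).indicator x) t = historySegment V r x t := by
  refine historySegment_congr fun θ hθ => indicator_of_mem (mem_Icc.2 ⟨?_, ?_⟩) _
  · linarith [ht.1, hθ.1]
  · linarith [ht.2, hθ.2]

omit [CompleteSpace V] [TopologicalSpace.SeparableSpace V] in
theorem delayD_extension {t : ℝ} (ht : t ∈ Icc 0 T) (x : ℝ → V) :
    N.delayD ((Icc (-N.r) T).indicator x) t = N.delayD x t := by
  rw [delayD, historySegment_extension ht, indicator_of_mem, delayD]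
  exact ⟨by linarith [ht.1], by linarith [ht.2, N.r_pos]⟩

omit [CompleteSpace V] [TopologicalSpace.SeparableSpace V] in
theorem delayF_extension {t : ℝ} (ht : t ∈ Icc 0 T) (x : ℝ → V) :
    N.delayF ((Icc (-N.r) T).indicator x) t = N.delayF x t := by
  rw [delayF, historySegment_extension ht, indicator_of_mem, delayF]
  exact ⟨by linarith [ht.1], by linarith [ht.2, N.r_pos]⟩

variable {φ : Ω → StateSpace H V N.r} {y : ℝ → Ω → H}
  {K : ℝ → ℝ → ℝ} {W : ℝ → U →L[ℝ] Lp ℝ 2 P}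

theorem IsMildSolution.memLp_state (hx : N.IsMildSolution P K W T φ x y) {t : ℝ}
    (ht : t ∈ Icc (0 : ℝ) T) : MemLp (N.state x y t) 2 P := by
  have h1 := memLp_random_history
    (x := fun s ω => (Icc (-N.r) T).indicator (fun s => x s ω) s) (memLp_extension hx.memLp_x) N.r t
  have h2 : (fun ω => historySegment V N.r
      (fun s => (Icc (-N.r) T).indicator (fun s => x s ω) s) t)
      = fun ω => historySegment V N.r (fun s => x s ω) t :=
    funext fun ω => historySegment_extension ht _
  rw [h2] at h1
  exact MemLp.of_fst_of_snd_prodLp ⟨hx.memLp_y t ht, h1⟩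

/-- If the mean of the stochastic integral against `ξ` is a convolution with `h`, then the mean of
the state against `ξ` is the mild solution of the abstract Cauchy problem with forcing `(h, 0)`. -/
theorem IsMildSolution.mean_state_eq [CompleteSpace H] (hx : N.IsMildSolution P K W T φ x y)
    {SA : ℝ → StrongDual ℝ V →L[ℝ] StrongDual ℝ V}
    (hSA : IsC0SemigroupGeneratedBy N.graphA SA)
    {S : ℝ → StateSpace H V N.r →L[ℝ] StateSpace H V N.r}
    (hS : IsC0SemigroupGeneratedBy N.graphGenerator S) (hT : 0 ≤ T) (hφ : MemLp φ 2 P)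
    {I : ℝ → Lp (StrongDual ℝ V) 2 P}
    (hmild : ∀ t ∈ Icc (0 : ℝ) T, ∀ᵐ ω ∂P, N.toDual (y t ω) = SA t (N.toDual (φ ω).fst)
        + (∫ s in (0 : ℝ)..t, SA (t - s) (N.delayF (fun σ => x σ ω) s)) + I t ω)
    (ξ : Lp ℝ 2 P) {h : ℝ → H} (hh : IntegrableOn h (Ioc 0 T))
    (hI : ∀ t ∈ Icc (0 : ℝ) T, lpMean P ξ (I t) = ∫ s in (0 : ℝ)..t, SA (t - s) (N.toDual (h s)))
    {t : ℝ} (ht : t ∈ Icc (0 : ℝ) T) :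
    ∫ ω, ξ ω • N.state x y t ω ∂P = S t (∫ ω, ξ ω • φ ω ∂P)
      + ∫ s in (0 : ℝ)..t, S (t - s) (WithLp.toLp 2 (h s, 0)) := by
  have key := N.mean_state_eq_of_memLp hSA hS hφ (y := y)
    (x := fun s ω => (Icc (-N.r) T).indicator (fun s => x s ω) s)
    (memLp_extension hx.memLp_x) hx.memLp_y ?_ ?_ (I := I) ?_ ξ hh hI t ht
  · rw [← key]
    refine integral_congr_ae (Eventually.of_forall fun ω => ?_)
    have h1 := historySegment_extension (r := N.r) ht fun s => x s ω
    simp only [state]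
    rw [← h1]
  · filter_upwards [hx.initial] with ω hω
    rw [← hω]
    exact historySegment_extension ⟨le_rfl, hT⟩ _
  · filter_upwards [hx.neutral, ae_restrict_mem measurableSet_Icc] with s hs hsT
    filter_upwards [hs] with ω hω
    have h1 := delayD_extension (N := N) hsT fun s => x s ω
    have h2 : (Icc (-N.r) T).indicator (fun s => x s ω) s = x s ω :=
      indicator_of_mem (mem_Icc.2 ⟨by linarith [hsT.1, N.r_pos], hsT.2⟩) _
    rw [hω, h2, ← h1]
  · intro s hs
    filter_upwards [hmild s hs] with ω hω
    rw [hω]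
    congr 2
    refine intervalIntegral.integral_congr fun σ hσ => ?_
    rw [uIcc_of_le hs.1] at hσ
    have h1 := delayF_extension (N := N) (T := T) ⟨hσ.1, hσ.2.trans hs.2⟩ fun s => x s ω
    rw [← h1]

end Extension

end NeutralSystem

/-! ### Reconstruction of the stochastic integral from its covariances -/

section Series

variable {ι E : Type*} [NormedAddCommGroup E] [InnerProductSpace ℝ E] [CompleteSpace E]

/-- A series of pairwise orthogonal vectors that are projections of a fixed vector converges. -/
theorem summable_of_inner_sub_eq_zero {J : ι → E} {Z : E}
    (horth : Pairwise fun k l => inner ℝ (J k) (J l) = (0 : ℝ))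
    (hZ : ∀ k, inner ℝ (J k) (Z - J k) = (0 : ℝ)) : Summable J := by
  have hJZ : ∀ k, inner ℝ (J k) Z = ‖J k‖ ^ 2 := fun k => by
    rw [← real_inner_self_eq_norm_sq, ← sub_eq_zero, ← inner_sub_right, hZ]
  have hfam : OrthogonalFamily ℝ (fun k => Submodule.span ℝ {J k})
      fun k => (Submodule.span ℝ {J k}).subtypeₗᵢ := by
    intro k l hkl v w
    obtain ⟨a, ha⟩ := Submodule.mem_span_singleton.1 v.2
    obtain ⟨b, hb⟩ := Submodule.mem_span_singleton.1 w.2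
    change inner ℝ (v : E) (w : E) = (0 : ℝ)
    rw [← ha, ← hb, real_inner_smul_left,
      real_inner_smul_right, horth hkl, mul_zero, mul_zero]
  have hsum := hfam.summable_iff_norm_sq_summable fun k => ⟨J k, Submodule.mem_span_singleton_self _⟩
  refine hsum.2 (summable_of_sum_le (c := ‖Z‖ ^ 2) (fun k => by positivity) fun s => ?_)
  have h1 : ‖∑ k ∈ s, J k‖ ^ 2 = ∑ k ∈ s, ‖J k‖ ^ 2 := by
    have := hfam.norm_sum (fun k => ⟨J k, Submodule.mem_span_singleton_self _⟩) s
    simpa using this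
  have h2 : inner ℝ (∑ k ∈ s, J k) Z = ∑ k ∈ s, ‖J k‖ ^ 2 := by
    rw [sum_inner]
    exact Finset.sum_congr rfl fun k _ => hJZ k
  have h3 := real_inner_le_norm (∑ k ∈ s, J k) Z
  change ∑ k ∈ s, ‖J k‖ ^ 2 ≤ _
  rw [h2, ← h1] at h3
  rw [← h1]
  have h4 : ‖∑ k ∈ s, J k‖ ≤ ‖Z‖ := by
    rcases (norm_nonneg (∑ k ∈ s, J k)).eq_or_lt with h | h
    · rw [← h]; exact norm_nonneg _
    · rw [sq] at h3
      exact le_of_mul_le_mul_left h3 h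
  gcongr

end Series

section CylindricalIntegral

variable {Ω : Type*} [MeasurableSpace Ω] {P : Measure Ω}
  {U : Type*} [NormedAddCommGroup U] [InnerProductSpace ℝ U]
  {α : ℝ} {K : ℝ → ℝ → ℝ} {W : ℝ → U →L[ℝ] Lp ℝ 2 P} {ι : Type*} {e : ι → U}

/-- The covariance of the noise `W τ (e k)` with a sum of Wiener integrals along an orthonormal
family only sees the `k`-th term. -/
theorem IsRegularVolterraKernel.lpMean_hasSum {E : Type*} [NormedAddCommGroup E] [NormedSpace ℝ E]
    [CompleteSpace E] (hK : IsRegularVolterraKernel α K) (hW : IsCylindricalVolterra K W)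
    (he : Orthonormal ℝ e) {c : ι → ℝ → E} (hc : ∀ k, Continuous (c k)) {t : ℝ} (ht : 0 ≤ t)
    {J : ι → Lp E 2 P} {I : Lp E 2 P}
    (hJ : ∀ k, IsWienerIntegral K (fun s => W s (e k)) ((Ico 0 t).indicator (c k)) (J k))
    (hI : HasSum J I) (τ : ℝ) (k : ι) :
    lpMean P (W τ (e k)) I = ∫ s in (0 : ℝ)..t, kernelCorrelation K τ s • c k s := by
  have h1 := hI.mapL (lpMean P (W τ (e k)))
  have h2 : lpMean P (W τ (e k)) (J k) = ∫ s in (0 : ℝ)..t, kernelCorrelation K τ s • c k s := by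
    rw [hK.lpMean_wienerIntegral_indicator hW τ (e k) (e k) (hc k) ht (hJ k),
      real_inner_self_eq_norm_sq, he.1 k]
    simp
  rw [← h2]
  exact h1.unique (hasSum_single k fun l hl =>
    (hJ l).lpMean_eq_zero fun σ => hW.inner_eq_zero τ σ (he.2 hl.symm))

/-- A random variable that has the covariance with the noise of a stochastic integral, and none
with what is orthogonal to the noise, is this stochastic integral. -/
theorem IsRegularVolterraKernel.exists_hasSum_of_lpMean [IsFiniteMeasure P] {E : Type*}
    [NormedAddCommGroup E] [InnerProductSpace ℝ E] [CompleteSpace E] (hK : IsRegularVolterraKernel α K)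
    (hW : IsCylindricalVolterra K W) (he : Orthonormal ℝ e) {c : ι → ℝ → E}
    (hc : ∀ k, Continuous (c k)) {t : ℝ} (ht : 0 ≤ t) {Z : Lp E 2 P}
    (hZ : ∀ τ k, lpMean P (W τ (e k)) Z = ∫ s in (0 : ℝ)..t, kernelCorrelation K τ s • c k s)
    (hZ' : ∀ ξ, (∀ τ k, inner ℝ ξ (W τ (e k)) = (0 : ℝ)) → lpMean P ξ Z = 0) :
    ∃ J : ι → Lp E 2 P,
      (∀ k, IsWienerIntegral K (fun s => W s (e k)) ((Ico 0 t).indicator (c k)) (J k)) ∧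
      HasSum J Z := by
  choose J hJ using fun k => hK.exists_wienerIntegral_indicator hW (e k) (hc k) ht
  refine ⟨J, hJ, ?_⟩
  have hcov : ∀ τ k, lpMean P (W τ (e k)) (J k) = lpMean P (W τ (e k)) Z := fun τ k => by
    rw [hZ, hK.lpMean_wienerIntegral_indicator hW τ (e k) (e k) (hc k) ht (hJ k),
      real_inner_self_eq_norm_sq, he.1 k]
    simp
  have hcov' : ∀ τ k l, k ≠ l → lpMean P (W τ (e k)) (J l) = 0 := fun τ k l hkl =>
    (hJ l).lpMean_eq_zero fun σ => hW.inner_eq_zero τ σ (he.2 hkl)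
  -- The `J k` are pairwise orthogonal and `Z - J k` is orthogonal to `J k`.
  have hsum : Summable J := summable_of_inner_sub_eq_zero (Z := Z)
    (fun k l hkl => (hJ k).inner_eq_zero fun τ => hcov' τ k l hkl)
    (fun k => (hJ k).inner_eq_zero fun τ => by rw [map_sub, hcov, sub_self])
  obtain ⟨J', hJ'⟩ := hsum
  suffices h : Z - J' = 0 by rwa [sub_eq_zero.1 h]
  refine eq_zero_of_lpMean_eq_zero fun ξ => ?_
  -- split `ξ` along the closed span of the noise
  set M : Submodule ℝ (Lp ℝ 2 P) :=
    (Submodule.span ℝ (range fun p : ℝ × ι => W p.1 (e p.2))).topologicalClosure with hM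
  have hMc : IsClosed (M : Set (Lp ℝ 2 P)) := Submodule.isClosed_topologicalClosure _
  have : CompleteSpace M := hMc.completeSpace_coe
  have hmem : ∀ τ k, W τ (e k) ∈ M := fun τ k =>
    Submodule.le_topologicalClosure _ (Submodule.subset_span ⟨(τ, k), rfl⟩)
  have h1 : ∀ η ∈ M, lpMean P η (Z - J') = 0 := by
    have hker : M ≤ ((lpMean P : Lp ℝ 2 P →L[ℝ] Lp E 2 P →L[ℝ] E).flip (Z - J')).ker := by
      refine Submodule.topologicalClosure_minimal _ ?_ (ContinuousLinearMap.isClosed_ker _)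
      rw [Submodule.span_le]
      rintro _ ⟨⟨τ, k⟩, rfl⟩
      change lpMean P (W τ (e k)) (Z - J') = 0
      rw [map_sub, sub_eq_zero, ← hcov]
      refine HasSum.unique ?_ (hJ'.mapL (lpMean P (W τ (e k))))
      exact hasSum_single k fun l hl => hcov' τ k l hl.symm
    intro η hη
    exact hker hη
  have h2 : ∀ η ∈ Mᗮ, lpMean P η (Z - J') = 0 := by
    intro η hη
    have h3 : ∀ τ k, inner ℝ η (W τ (e k)) = (0 : ℝ) := fun τ k => by
      rw [real_inner_comm]
      exact hη _ (hmem τ k)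
    rw [map_sub, hZ' η h3, zero_sub, neg_eq_zero]
    refine HasSum.unique (hJ'.mapL (lpMean P η)) ?_
    rw [show (fun k => lpMean P η (J k)) = fun _ => 0 from
      funext fun k => (hJ k).lpMean_eq_zero fun τ => h3 τ k]
    exact hasSum_zero
  obtain ⟨η, hη, ζ, hζ, rfl⟩ := M.exists_add_mem_mem_orthogonal ξ
  rw [map_add, add_apply, h1 η hη, h2 ζ hζ, add_zero]

end CylindricalIntegral

section SemigroupIntegrand

variable {E : Type*} [NormedAddCommGroup E] [NormedSpace ℝ E]

theorem indicator_convolution_integrand (S : ℝ → E →L[ℝ] E) (v : E) (t : ℝ) :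
    (Ico 0 t).indicator (fun s => S (t - s) v) = (Ico 0 t).indicator fun s => S (max (t - s) 0) v :=
  indicator_congr fun s hs => by rw [max_eq_left (by linarith [hs.2])]

theorem IsC0SemigroupGeneratedBy.continuous_convolution_integrand [CompleteSpace E]
    {𝒢 : Set (E × E)} {S : ℝ → E →L[ℝ] E} (hS : IsC0SemigroupGeneratedBy 𝒢 S) (v : E) (t : ℝ) :
    Continuous fun s => S (max (t - s) 0) v :=
  hS.continuous_uncurry.comp (by fun_prop : Continuous fun s => (t - s, v))

theorem integral_correlation_convolution (K : ℝ → ℝ → ℝ) (S : ℝ → E →L[ℝ] E) (τ : ℝ) (v : E)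
    {t : ℝ} (ht : 0 ≤ t) :
    ∫ s in (0 : ℝ)..t, kernelCorrelation K τ s • S (max (t - s) 0) v
      = ∫ s in (0 : ℝ)..t, S (t - s) (kernelCorrelation K τ s • v) := by
  refine intervalIntegral.integral_congr fun s hs => ?_
  rw [uIcc_of_le ht] at hs
  rw [max_eq_left (by linarith [hs.2]), map_smul]

end SemigroupIntegrand

end

theorem proposition3p1
    {Ω : Type*} [MeasurableSpace Ω] (P : Measure Ω) [IsProbabilityMeasure P]
    {U V H : Type*}
    [NormedAddCommGroup U] [InnerProductSpace ℝ U] [CompleteSpace U]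
    [TopologicalSpace.SeparableSpace U]
    [NormedAddCommGroup V] [InnerProductSpace ℝ V] [CompleteSpace V]
    [TopologicalSpace.SeparableSpace V]
    [NormedAddCommGroup H] [InnerProductSpace ℝ H] [CompleteSpace H]
    (N : NeutralSystem U V H)
    (α : ℝ) (K : ℝ → ℝ → ℝ) (hK : IsRegularVolterraKernel α K)
    (W : ℝ → U →L[ℝ] Lp ℝ 2 P) (hW : IsCylindricalVolterra K W)
    (T : ℝ) (hT : 0 ≤ T)
    (φ : Ω → StateSpace H V N.r) (hφ : MemLp φ 2 P)
    (x : ℝ → Ω → V) (y : ℝ → Ω → H)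
    (hx : N.IsMildSolution P K W T φ x y) :
    IsMildCauchySolution K W N.graphGenerator N.liftedNoise T φ (N.state x y) := by
  obtain ⟨B, c, ω, Λ, hmax⟩ := N.exists_isMaximalQuasiDissipative
  obtain ⟨S, hS⟩ := hmax.exists_semigroup
  obtain ⟨SA, hSA, hmild⟩ := hx.mild
  choose! I hI hmildI using hmild
  refine ⟨S, hS, fun t ht => ?_⟩
  have hSφ : MemLp (fun ω => S t (φ ω)) 2 P := (S t).comp_memLp' hφ
  -- The candidate for the stochastic integral is what the variation of constants formula leaves.
  have hZ : MemLp (fun ω => N.state x y t ω - S t (φ ω)) 2 P := (hx.memLp_state ht).sub hSφ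
  have hmeanZ : ∀ ξ, lpMean P ξ hZ.toLp
      = (∫ ω, ξ ω • N.state x y t ω ∂P) - S t (∫ ω, ξ ω • φ ω ∂P) := by
    intro ξ
    rw [map_integral_lp_smul _ _ hφ, ← integral_sub (integrable_lp_smul ξ (hx.memLp_state ht))
      (integrable_lp_smul ξ hSφ), lpMean_apply]
    refine integral_congr_ae ?_
    filter_upwards [hZ.coeFn_toLp] with ω h
    rw [h, smul_sub]
  refine ⟨hZ.toLp, fun w e => ?_, ?_⟩
  · choose! J hJ hJI using fun t ht => hI t ht w e
    -- Truncating the time at zero does not change the integrand and makes it continuous.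
    have hJ' : ∀ t ∈ Icc 0 T, ∀ k, IsWienerIntegral K (fun s => W s (e k))
        ((Ico 0 t).indicator fun s => SA (max (t - s) 0) (N.toDual (N.Φ (e k)))) (J t k) :=
      fun t ht k => by
        rw [← indicator_convolution_integrand]
        exact hJ t ht k
    have hmean : ∀ ξ {h : ℝ → H}, IntegrableOn h (Ioc 0 T) →
        (∀ t ∈ Icc (0 : ℝ) T, lpMean P ξ (I t) = ∫ s in (0 : ℝ)..t, SA (t - s) (N.toDual (h s))) →
        lpMean P ξ hZ.toLp = ∫ s in (0 : ℝ)..t, S (t - s) (WithLp.toLp 2 (h s, 0)) := by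
      intro ξ h hh hIh
      rw [hmeanZ, hx.mean_state_eq hSA hS hT hφ hmildI ξ hh hIh ht, add_sub_cancel_left]
    suffices h : ∃ L : w → Lp (StateSpace H V N.r) 2 P, (∀ k, IsWienerIntegral K (fun s => W s (e k))
        ((Ico 0 t).indicator fun s => S (max (t - s) 0) (N.liftedNoise (e k))) (L k)) ∧
        HasSum L hZ.toLp by
      obtain ⟨L, hL, hLZ⟩ := h
      refine ⟨L, fun k => ?_, hLZ⟩
      have h1 := hL k
      rw [← indicator_convolution_integrand] at h1
      exact h1
    refine hK.exists_hasSum_of_lpMean hW e.orthonormal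
      (c := fun k s => S (max (t - s) 0) (N.liftedNoise (e k)))
      (fun k => hS.continuous_convolution_integrand _ t) ht.1 (Z := hZ.toLp) ?_ ?_
    -- For `ξ = W τ (e k)` the noise acts as the deterministic forcing `h = kernelCorrelation K τ • Φ (e k)`.
    · intro τ k
      have hg : IntegrableOn (fun s => kernelCorrelation K τ s • N.Φ (e k)) (Ioc 0 T) :=
        ((hK.integrableOn_kernelCorrelation τ 0 T).mono_set Ioc_subset_Icc_self).smul_const _
      rw [integral_correlation_convolution _ _ _ _ ht.1, hmean (W τ (e k)) hg]
      · refine intervalIntegral.integral_congr fun s _ => ?_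
        simp only [NeutralSystem.liftedNoise, ← WithLp.toLp_smul, Prod.smul_mk, smul_zero]
      · intro s hs
        rw [hK.lpMean_hasSum hW e.orthonormal
          (fun k => hSA.continuous_convolution_integrand _ s) hs.1 (hJ' s hs) (hJI s hs) τ k,
          integral_correlation_convolution _ _ _ _ hs.1]
        simp only [N.toDual_smul]
    -- For `ξ` orthogonal to the noise the forcing vanishes.
    · intro ξ hξ
      rw [hmean ξ (h := fun _ => 0) (integrable_zero _ _ _)]
      · have h0 : (WithLp.toLp 2 ((0 : H), (0 : SegmentSpace V N.r)) : StateSpace H V N.r) = 0 := rfl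
        simp [h0]
      · intro s hs
        have h1 := (hJI s hs).mapL (lpMean P ξ)
        have h2 : ∀ l, lpMean P ξ (J s l) = 0 := fun l =>
          (hJ' s hs l).lpMean_eq_zero fun σ => hξ σ l
        simp only [h2] at h1
        have h3 : N.toDual (0 : H) = 0 := N.toDualL.map_zero
        rw [h1.unique hasSum_zero]
        simp [h3]
  · filter_upwards [hZ.coeFn_toLp] with ω h
    rw [h]
    abel
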